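/- **Setting.** Let $\mathcal X,\Xi$ be Polish spaces, let $\varpi\in\mathcal X$ be an isolated point (cemetery state), and let $S^{\sqcup}(\mathcal Z)=\bigsqcup_{n\ge0}\mathcal Z^n/\mathfrak S_n$ be the space of finite unordered sequences in $\mathcal Z$, with $|z|$ the length of $z$ and $\langle z_A\rangle$ the unordered sequence of $(z_v)_{v\in A}$. Let $\mathbb V=\{ø\}\cup\bigcup_{k\ge1}\mathbb N^k$ ($\mathbb N=\{1,2,\dots\}$) be the Ulam–Harris–Neveu labels with concatenation, $\mathbb V^0=\mathbb V\setminus\{ø\}$, $\mathbb V_1=\{ø\}\cup\mathbb N$, $\pi_v$ the parent of $v\in\mathbb V^0$, $\mathbb V_{v+}$ the set of strict descendants of $v$, and $\mathbb V_{v-}=\mathbb V\setminus(\mathbb V_{v+}\cup\{v,\pi_v\})$. For a tree $\mathcal T\subset\mathbb V$ let $N_v(\mathcal T)$ be the set of neighbors of $v$ in $\mathcal T$, with $N_v(\mathcal T)=\emptyset$ if $v\notin\mathcal T$. Write $X_v[k]=(X_v(0),\dots,X_v(k))$ and $Y_v(0)=(1_{\{v\in\mathcal T\}},X_v(0))$.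 **Assumptions.** Let $\rho_ø$ be a probability measure on $\mathbb N_0$ with finite first moment. On a probability space let $\mathcal T\sim\mathrm{UGW}(\rho_ø)$: a Galton–Watson tree in which the root has offspring law $\rho_ø$ and all other vertices have offspring law $\rho(k)=(k+1)\rho_ø(k+1)/\sum_n n\rho_ø(n)$ (if $\rho_ø=\delta_0$, then $\rho$ is arbitrary, as $\mathcal T=\{ø\}$ a.s.). Let $X_v(0)$, $v\in\mathbb V$, be $\mathcal X$-valued and $\xi_v(k)$, $v\in\mathbb V,\,k\ge1$, be $\Xi$-valued random variables, such that: 1. (a) for $v\in\mathbb V^0$, $(Y_u(0))_{u\in\mathbb V_{v+}}$ and $(Y_u(0))_{u\in\mathbb V_{v-}}$ are conditionally independent given $(Y_v(0),Y_{\pi_v}(0))$; (b) the conditional law of $(Y_{vu}(0))_{u\in\mathbb V^0}$ given $(Y_v(0),Y_{\pi_v}(0))$ does not depend on $v\in\mathbb V^0$: one probability kernel is a version of it for all $v$; (c) for $n\ge1$ with $\mathbb P(|N_ø(\mathcal T)|=n)>0$ and each permutation $\pi$ of $\{1,\dots,n\}$, the law of $(Y_ø(0),(Y_{\pi(1)v}(0))_{v\in\mathbb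 V},\dots,(Y_{\pi(n)v}(0))_{v\in\mathbb V})$ given $|N_ø(\mathcal T)|=n$ is the same as for $\pi=\mathrm{id}$; (d) the rooted marked graph $(\mathcal T,X_{\mathcal T}(0),ø)$ is unimodular: $\mathbb E\sum_{u\in\mathcal T}f(\mathcal T,X_{\mathcal T}(0),ø,u)=\mathbb E\sum_{u\in\mathcal T}f(\mathcal T,X_{\mathcal T}(0),u,ø)$ for every bounded nonnegative Borel function $f$ on the space of isomorphism classes of doubly rooted, connected, locally finite $\mathcal X$-marked graphs (local topology). 2. The $\xi_v(k)$ are i.i.d. 3. $(\mathcal T,(X_v(0))_{v\in\mathbb V})$ is independent of $(\xi_v(k))_{v,k}$. 4. For each $k\ge0$, $F^k:\mathcal X^{k+1}\times S^{\sqcup}(\mathcal X^{k+1})\times\Xi\to\mathcal X\setminus\{\varpi\}$ is measurable. 5. For each $v\in\mathbb V$, a.s. $X_v(0)=\varpi$ if and only if $v\notin\mathcal T$. Define $X_v(k+1)=F^k(X_v[k],\langle X_{N_v(\mathcal T)}[k]\rangle,\xi_v(k+1))$ if $v\in\mathcal T$, and $X_v(k+1)=\varpi$ if $v\notin\mathcal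 T$, for $k\ge0$. **Reduced local-field process.** On some probability space, consider a random tree $\bar{\mathcal T}$, $\mathcal X$-valued $\bar X_v(k)$ ($v\in\mathbb V_1$) and $\mathbb N_0$-valued $\hat N(k)$, $k\ge0$, such that $(\bar{\mathcal T},\bar X_{\mathbb V_1}(0),\hat N(0))\overset d=(\mathcal T\cap\mathbb V_1,X_{\mathbb V_1}(0),|N_1(\mathcal T)|)$ and, for each $k\ge0$: * $\bar\gamma[k]$ is a probability kernel from $(\mathcal X^{k+1})^2$ to $S^{\sqcup}(\mathcal X^{k+1})$ with, for Borel $B$ and a.e. $(x_ø,x_1)$ with respect to the law of $(\bar X_ø[k],\bar X_1[k])$, $$\bar\gamma[k](B\mid x_ø,x_1)=\frac{\mathbb E\big[\tfrac{|N_ø(\bar{\mathcal T})|}{\hat N(k)}1_{\{\langle\bar X_{N_ø(\bar{\mathcal T})}[k]\rangle\in B\}}\,\big|\,\bar X_ø[k]=x_ø,\bar X_1[k]=x_1\big]}{\mathbb E\big[\tfrac{|N_ø(\bar{\mathcal T})|}{\hat N(k)}\,\big|\,\bar X_ø[k]=x_ø,\bar X_1[k]=x_1\big]},\qquad \tfrac00:=1;$$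 * $\bar Z^k_v$, $v\in\mathbb N$, are $S^{\sqcup}(\mathcal X^{k+1})$-valued random variables with, for Borel sets $B_v$, $$\mathbb P\big(\bar Z^k_v\in B_v\ \forall v\in N_ø(\bar{\mathcal T})\,\big|\,\bar{\mathcal T},\bar X_{\mathbb V_1}[k]\big)=\prod_{v\in N_ø(\bar{\mathcal T})}\bar\gamma[k](B_v\mid\bar X_v[k],\bar X_ø[k])\quad\text{a.s.};$$ * $(\bar\xi_v(k+1))_{v\in\mathbb V_1}$ are i.i.d. with the law of $\xi_ø(1)$, and are independent of $(\bar{\mathcal T},\bar X_{\mathbb V_1}[k],(\bar Z^k_v)_{v\in\mathbb N})$; * a.s., $\bar X_ø(k+1)=F^k(\bar X_ø[k],\langle\bar X_{N_ø(\bar{\mathcal T})}[k]\rangle,\bar\xi_ø(k+1))$; for $v\in\mathbb N$, $\bar X_v(k+1)=F^k(\bar X_v[k],\bar Z^k_v,\bar\xi_v(k+1))$ if $v\in\bar{\mathcal T}$ and $\bar X_v(k+1)=\varpi$ otherwise; and $\hat N(k+1)=|\bar Z^k_1|$ if $\bar{\mathcal T}\ne\{ø\}$, while $\hat N(k+1)=0$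 if $\bar{\mathcal T}=\{ø\}$. **Theorem.** Such a process exists, and for every such process and every $k\in\mathbb N_0$, $$\big((1_{\{v\in\mathcal T\}},X_v[k])_{v\in\mathbb V_1},\,|N_1(\mathcal T)|\big)\overset d=\big((1_{\{v\in\bar{\mathcal T}\}},\bar X_v[k])_{v\in\mathbb V_1},\,\hat N(k)\big).$$ In particular, $(1_{\{v\in\mathcal T\}},(X_v(k))_{k\ge0})_{v\in\mathbb V_1}$ and $(1_{\{v\in\bar{\mathcal T}\}},(\bar X_v(k))_{k\ge0})_{v\in\mathbb V_1}$ have the same law. -/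

import Mathlib

open MeasureTheory ProbabilityTheory
open scoped ENNReal NNReal

universe u w

/-! ### Unordered finite sequences -/

/-- Finite unordered sequences, of arbitrary length, of elements of `Z`: the disjoint union over `n`
of the quotients of `Z ^ n` by the symmetric group. -/
def Unordered (Z : Type*) : Type _ := Multiset Z

namespace Unordered

/-- The unordered sequence `⟨(z i)_{i ∈ s}⟩`. -/
def ofFinset {ι Z : Type*} (s : Finset ι) (z : ι → Z) : Unordered Z := Multiset.map z s.val

/-- The length of an unordered sequence. -/
def length {Z : Type*} (z : Unordered Z) : ℕ := Multiset.card z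

/-- A set is measurable if and only if its preimage in every `Z ^ n` is. For Polish `Z` this is the
Borel σ-algebra of the disjoint union of the quotient topologies. -/
instance {Z : Type*} [MeasurableSpace Z] : MeasurableSpace (Unordered Z) :=
  ⨅ n : ℕ, MeasurableSpace.map
    (fun z : Fin n → Z => ofFinset (Finset.univ : Finset (Fin n)) z) MeasurableSpace.pi

end Unordered

/-! ### Ulam-Harris-Neveu trees -/

/-- The labels: finite words in the positive integers. The root is the empty word, concatenation
is `++`, the children of `v` are the words `v ++ [k]`, and the parent of `v ≠ []` is
`v.dropLast`. -/
abbrev UHLabel : Type := List ℕ+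

/-- The labels of the root and of the first generation. -/
abbrev UHLabel₁ : Type := {v : UHLabel // v.length ≤ 1}

def UHLabel₁.root : UHLabel₁ := ⟨[], by simp⟩

def UHLabel₁.child (j : ℕ+) : UHLabel₁ := ⟨[j], by simp⟩

/-- The labels other than the root. -/
abbrev UHLabel₀ : Type := {v : UHLabel // v ≠ []}

/-- The strict descendants of `v`. -/
def UHLabel.above (v : UHLabel) : Set UHLabel := {u | ∃ w : UHLabel, w ≠ [] ∧ u = v ++ w}

/-- All labels except `v`, its parent, and the strict descendants of `v`. -/
def UHLabel.below (v : UHLabel) : Set UHLabel := (UHLabel.above v ∪ {v, v.dropLast})ᶜ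

structure IsUHTree (s : Set UHLabel) : Prop where
  root_mem : [] ∈ s
  mem_of_append_mem : ∀ u w : UHLabel, u ++ w ∈ s → u ∈ s
  children : ∀ v ∈ s, ∃ c : ℕ, ∀ k : ℕ+, v ++ [k] ∈ s ↔ (k : ℕ) ≤ c

/-- Trees, with the σ-algebra generated by the events `v ∈ T`. -/
abbrev UHTree : Type := {s : Set UHLabel // IsUHTree s}

namespace UHTree

/-- The edges of a tree join a vertex with its children. -/
def Adj (T : UHTree) (u v : UHLabel) : Prop :=
  u ∈ T.1 ∧ v ∈ T.1 ∧ ((∃ k, v = u ++ [k]) ∨ (∃ k, u = v ++ [k]))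

theorem finite_children (T : UHTree) (v : UHLabel) : {k : ℕ+ | v ++ [k] ∈ T.1}.Finite := by
  by_cases hv : v ∈ T.1
  · obtain ⟨c, hc⟩ := T.2.children v hv
    refine Set.Finite.of_finite_image (f := fun k : ℕ+ => (k : ℕ)) ?_ PNat.coe_injective.injOn
    refine (Set.finite_Iic c).subset ?_
    rintro _ ⟨k, hk, rfl⟩
    exact (hc k).1 hk
  · convert Set.finite_empty
    ext k
    simp only [Set.mem_ofPred_eq, Set.mem_empty_iff_false, iff_false]
    exact fun h => hv (T.2.mem_of_append_mem _ _ h)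

theorem finite_neighbors (T : UHTree) (v : UHLabel) : {u | T.Adj v u}.Finite := by
  refine (((T.finite_children v).image (fun k => v ++ [k])).union
    (Set.finite_singleton v.dropLast)).subset ?_
  rintro u ⟨-, hu, ⟨k, rfl⟩ | ⟨k, rfl⟩⟩
  · exact Or.inl ⟨k, hu, rfl⟩
  · right; simp

/-- The neighbors of `v` in `T`; there are none if `v` is not a vertex of `T`. -/
noncomputable def nbhd (T : UHTree) (v : UHLabel) : Finset UHLabel := (T.finite_neighbors v).toFinset

/-- The first-generation vertices `j ∈ ℕ` of `T`, that is, the neighbors `[j]` of the root. -/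
noncomputable def rootChildren (T : UHTree) : Finset ℕ+ := (T.finite_children []).toFinset

/-- The tree formed by the root of `T` and its children. -/
def trunc₁ (T : UHTree) : UHTree := ⟨{v | v ∈ T.1 ∧ v.length ≤ 1}, by
  refine ⟨⟨T.2.root_mem, by simp⟩, ?_, ?_⟩
  · rintro u w ⟨h, hl⟩
    refine ⟨T.2.mem_of_append_mem u w h, ?_⟩
    simp only [List.length_append] at hl
    omega
  · rintro v ⟨hv, hl⟩
    by_cases h : v = []
    · subst h
      obtain ⟨c, hc⟩ := T.2.children [] hv
      exact ⟨c, fun k => by simpa using hc k⟩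
    · have : 0 < v.length := List.length_pos_iff.2 h
      refine ⟨0, fun k => ⟨fun hk => ?_, fun hk => absurd k.pos (by omega)⟩⟩
      have := hk.2
      simp only [List.length_append, List.length_singleton] at this
      omega⟩

/-- The tree in which each vertex `v` has `c v` children. -/
def ofOffspring (c : UHLabel → ℕ) : UHTree :=
  ⟨{v | ∀ (u : UHLabel) (k : ℕ+) (w : UHLabel), v = u ++ k :: w → (k : ℕ) ≤ c u}, by
    refine ⟨?_, ?_, ?_⟩
    · intro u k w h
      simp at h
    · intro u x h u' k w hu
      exact h u' k (w ++ x) (by simp [hu])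
    · intro v hv
      refine ⟨c v, fun k => ⟨fun h => h v k [] rfl, fun hk u j w h => ?_⟩⟩
      rcases List.eq_nil_or_concat w with rfl | ⟨w', a, rfl⟩
      · have := List.append_inj' h rfl
        simp only [List.cons.injEq, and_true] at this
        rw [← this.1, ← this.2]
        exact hk
      · have h' : v ++ [k] = (u ++ j :: w') ++ [a] := by simpa using h
        exact hv u j w' (List.append_inj' h' rfl).1⟩

theorem measurable_ofOffspring : Measurable ofOffspring := by
  refine Measurable.subtype_mk ?_
  refine measurable_pi_iff.2 fun v => ?_
  change Measurable fun c : UHLabel → ℕ =>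
    ∀ (u : UHLabel) (k : ℕ+) (w : UHLabel), v = u ++ k :: w → (k : ℕ) ≤ c u
  refine Measurable.forall fun u => Measurable.forall fun k => Measurable.forall fun w =>
    Measurable.imp measurable_const ?_
  exact measurableSet_setOfPred.1 (measurableSet_le measurable_const (measurable_pi_apply u))

/-- The Galton-Watson law: offspring numbers are independent, with law `ρ₀` at the root and `ρ` at
all other vertices. -/
noncomputable def gwLaw (ρ₀ ρ : PMF ℕ) : Measure UHTree :=
  (Measure.infinitePi fun v : UHLabel => (if v = [] then ρ₀ else ρ).toMeasure).map ofOffspring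

end UHTree

/-- `ρ₀` has a finite first moment `m`, and `ρ k = (k + 1) * ρ₀ (k + 1) / m` for all `k`. In the
degenerate case `m = 0`, where the quotient is undefined and the tree has no vertex other than the
root, `ρ` is not restricted. -/
def IsUnimodularOffspring (ρ₀ ρ : PMF ℕ) : Prop :=
  ∑' n : ℕ, (n : ℝ≥0∞) * ρ₀ n ≠ ∞ ∧
    ∀ k : ℕ, ρ k * ∑' n : ℕ, (n : ℝ≥0∞) * ρ₀ n = ((k + 1 : ℕ) : ℝ≥0∞) * ρ₀ (k + 1)

/-! ### Marked graphs and unimodularity -/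

/-- A countable, connected, locally finite graph with marks in `Z`. Its vertex set is a subset of
the countably infinite set `UHLabel`, so that every countable graph has an isomorphic copy of this
form. The values of `mark` outside the vertex set play no role. -/
structure MarkedGraph (Z : Type*) where
  graph : (⊤ : SimpleGraph UHLabel).Subgraph
  connected : graph.Connected
  locallyFinite : ∀ v, (graph.neighborSet v).Finite
  mark : UHLabel → Z

/-- A marked graph with two (possibly equal) roots. -/
structure DoublyRooted (Z : Type*) extends MarkedGraph Z where
  root : graph.verts
  root' : graph.verts

namespace DoublyRooted

/-- The σ-algebra generated by the vertex indicators, the edge indicators, the marks and the two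
roots. -/
instance {Z : Type*} [MeasurableSpace Z] : MeasurableSpace (DoublyRooted Z) :=
  MeasurableSpace.comap
    (fun g => ((fun v => v ∈ g.graph.verts, fun p => g.graph.Adj p.1 p.2, g.mark,
        fun v => g.root.1 = v, fun v => g.root'.1 = v) :
      (UHLabel → Prop) × (UHLabel × UHLabel → Prop) × (UHLabel → Z) ×
        (UHLabel → Prop) × (UHLabel → Prop)))
    inferInstance

/-- Isomorphism: a graph isomorphism that respects both roots and the marks. -/
def Iso {Z : Type*} (g h : DoublyRooted Z) : Prop :=
  ∃ φ : g.graph.coe ≃g h.graph.coe, φ g.root = h.root ∧ φ g.root' = h.root' ∧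
    ∀ v : g.graph.verts, h.mark (φ v) = g.mark v

instance setoid (Z : Type*) : Setoid (DoublyRooted Z) where
  r := Iso
  iseqv := by
    refine ⟨fun g => ⟨SimpleGraph.Iso.refl, rfl, rfl, fun _ => rfl⟩, ?_, ?_⟩
    · rintro g h ⟨φ, h1, h2, h3⟩
      refine ⟨φ.symm, ?_, ?_, fun v => ?_⟩
      · rw [← h1]; exact φ.symm_apply_apply _
      · rw [← h2]; exact φ.symm_apply_apply _
      · have := h3 (φ.symm v)
        rw [← this]
        exact congrArg (fun w : h.graph.verts => h.mark w) (φ.apply_symm_apply v)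
    · rintro g h k ⟨φ, h1, h2, h3⟩ ⟨ψ, k1, k2, k3⟩
      refine ⟨φ.trans ψ, ?_, ?_, fun v => ?_⟩
      · rw [← k1, ← h1]; rfl
      · rw [← k2, ← h2]; rfl
      · rw [← h3 v, ← k3 (φ v)]; rfl

end DoublyRooted

/-- The space of isomorphism classes of doubly rooted marked graphs, with the quotient σ-algebra
(a set of classes is measurable if and only if the set of their representatives is). For Polish `Z`
this is the Borel σ-algebra of the topology of local convergence. -/
abbrev DoublyRootedClass (Z : Type*) : Type _ := Quotient (DoublyRooted.setoid Z)

/-- The random rooted marked graph `(G, o)` is unimodular: for all bounded nonnegative measurable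
`f`, `𝔼 ∑_{u ∈ G} f (G, o, u) = 𝔼 ∑_{u ∈ G} f (G, u, o)`. -/
def IsUnimodular {Ω Z : Type*} [MeasurableSpace Ω] [MeasurableSpace Z] (P : Measure Ω)
    (G : Ω → MarkedGraph Z) (o : (ω : Ω) → (G ω).graph.verts) : Prop :=
  ∀ f : DoublyRootedClass Z → ℝ≥0∞, Measurable f → (∃ C : ℝ≥0, ∀ g, f g ≤ C) →
    ∫⁻ ω, ∑' u : (G ω).graph.verts, f ⟦⟨G ω, o ω, u⟩⟧ ∂P =
      ∫⁻ ω, ∑' u : (G ω).graph.verts, f ⟦⟨G ω, u, o ω⟩⟧ ∂P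

namespace UHTree

/-- The tree as a graph on its vertex set. -/
def toSubgraph (T : UHTree) : (⊤ : SimpleGraph UHLabel).Subgraph where
  verts := T.1
  Adj := T.Adj
  adj_sub := by
    rintro u v ⟨-, -, ⟨k, rfl⟩ | ⟨k, rfl⟩⟩ <;> simp
  edge_vert := fun h => h.1
  symm := ⟨fun _ _ h => ⟨h.2.1, h.1, h.2.2.symm⟩⟩

theorem toSubgraph_connected (T : UHTree) : T.toSubgraph.Connected := by
  have key : ∀ (v : UHLabel) (hv : v ∈ T.1),
      T.toSubgraph.coe.Reachable ⟨[], T.2.root_mem⟩ ⟨v, hv⟩ := by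
    intro v
    induction v using List.reverseRecOn with
    | nil => intro hv; exact SimpleGraph.Reachable.refl _
    | append_singleton u k ih =>
      intro hv
      have hu := T.2.mem_of_append_mem _ _ hv
      refine (ih hu).trans (SimpleGraph.Adj.reachable ?_)
      exact ⟨hu, hv, Or.inl ⟨k, rfl⟩⟩
  refine ⟨?_⟩
  have : Nonempty T.toSubgraph.verts := ⟨⟨[], T.2.root_mem⟩⟩
  exact ⟨fun a b => (key a.1 a.2).symm.trans (key b.1 b.2)⟩

/-- The tree `T` with marks `x`. -/
def toMarkedGraph {Z : Type*} (T : UHTree) (x : UHLabel → Z) : MarkedGraph Z where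
  graph := T.toSubgraph
  connected := T.toSubgraph_connected
  locallyFinite := T.finite_neighbors
  mark := x

end UHTree

/-! ### Processes on trees -/

/-- Conditional independence of `f` and `g` given `h`. -/
def CondIndepGiven {Ω α β γ : Type*} [MeasurableSpace Ω] [MeasurableSpace α] [MeasurableSpace β]
    [mγ : MeasurableSpace γ] (P : Measure Ω) (f : Ω → α) (g : Ω → β) (h : Ω → γ) : Prop :=
  ∀ A B, MeasurableSet A → MeasurableSet B →
    P⟦f ⁻¹' A ∩ g ⁻¹' B | mγ.comap h⟧ =ᵐ[P]
      fun ω => (P⟦f ⁻¹' A | mγ.comap h⟧) ω * (P⟦g ⁻¹' B | mγ.comap h⟧) ω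

/-- The trajectory `X_v[k] = (X_v(0), …, X_v(k))` of the process `X` at the site `v`. -/
def traj {Ω 𝒳 I : Type*} (X : I → ℕ → Ω → 𝒳) (v : I) (k : ℕ) (ω : Ω) : Fin (k + 1) → 𝒳 :=
  fun i => X v i ω

/-- The pair `Y_v(0) = (1_{v ∈ T}, X_v(0))`; the indicator is represented by the proposition
`v ∈ T`. -/
def initPair {Ω 𝒳 : Type*} (T : Ω → UHTree) (X : UHLabel → ℕ → Ω → 𝒳) (v : UHLabel) (ω : Ω) :
    Prop × 𝒳 :=
  (v ∈ (T ω).1, X v 0 ω)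

/-- The assumptions on the tree `T`, the initial states `X_v(0)`, the noises `ξ_v(k)` for `k ≥ 1`,
and the update functions `F^k`. -/
structure UGWCondition {Ω 𝒳 Ξ : Type*} [MeasurableSpace Ω] [MeasurableSpace 𝒳] [MeasurableSpace Ξ]
    (P : Measure Ω) (ϖ : 𝒳) (ρ₀ ρ : PMF ℕ) (T : Ω → UHTree) (X : UHLabel → ℕ → Ω → 𝒳)
    (ξ : UHLabel → ℕ → Ω → Ξ)
    (F : (k : ℕ) → (Fin (k + 1) → 𝒳) → Unordered (Fin (k + 1) → 𝒳) → Ξ → 𝒳) : Prop where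
  measurable_tree : Measurable T
  measurable_init : ∀ v, Measurable (X v 0)
  measurable_noise : ∀ v k, Measurable (ξ v (k + 1))
  /-- `T` is a unimodular Galton-Watson tree. -/
  offspring : IsUnimodularOffspring ρ₀ ρ
  law_tree : P.map T = UHTree.gwLaw ρ₀ ρ
  /-- The initial states form a Markov random field. -/
  markov : ∀ v : UHLabel, v ≠ [] →
    CondIndepGiven P (fun ω (u : UHLabel.above v) => initPair T X u ω)
      (fun ω (u : UHLabel.below v) => initPair T X u ω)
      (fun ω => (initPair T X v ω, initPair T X v.dropLast ω))
  /-- The conditional law of `(Y_{vu}(0))_{u ≠ ø}` given the values of `Y_v(0)` and of `Y` at the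
  parent of `v` does not depend on `v ≠ ø`. -/
  homogeneous : ∃ κ : Kernel ((Prop × 𝒳) × (Prop × 𝒳)) (UHLabel₀ → Prop × 𝒳), IsMarkovKernel κ ∧
    ∀ v : UHLabel, v ≠ [] → ∀ B : Set (UHLabel₀ → Prop × 𝒳), MeasurableSet B →
      P⟦(fun ω (u : UHLabel₀) => initPair T X (v ++ u.1) ω) ⁻¹' B |
          MeasurableSpace.comap (fun ω => (initPair T X v ω, initPair T X v.dropLast ω))
            inferInstance⟧ =ᵐ[P]
        fun ω => (κ (initPair T X v ω, initPair T X v.dropLast ω)).real B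
  /-- Leaf exchangeability: given that the root has `n` children, the law is invariant under
  permutations of the `n` subtrees attached to the root. -/
  exchangeable : ∀ n : ℕ, 1 ≤ n → P {ω | ((T ω).nbhd []).card = n} ≠ 0 →
    ∀ σ : Equiv.Perm (Fin n),
      (P[|{ω | ((T ω).nbhd []).card = n}]).map
          (fun ω => (initPair T X [] ω,
            fun (i : Fin n) (v : UHLabel) => initPair T X ((σ i : ℕ).succPNat :: v) ω)) =
        (P[|{ω | ((T ω).nbhd []).card = n}]).map
          (fun ω => (initPair T X [] ω,
            fun (i : Fin n) (v : UHLabel) => initPair T X ((i : ℕ).succPNat :: v) ω))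
  unimodular : IsUnimodular P (fun ω => (T ω).toMarkedGraph (fun v => X v 0 ω))
    (fun ω => ⟨[], (T ω).2.root_mem⟩)
  indep_noise : iIndepFun (fun (p : UHLabel × ℕ) ω => ξ p.1 (p.2 + 1) ω) P
  identDistrib_noise : ∀ v k, IdentDistrib (ξ v (k + 1)) (ξ [] 1) P P
  indep_init_noise : IndepFun (fun ω => (T ω, fun v => X v 0 ω))
    (fun ω (p : UHLabel × ℕ) => ξ p.1 (p.2 + 1) ω) P
  measurable_update : ∀ k, Measurable
    (fun q : (Fin (k + 1) → 𝒳) × Unordered (Fin (k + 1) → 𝒳) × Ξ => F k q.1 q.2.1 q.2.2)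
  update_ne : ∀ k x z e, F k x z e ≠ ϖ
  init_eq_iff : ∀ v, ∀ᵐ ω ∂P, X v 0 ω = ϖ ↔ v ∉ (T ω).1

open Classical in
/-- The particle system: `X_v(k+1) = F^k(X_v[k], ⟨X_{N_v(T)}[k]⟩, ξ_v(k+1))` at the vertices `v` of
the tree, and `X_v(k+1) = ϖ` at all other labels. -/
def IsParticleSystem {Ω 𝒳 Ξ : Type*} (ϖ : 𝒳) (T : Ω → UHTree) (X : UHLabel → ℕ → Ω → 𝒳)
    (ξ : UHLabel → ℕ → Ω → Ξ)
    (F : (k : ℕ) → (Fin (k + 1) → 𝒳) → Unordered (Fin (k + 1) → 𝒳) → Ξ → 𝒳) : Prop :=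
  ∀ k v ω, X v (k + 1) ω =
    if v ∈ (T ω).1 then
      F k (traj X v k ω)
        (Unordered.ofFinset ((T ω).nbhd v) fun u => traj X u k ω) (ξ v (k + 1) ω)
    else ϖ

/-- The quotient `a / b`, with the convention `0 / 0 = 1`. -/
noncomputable def ratio (a b : ℕ) : ℝ := if a = 0 ∧ b = 0 then 1 else (a : ℝ) / b

/-- The unordered trajectories `⟨X_{N_ø(T)}[k]⟩` of the children of the root. -/
noncomputable def rootNbhdTraj {Ω 𝒳 : Type*} (T : Ω → UHTree) (X : UHLabel₁ → ℕ → Ω → 𝒳) (k : ℕ)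
    (ω : Ω) : Unordered (Fin (k + 1) → 𝒳) :=
  Unordered.ofFinset (T ω).rootChildren fun j => traj X (UHLabel₁.child j) k ω

/-- The kernel `γ` is a version of the size-biased conditional law of `⟨X_{N_ø(T)}[k]⟩`,
`γ(B | x, y) = 𝔼[(|N_ø(T)| / N(k)) 1_{⟨X_{N_ø(T)}[k]⟩ ∈ B} | X_ø[k] = x, X_1[k] = y]
  / 𝔼[|N_ø(T)| / N(k) | X_ø[k] = x, X_1[k] = y]`. -/
def IsPhantomKernel {Ω 𝒳 : Type*} [MeasurableSpace Ω] [MeasurableSpace 𝒳] (P : Measure Ω)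
    (T : Ω → UHTree) (X : UHLabel₁ → ℕ → Ω → 𝒳) (N : ℕ → Ω → ℕ) (k : ℕ)
    (γ : Kernel ((Fin (k + 1) → 𝒳) × (Fin (k + 1) → 𝒳)) (Unordered (Fin (k + 1) → 𝒳))) : Prop :=
  IsMarkovKernel γ ∧
    ∀ B : Set (Unordered (Fin (k + 1) → 𝒳)), MeasurableSet B →
      (fun ω => (γ (traj X .root k ω, traj X (.child 1) k ω)).real B) =ᵐ[P] fun ω =>
        (P[(rootNbhdTraj T X k ⁻¹' B).indicator
              (fun ω => ratio ((T ω).nbhd []).card (N k ω)) |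
            MeasurableSpace.comap (fun ω => (traj X .root k ω, traj X (.child 1) k ω))
              inferInstance]) ω /
          (P[fun ω => ratio ((T ω).nbhd []).card (N k ω) |
            MeasurableSpace.comap (fun ω => (traj X .root k ω, traj X (.child 1) k ω))
              inferInstance]) ω

open Classical in
/-- `(T, X, N)` is a reduced local-field process with update functions `F`, initial law `ν`, noise
law `θ`, noises `ξ`, phantoms `Z` and phantom kernels `γ`. -/
structure IsLocalFieldProcess {Ω 𝒳 Ξ : Type*} [MeasurableSpace Ω] [MeasurableSpace 𝒳]
    [MeasurableSpace Ξ] (P : Measure Ω) (ϖ : 𝒳)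
    (F : (k : ℕ) → (Fin (k + 1) → 𝒳) → Unordered (Fin (k + 1) → 𝒳) → Ξ → 𝒳)
    (ν : Measure (UHTree × (UHLabel₁ → 𝒳) × ℕ)) (θ : Measure Ξ)
    (T : Ω → UHTree) (X : UHLabel₁ → ℕ → Ω → 𝒳) (N : ℕ → Ω → ℕ) (ξ : UHLabel₁ → ℕ → Ω → Ξ)
    (Z : (k : ℕ) → ℕ+ → Ω → Unordered (Fin (k + 1) → 𝒳))
    (γ : (k : ℕ) →
      Kernel ((Fin (k + 1) → 𝒳) × (Fin (k + 1) → 𝒳)) (Unordered (Fin (k + 1) → 𝒳))) : Prop where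
  measurable_tree : Measurable T
  measurable_state : ∀ v k, Measurable (X v k)
  measurable_count : ∀ k, Measurable (N k)
  measurable_noise : ∀ v k, Measurable (ξ v (k + 1))
  measurable_phantom : ∀ k j, Measurable (Z k j)
  /-- Initialization. -/
  law_init : P.map (fun ω => (T ω, fun v => X v 0 ω, N 0 ω)) = ν
  /-- The kernels are computed from the law of the process itself. -/
  kernel : ∀ k, IsPhantomKernel P T X N k (γ k)
  /-- Given `T` and the trajectories up to time `k`, the phantoms of the children `j` of the root
  are independent, with laws `γ[k](· | X_j[k], X_ø[k])`. -/
  law_phantom : ∀ k, ∀ B : ℕ+ → Set (Unordered (Fin (k + 1) → 𝒳)), (∀ j, MeasurableSet (B j)) →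
    P⟦{ω | ∀ j ∈ (T ω).rootChildren, Z k j ω ∈ B j} |
        MeasurableSpace.comap (fun ω => (T ω, fun v => traj X v k ω)) inferInstance⟧ =ᵐ[P]
      fun ω => ∏ j ∈ (T ω).rootChildren,
        (γ k (traj X (.child j) k ω, traj X .root k ω)).real (B j)
  /-- The noises of each step are i.i.d. with law `θ`, and fresh. -/
  indep_noise : ∀ k, iIndepFun (fun v => ξ v (k + 1)) P
  law_noise : ∀ k v, P.map (ξ v (k + 1)) = θ
  fresh_noise : ∀ k, IndepFun (fun ω v => ξ v (k + 1) ω)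
    (fun ω => (T ω, fun v => traj X v k ω, fun j => Z k j ω)) P
  /-- The updates. On `{T = {ø}}` those of `X` read `X_ø(k+1) = F^k(X_ø[k], ∅, ξ_ø(k+1))` and
  `X_j(k+1) = ϖ`. -/
  count_succ : ∀ k, ∀ᵐ ω ∂P,
    N (k + 1) ω = if (T ω).1 = {[]} then 0 else (Z k 1 ω).length
  root_succ : ∀ k, ∀ᵐ ω ∂P,
    X .root (k + 1) ω = F k (traj X .root k ω) (rootNbhdTraj T X k ω) (ξ .root (k + 1) ω)
  child_succ : ∀ k j, ∀ᵐ ω ∂P,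
    X (.child j) (k + 1) ω =
      if [j] ∈ (T ω).1 then F k (traj X (.child j) k ω) (Z k j ω) (ξ (.child j) (k + 1) ω) else ϖ

/-! The particle system itself, observed only at the root and its children, is a reduced local-field
process: its phantoms are the actual unordered trajectories around the children, its count is the
degree of the first child, its noises are the original ones. This gives existence
(`UGWCondition.isLocalFieldProcess`). Conversely, the law of such a process is pinned down by its
initial law and its noise law (`IsLocalFieldProcess.map_fieldState_eq`), so every realization has
the laws of the particle system.

That the particle system qualifies rests on two facts. The first is a Markov property of
trajectories (`UGWCondition.exists_isSubtreeKernel`): given all states outside the strict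
descendants of a child `[j]`, the states of those descendants follow a kernel that reads only the
states of `[j]` and of the root, and is the same for all `j`. At time 0 this is the Markov random
field assumption together with homogeneity. It survives a time step because a subtree and its
outside are driven by disjoint noises and interact only through `[j]` and the root; the new state of
`[j]`, which becomes part of the conditioning, is handled by a disintegration. Applied to one child
after another, the property makes the neighborhoods of the children conditionally independent
(`lintegral_prod_childIndicator`).

The second is mass transport (`lintegral_card_div_card`). Averaging over the noises turns a
functional of the trajectories at two adjacent sites into an isomorphism-invariant function of the
doubly rooted initial graph, to which unimodularity applies. Exchangeability replaces the sum over
the children of the root by |N_ø| times the term of the first child. The outcome, on the event that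
the root has a child, is E[(|N_ø| / |N_1|) f(X_ø, X_1, ⟨X_{N_ø}⟩)] = E[f(X_1, X_ø, ⟨X_{N_1}⟩)].
Hence the size-biased conditional law in the definition of γ is the conditional law of the
neighborhood of the first child given (X_1, X_ø), which is what the Markov property provides
(`isPhantomKernel_phantomKernel`).

Uniqueness is an induction on time. The formula for γ[k] involves only the law of the tree, the
trajectories and the count at time k, so equal laws yield kernels that agree almost everywhere for
the law of (X_ø, X_1). The phantoms, however, use γ at (X_j, X_ø). For the particle system the law
of this pair, on the event that `[j]` is a vertex, is absolutely continuous with respect to that of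
(X_ø, X_1), again by mass transport and exchangeability (`ae_child_root_of_ae_root_child`). So the
phantoms at vertices have the same joint law with the tree and the trajectories, and the independent
noise and the update map carry the equality of laws to time k + 1. -/

/-! ### Unordered sequences: reindexing and measurability. -/

namespace Unordered

variable {ι κ Z : Type*}

theorem ofFinset_image_of_injOn [DecidableEq κ] (s : Finset ι) (φ : ι → κ) (hφ : Set.InjOn φ s)
    (z : κ → Z) : ofFinset (s.image φ) z = ofFinset s (z ∘ φ) := by
  unfold ofFinset
  rw [Finset.image_val_of_injOn hφ, Multiset.map_map]

theorem ofFinset_congr {s : Finset ι} {z z' : ι → Z} (h : ∀ i ∈ s, z i = z' i) :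
    ofFinset s z = ofFinset s z' :=
  Multiset.map_congr rfl h

@[simp] theorem length_ofFinset (s : Finset ι) (z : ι → Z) : length (ofFinset s z) = s.card :=
  Multiset.card_map _ _

/-- An enumeration of `s` reduces the map to the one on `Z ^ n`, which is measurable because the
σ-algebra is an infimum of pushforwards. -/
theorem measurable_ofFinset [MeasurableSpace Z] (s : Finset ι) :
    Measurable (fun z : ι → Z => ofFinset s z) := by
  have h : ∀ z : ι → Z, ofFinset s z =
      ofFinset (Finset.univ : Finset (Fin s.card)) (fun i => z (s.equivFin.symm i)) := by
    classical
    intro z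
    have : s = Finset.univ.image (fun i : Fin s.card => (s.equivFin.symm i : ι)) := by
      ext i
      simp only [Finset.mem_image, Finset.mem_univ, true_and]
      exact ⟨fun hi => ⟨s.equivFin ⟨i, hi⟩, by simp⟩, by rintro ⟨a, rfl⟩; simp⟩
    conv_lhs => rw [this]
    rw [ofFinset_image_of_injOn]
    · rfl
    · intro a _ b _ hab
      simpa using hab
  simp_rw [h]
  have h2 : Measurable (fun z : Fin s.card → Z => ofFinset (Finset.univ : Finset (Fin s.card)) z) := by
    refine measurable_iff_le_map.2 ?_
    exact iInf_le (fun n : ℕ => MeasurableSpace.map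
      (fun z : Fin n → Z => ofFinset (Finset.univ : Finset (Fin n)) z) MeasurableSpace.pi) s.card
  exact h2.comp (measurable_pi_lambda _ fun i => measurable_pi_apply _)

/-- The σ-algebra is final for the maps from the powers `Z ^ n`. -/
theorem measurable_from [MeasurableSpace Z] {β : Type*} [MeasurableSpace β] {f : Unordered Z → β}
    (h : ∀ n, Measurable fun z : Fin n → Z => f (ofFinset Finset.univ z)) : Measurable f := by
  intro s hs
  rw [instMeasurableSpace, MeasurableSpace.measurableSet_iInf]
  exact fun n => h n hs

theorem measurable_length [MeasurableSpace Z] : Measurable (length : Unordered Z → ℕ) :=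
  measurable_from fun n => by simp

/-- The unordered sequence of the values `(q i).2` over the indices `i` with `(q i).1`; it is empty
if there are infinitely many of them. -/
noncomputable def ofMarked (q : ι → Prop × Z) : Unordered Z :=
  open Classical in
  ofFinset (if h : {i | (q i).1}.Finite then h.toFinset else ∅) fun i => (q i).2

theorem ofMarked_eq_of_coe_eq {q : ι → Prop × Z} (s : Finset ι) (h : {i | (q i).1} = s) :
    ofMarked q = ofFinset s fun i => (q i).2 := by
  have hf : {i | (q i).1}.Finite := h ▸ s.finite_toSet
  rw [ofMarked, dif_pos hf]
  congr 1
  exact Finset.coe_injective (by simpa using h)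

/-- Source of all later invariance under relabeling. If the marked set is infinite, so is its image,
and both sides take the empty default. -/
theorem ofMarked_eq_of_bijOn {q : ι → Prop × Z} {r : κ → Prop × Z} (φ : ι → κ)
    (hφ : Set.BijOn φ {i | (q i).1} {k | (r k).1}) (h : ∀ i, (q i).1 → (r (φ i)).2 = (q i).2) :
    ofMarked r = ofMarked q := by
  classical
  by_cases hf : {i | (q i).1}.Finite
  · rw [ofMarked_eq_of_coe_eq hf.toFinset (by simp),
      ofMarked_eq_of_coe_eq (hf.toFinset.image φ) (by simp [hφ.image_eq]),
      ofFinset_image_of_injOn _ _ (by simpa using hφ.injOn)]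
    exact ofFinset_congr fun i hi => h i (by simpa using hi)
  · have hf' : ¬ {k | (r k).1}.Finite := by
      rwa [← hφ.image_eq, Set.finite_image_iff hφ.injOn]
    rw [ofMarked, ofMarked, dif_neg hf, dif_neg hf']
    rfl

/-- There are countably many finite index sets; on the event that a given one is marked, the map is
`ofFinset` for a fixed set, and on the remaining event it is constant. -/
theorem measurable_ofMarked [Countable ι] [MeasurableSpace Z] :
    Measurable (ofMarked : (ι → Prop × Z) → Unordered Z) := by
  have hm : ∀ s : Finset ι, MeasurableSet {q : ι → Prop × Z | {i | (q i).1} = s} := by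
    intro s
    have : {q : ι → Prop × Z | {i | (q i).1} = s} = ⋂ i, {q | (q i).1 ↔ i ∈ s} := by
      ext q; simp [Set.ext_iff]
    rw [this]
    refine MeasurableSet.iInter fun i => ?_
    exact measurableSet_setOfPred.2
      (Measurable.iff (measurable_fst.comp (measurable_pi_apply i)) measurable_const)
  intro B hB
  have : ofMarked ⁻¹' B = (⋃ s : Finset ι, {q : ι → Prop × Z | {i | (q i).1} = s} ∩
      (fun q => ofFinset s fun i => (q i).2) ⁻¹' B) ∪
      ((⋃ s : Finset ι, {q : ι → Prop × Z | {i | (q i).1} = s})ᶜ ∩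
        (fun q => ofFinset (∅ : Finset ι) fun i => (q i).2) ⁻¹' B) := by
    ext q
    simp only [Set.mem_preimage, Set.mem_union, Set.mem_iUnion, Set.mem_inter_iff,
      Set.mem_ofPred_eq, Set.mem_compl_iff, not_exists]
    by_cases hf : {i | (q i).1}.Finite
    · have h1 : {i | (q i).1} = (hf.toFinset : Set ι) := by simp
      constructor
      · intro hq
        exact Or.inl ⟨hf.toFinset, h1, by rwa [← ofMarked_eq_of_coe_eq _ h1]⟩
      · rintro (⟨s, hs, hq⟩ | ⟨h, -⟩)
        · rwa [ofMarked_eq_of_coe_eq _ hs]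
        · exact absurd h1 (h _)
    · have h1 : ∀ s : Finset ι, {i | (q i).1} ≠ s := fun s hs => hf (hs ▸ s.finite_toSet)
      rw [ofMarked, dif_neg hf]
      exact ⟨fun hq => Or.inr ⟨h1, hq⟩, by rintro (⟨s, hs, -⟩ | ⟨-, hq⟩); exacts [absurd hs (h1 s), hq]⟩
  rw [this]
  have hz : Measurable fun q : ι → Prop × Z => fun i => (q i).2 :=
    measurable_pi_lambda _ fun i => measurable_snd.comp (measurable_pi_apply i)
  exact (MeasurableSet.iUnion fun s => (hm s).inter ((measurable_ofFinset s).comp hz hB)).union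
    ((MeasurableSet.iUnion hm).compl.inter ((measurable_ofFinset ∅).comp hz hB))

end Unordered

/-! ### The dynamics on a deterministic marked graph. -/

/-- Vertex indicators, edge indicators and marks. -/
abbrev GraphData (𝒳 : Type*) : Type _ :=
  (UHLabel → Prop) × (UHLabel × UHLabel → Prop) × (UHLabel → 𝒳)

section GraphDynamics

variable {𝒳 Ξ : Type*} (ϖ : 𝒳)
  (F : (k : ℕ) → (Fin (k + 1) → 𝒳) → Unordered (Fin (k + 1) → 𝒳) → Ξ → 𝒳)

open Classical in
/-- The trajectories, up to time `k`, of the particle system on a marked graph, driven by `e`. -/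
noncomputable def graphTraj (d : GraphData 𝒳) (e : UHLabel × ℕ → Ξ) :
    (k : ℕ) → UHLabel → Fin (k + 1) → 𝒳
  | 0, v => fun _ => d.2.2 v
  | k + 1, v => Fin.snoc (α := fun _ => 𝒳) (graphTraj d e k v)
      (if d.1 v then F k (graphTraj d e k v)
        (Unordered.ofMarked fun u => (d.2.1 (v, u), graphTraj d e k u)) (e (v, k)) else ϖ)

/-- The unordered trajectories of the neighbors of `v`. -/
noncomputable def graphNbhd (d : GraphData 𝒳) (e : UHLabel × ℕ → Ξ) (k : ℕ) (v : UHLabel) :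
    Unordered (Fin (k + 1) → 𝒳) :=
  Unordered.ofMarked fun u => (d.2.1 (v, u), graphTraj ϖ F d e k u)

theorem measurable_snoc {α : Type*} [MeasurableSpace α] (n : ℕ) :
    Measurable fun p : (Fin n → α) × α => (Fin.snoc (α := fun _ => α) p.1 p.2 : Fin (n + 1) → α) := by
  refine measurable_pi_lambda _ fun i => ?_
  refine Fin.lastCases ?_ (fun j => ?_) i
  · simpa using measurable_snd
  · simpa [Function.comp_def] using (measurable_pi_apply j).comp measurable_fst

section Measurability

variable [MeasurableSpace 𝒳] [MeasurableSpace Ξ]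
  (hF : ∀ k, Measurable
    (fun q : (Fin (k + 1) → 𝒳) × Unordered (Fin (k + 1) → 𝒳) × Ξ => F k q.1 q.2.1 q.2.2))

include hF in
theorem measurable_graphTraj (k : ℕ) (v : UHLabel) :
    Measurable fun p : GraphData 𝒳 × (UHLabel × ℕ → Ξ) => graphTraj ϖ F p.1 p.2 k v := by
  induction k generalizing v with
  | zero =>
    refine measurable_pi_lambda _ fun _ => ?_
    exact (measurable_pi_apply v).comp (measurable_snd.comp (measurable_snd.comp measurable_fst))
  | succ k ih =>
    have hN : Measurable fun p : GraphData 𝒳 × (UHLabel × ℕ → Ξ) =>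
        Unordered.ofMarked fun u => (p.1.2.1 (v, u), graphTraj ϖ F p.1 p.2 k u) := by
      refine Unordered.measurable_ofMarked.comp (measurable_pi_lambda _ fun u => ?_)
      refine Measurable.prodMk ?_ (ih u)
      exact (measurable_pi_apply (v, u)).comp (measurable_fst.comp (measurable_snd.comp measurable_fst))
    refine (measurable_snoc (k + 1)).comp ((ih v).prodMk (Measurable.ite ?_ ?_ measurable_const))
    · exact measurableSet_setOfPred.2 ((measurable_pi_apply v).comp (measurable_fst.comp measurable_fst))
    · exact (hF k).comp ((ih v).prodMk (hN.prodMk ((measurable_pi_apply _).comp measurable_snd)))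

include hF in
theorem measurable_graphNbhd (k : ℕ) (v : UHLabel) :
    Measurable fun p : GraphData 𝒳 × (UHLabel × ℕ → Ξ) => graphNbhd ϖ F p.1 p.2 k v := by
  refine Unordered.measurable_ofMarked.comp (measurable_pi_lambda _ fun u => ?_)
  refine Measurable.prodMk ?_ (measurable_graphTraj ϖ F hF k u)
  exact (measurable_pi_apply (v, u)).comp (measurable_fst.comp (measurable_snd.comp measurable_fst))

end Measurability

variable {ϖ F}

/-- The noise with index `i` drives the step from time `i` to `i + 1`, so a trajectory up to time
`k` reads only the indices below `k`. -/
theorem graphTraj_congr_noise {d : GraphData 𝒳} {e e' : UHLabel × ℕ → Ξ} {k : ℕ}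
    (h : ∀ v, ∀ i < k, e (v, i) = e' (v, i)) (v : UHLabel) :
    graphTraj ϖ F d e k v = graphTraj ϖ F d e' k v := by
  induction k generalizing v with
  | zero => rfl
  | succ k ih =>
    have ih' := fun v => ih (fun v i hi => h v i (by omega)) v
    simp only [graphTraj, ih', h v k (by omega)]

/-- Isomorphic graphs, driven by corresponding noises, have corresponding trajectories. -/
theorem graphTraj_iso {d d' : GraphData 𝒳} {e e' : UHLabel × ℕ → Ξ}
    (hd : ∀ u v, d.2.1 (u, v) → d.1 v)
    (hd' : ∀ u v, d'.2.1 (u, v) → d'.1 v) (φ : UHLabel → UHLabel)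
    (hφ : Set.BijOn φ {v | d.1 v} {v | d'.1 v})
    (hadj : ∀ u v, d.1 u → d.1 v → (d'.2.1 (φ u, φ v) ↔ d.2.1 (u, v)))
    (hmark : ∀ v, d.1 v → d'.2.2 (φ v) = d.2.2 v)
    (he : ∀ v, d.1 v → ∀ i, e' (φ v, i) = e (v, i)) (k : ℕ) (v : UHLabel) (hv : d.1 v) :
    graphTraj ϖ F d' e' k (φ v) = graphTraj ϖ F d e k v ∧
      graphNbhd ϖ F d' e' k (φ v) = graphNbhd ϖ F d e k v := by
  -- At a fixed time, agreement of trajectories forces agreement of neighborhoods, since `φ` maps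
  -- neighbors bijectively to neighbors; the induction on time is then run for trajectories alone.
  have key : ∀ k, (∀ v, d.1 v → graphTraj ϖ F d' e' k (φ v) = graphTraj ϖ F d e k v) →
      ∀ v, d.1 v → graphNbhd ϖ F d' e' k (φ v) = graphNbhd ϖ F d e k v := by
    intro k ih v hv
    refine Unordered.ofMarked_eq_of_bijOn φ ⟨?_, ?_, ?_⟩ fun u hu => ih u (hd v u hu)
    · intro u hu
      exact (hadj v u hv (hd v u hu)).2 hu
    · exact hφ.injOn.mono fun u hu => hd v u hu
    · intro u hu
      obtain ⟨w, hw, rfl⟩ := hφ.surjOn (hd' _ u hu)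
      exact ⟨w, (hadj v w hv hw).1 hu, rfl⟩
  have main : ∀ k v, d.1 v → graphTraj ϖ F d' e' k (φ v) = graphTraj ϖ F d e k v := by
    intro k
    induction k with
    | zero => intro v hv; funext; exact hmark v hv
    | succ k ih =>
      intro v hv
      have h1 := key k ih v hv
      have h2 : d'.1 (φ v) := hφ.mapsTo hv
      unfold graphNbhd at h1
      simp only [graphTraj, ih v hv, h1, he v hv, hv, h2]
  exact ⟨main k v hv, key k (main k) v hv⟩

/-- The joint state at two sites: their trajectories and those of their neighbors. -/
abbrev PairState (𝒳 : Type*) (k : ℕ) : Type _ :=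
  (Fin (k + 1) → 𝒳) × (Fin (k + 1) → 𝒳) × Unordered (Fin (k + 1) → 𝒳) × Unordered (Fin (k + 1) → 𝒳)

variable (ϖ F) in
noncomputable def pairState (d : GraphData 𝒳) (e : UHLabel × ℕ → Ξ) (k : ℕ) (o u : UHLabel) :
    PairState 𝒳 k :=
  (graphTraj ϖ F d e k o, graphTraj ϖ F d e k u, graphNbhd ϖ F d e k o, graphNbhd ϖ F d e k u)

theorem measurable_pairState [MeasurableSpace 𝒳] [MeasurableSpace Ξ]
    (hF : ∀ k, Measurable
      (fun q : (Fin (k + 1) → 𝒳) × Unordered (Fin (k + 1) → 𝒳) × Ξ => F k q.1 q.2.1 q.2.2))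
    (k : ℕ) (o u : UHLabel) :
    Measurable fun p : GraphData 𝒳 × (UHLabel × ℕ → Ξ) => pairState ϖ F p.1 p.2 k o u :=
  (measurable_graphTraj ϖ F hF k o).prodMk ((measurable_graphTraj ϖ F hF k u).prodMk
    ((measurable_graphNbhd ϖ F hF k o).prodMk (measurable_graphNbhd ϖ F hF k u)))

/-! ### Means over the noise. -/

section Average

variable [MeasurableSpace 𝒳] [MeasurableSpace Ξ] (ϖ F) (θ : Measure Ξ) [IsProbabilityMeasure θ]

/-- The mean of a functional of the joint state at two sites, when the noises are i.i.d. with law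
`θ`. -/
noncomputable def pairMean {k : ℕ} (q : PairState 𝒳 k → ℝ≥0∞) (d : GraphData 𝒳) (o u : UHLabel) :
    ℝ≥0∞ :=
  ∫⁻ e, q (pairState ϖ F d e k o u) ∂(Measure.infinitePi fun _ : UHLabel × ℕ => θ)

theorem measurable_pairMean
    (hF : ∀ k, Measurable
      (fun q : (Fin (k + 1) → 𝒳) × Unordered (Fin (k + 1) → 𝒳) × Ξ => F k q.1 q.2.1 q.2.2))
    {k : ℕ} {q : PairState 𝒳 k → ℝ≥0∞} (hq : Measurable q) (o u : UHLabel) :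
    Measurable fun d => pairMean ϖ F θ q d o u :=
  Measurable.lintegral_prod_right' (hq.comp (measurable_pairState hF k o u))

omit [MeasurableSpace 𝒳] in
theorem pairMean_le {k : ℕ} {q : PairState 𝒳 k → ℝ≥0∞} {C : ℝ≥0∞} (hq : ∀ x, q x ≤ C)
    (d : GraphData 𝒳) (o u : UHLabel) : pairMean ϖ F θ q d o u ≤ C :=
  (lintegral_mono fun _ => hq _).trans (by simp)

/-- Only the noises at vertices matter, and an i.i.d. family read along an injection of indices is
again i.i.d. with the same law. Both means therefore equal one integral over noises indexed by the
vertices of `d`. The map `φ` is a bijection between vertex sets only, so the noise cannot be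
transported along it on all labels. -/
theorem pairMean_iso
    (hF : ∀ k, Measurable
      (fun q : (Fin (k + 1) → 𝒳) × Unordered (Fin (k + 1) → 𝒳) × Ξ => F k q.1 q.2.1 q.2.2))
    {k : ℕ} {q : PairState 𝒳 k → ℝ≥0∞} (hq : Measurable q) {d d' : GraphData 𝒳}
    (hd : ∀ u v, d.2.1 (u, v) → d.1 v)
    (hd' : ∀ u v, d'.2.1 (u, v) → d'.1 v) (φ : UHLabel → UHLabel)
    (hφ : Set.BijOn φ {v | d.1 v} {v | d'.1 v})
    (hadj : ∀ u v, d.1 u → d.1 v → (d'.2.1 (φ u, φ v) ↔ d.2.1 (u, v)))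
    (hmark : ∀ v, d.1 v → d'.2.2 (φ v) = d.2.2 v) {o u : UHLabel} (ho : d.1 o) (hu : d.1 u) :
    pairMean ϖ F θ q d' (φ o) (φ u) = pairMean ϖ F θ q d o u := by
  classical
  obtain ⟨ξ₀⟩ : Nonempty Ξ := nonempty_of_isProbabilityMeasure θ
  -- Noises at the vertices of `d`; `ext` fills in `ξ₀` at the other labels, where the noise is
  -- never read.
  let S := {v : UHLabel × ℕ // d.1 v.1}
  let ext : (S → Ξ) → UHLabel × ℕ → Ξ := fun g v => if h : d.1 v.1 then g ⟨v, h⟩ else ξ₀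
  have hext : Measurable ext := by
    refine measurable_pi_lambda _ fun v => ?_
    by_cases h : d.1 v.1
    · simpa [ext, h] using measurable_pi_apply _
    · simp [ext, h]
  have hQ : Measurable fun g : S → Ξ => q (pairState ϖ F d (ext g) k o u) :=
    hq.comp ((measurable_pairState hF k o u).comp (measurable_const.prodMk hext))
  have h1 : ∀ (ψ : S → UHLabel × ℕ) (_ : Function.Injective ψ),
      ∫⁻ e, q (pairState ϖ F d (ext fun s => e (ψ s)) k o u)
          ∂(Measure.infinitePi fun _ : UHLabel × ℕ => θ) =
        ∫⁻ g, q (pairState ϖ F d (ext g) k o u) ∂(Measure.infinitePi fun _ : S => θ) := by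
    intro ψ hψ
    have := Measure.map_infinitePi_infinitePi_of_inj (P := fun _ : UHLabel × ℕ => θ) hψ
    rw [← this, lintegral_map hQ (measurable_pi_lambda _ fun s => measurable_pi_apply _)]
  have h2 := h1 Subtype.val Subtype.val_injective
  have h3 := h1 (fun s => (φ s.1.1, s.1.2)) (by
    rintro ⟨⟨a, i⟩, ha⟩ ⟨⟨b, j⟩, hb⟩ hab
    simp only [Prod.mk.injEq] at hab
    obtain rfl : a = b := hφ.injOn ha hb hab.1
    simp [hab.2])
  have hid : ∀ v, d.1 v → d.1 (id v) := fun _ h => h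
  unfold pairMean
  trans ∫⁻ g, q (pairState ϖ F d (ext g) k o u) ∂(Measure.infinitePi fun _ : S => θ)
  · rw [← h3]
    refine lintegral_congr fun e => ?_
    have := fun v hv => graphTraj_iso (ϖ := ϖ) (F := F) (e := ext fun s => e (φ s.1.1, s.1.2))
      (e' := e) hd hd' φ hφ hadj hmark (fun v hv i => by simp [ext, hv]) k v hv
    simp only [pairState, this o ho, this u hu]
  -- Here the isomorphism is the identity of `d`: the two noises differ only off the vertices.
  · rw [← h2]
    refine lintegral_congr fun e => ?_
    have := fun v hv => graphTraj_iso (ϖ := ϖ) (F := F) (e := e) (e' := ext fun s => e s.1)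
      hd hd id (Set.bijOn_id _) (fun _ _ _ _ => Iff.rfl) (fun _ _ => rfl)
      (fun v hv i => by simp [ext, hv]) k v hv
    simp only [pairState, id] at this ⊢
    simp only [this o ho, this u hu]

end Average

end GraphDynamics

/-! ### Neighbors, degrees and measurability on trees. -/

section Trees

variable {𝒳 Ξ : Type*}

theorem UHTree.measurableSet_mem (v : UHLabel) : MeasurableSet {T : UHTree | v ∈ T.1} :=
  measurableSet_setOfPred.2 ((measurable_pi_apply v).comp measurable_subtype_coe)

theorem UHTree.measurable_mem (v : UHLabel) : Measurable fun T : UHTree => v ∈ T.1 :=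
  measurableSet_setOfPred.1 (UHTree.measurableSet_mem v)

theorem UHTree.measurable_iff {α : Type*} [MeasurableSpace α] {f : α → UHTree} :
    Measurable f ↔ ∀ v, MeasurableSet {a | v ∈ (f a).1} := by
  refine ⟨fun h v => h (UHTree.measurableSet_mem v), fun h => Measurable.subtype_mk ?_⟩
  exact measurable_pi_iff.2 fun v => measurableSet_setOfPred.1 (h v)

theorem UHTree.measurable_adj (u v : UHLabel) : Measurable fun T : UHTree => T.Adj u v :=
  (UHTree.measurable_mem u).and ((UHTree.measurable_mem v).and measurable_const)

@[simp] theorem UHTree.mem_nbhd (T : UHTree) (u v : UHLabel) : u ∈ T.nbhd v ↔ T.Adj v u := by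
  simp [UHTree.nbhd]

@[simp] theorem UHTree.mem_rootChildren (T : UHTree) (j : ℕ+) : j ∈ T.rootChildren ↔ [j] ∈ T.1 := by
  simp [UHTree.rootChildren]

theorem UHTree.adj_root_iff (T : UHTree) (u : UHLabel) :
    T.Adj [] u ↔ ∃ j : ℕ+, [j] ∈ T.1 ∧ u = [j] := by
  constructor
  · rintro ⟨-, h, ⟨k, rfl⟩ | ⟨k, hk⟩⟩
    · exact ⟨k, h, rfl⟩
    · simp at hk
  · rintro ⟨j, h, rfl⟩
    exact ⟨T.2.root_mem, h, Or.inl ⟨j, rfl⟩⟩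

theorem UHTree.adj_symm {T : UHTree} {u v : UHLabel} (h : T.Adj u v) : T.Adj v u :=
  ⟨h.2.1, h.1, h.2.2.symm⟩

theorem UHTree.nbhd_root_eq (T : UHTree) :
    T.nbhd [] = T.rootChildren.map ⟨fun j => [j], fun _ _ h => by simpa using h⟩ := by
  ext u
  simp only [UHTree.mem_nbhd, UHTree.adj_root_iff, Finset.mem_map, UHTree.mem_rootChildren,
    eq_comm (a := u)]
  rfl

/-- The labels of the children have no gaps. This lets events about `[j]` be decided by the degree
of the root. -/
theorem UHTree.singleton_mem_iff (T : UHTree) (j : ℕ+) :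
    [j] ∈ T.1 ↔ (j : ℕ) ≤ (T.nbhd []).card := by
  obtain ⟨c, hc⟩ := T.2.children [] T.2.root_mem
  simp only [List.nil_append] at hc
  have : T.rootChildren.image (fun j : ℕ+ => (j : ℕ)) = Finset.Icc 1 c := by
    ext i
    simp only [Finset.mem_image, UHTree.mem_rootChildren, hc, Finset.mem_Icc]
    exact ⟨by rintro ⟨a, ha, rfl⟩; exact ⟨a.pos, ha⟩, fun h => ⟨⟨i, h.1⟩, h.2, rfl⟩⟩
  rw [hc, T.nbhd_root_eq, Finset.card_map,
    ← Finset.card_image_of_injective _ PNat.coe_injective, this]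
  simp

theorem UHTree.measurable_card_nbhd (v : UHLabel) : Measurable fun T : UHTree => (T.nbhd v).card := by
  -- With trivial marks, `ofMarked` counts neighbors, and its measurability is known.
  have : (fun T : UHTree => (T.nbhd v).card) = fun T =>
      Unordered.length (Unordered.ofMarked fun u : UHLabel => (T.Adj v u, ())) := by
    ext T
    rw [Unordered.ofMarked_eq_of_coe_eq (T.nbhd v) (by ext; simp), Unordered.length_ofFinset]
  rw [this]
  exact Unordered.measurable_length.comp (Unordered.measurable_ofMarked.comp
    (measurable_pi_lambda _ fun u => (UHTree.measurable_adj v u).prodMk measurable_const))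

/-- The data of a tree with marks. -/
def UHTree.data (p : UHTree × (UHLabel → 𝒳)) : GraphData 𝒳 :=
  (fun v => v ∈ p.1.1, fun e => p.1.Adj e.1 e.2, p.2)

theorem UHTree.measurable_data [MeasurableSpace 𝒳] :
    Measurable (UHTree.data : UHTree × (UHLabel → 𝒳) → GraphData 𝒳) := by
  refine Measurable.prodMk ?_ (Measurable.prodMk ?_ measurable_snd)
  · exact measurable_pi_lambda _ fun v => (UHTree.measurable_mem v).comp measurable_fst
  · exact measurable_pi_lambda _ fun e => (UHTree.measurable_adj e.1 e.2).comp measurable_fst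

end Trees

/-! ### Test functions on isomorphism classes of doubly rooted graphs. -/

namespace DoublyRooted

variable {𝒳 Ξ : Type*}

/-- The data of a doubly rooted marked graph. -/
def data (g : DoublyRooted 𝒳) : GraphData 𝒳 :=
  (fun v => v ∈ g.graph.verts, fun p => g.graph.Adj p.1 p.2, g.mark)

theorem measurable_encode [MeasurableSpace 𝒳] : Measurable (fun g : DoublyRooted 𝒳 =>
    ((fun v => v ∈ g.graph.verts, fun p => g.graph.Adj p.1 p.2, g.mark,
        fun v => g.root.1 = v, fun v => g.root'.1 = v) :
      (UHLabel → Prop) × (UHLabel × UHLabel → Prop) × (UHLabel → 𝒳) ×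
        (UHLabel → Prop) × (UHLabel → Prop))) :=
  comap_measurable _

theorem measurable_data [MeasurableSpace 𝒳] : Measurable (data : DoublyRooted 𝒳 → GraphData 𝒳) := by
  have h := measurable_encode (𝒳 := 𝒳)
  exact h.fst.prodMk (h.snd.fst.prodMk h.snd.snd.fst)

theorem measurableSet_roots [MeasurableSpace 𝒳] (o u : UHLabel) :
    MeasurableSet {g : DoublyRooted 𝒳 | g.root.1 = o ∧ g.root'.1 = u} := by
  have h := measurable_encode (𝒳 := 𝒳)
  exact measurableSet_setOfPred.2 (((measurable_pi_apply o).comp h.snd.snd.snd.fst).and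
    ((measurable_pi_apply u).comp h.snd.snd.snd.snd))

variable [MeasurableSpace 𝒳] [MeasurableSpace Ξ] (ϖ : 𝒳)
  (F : (k : ℕ) → (Fin (k + 1) → 𝒳) → Unordered (Fin (k + 1) → 𝒳) → Ξ → 𝒳)
  (θ : Measure Ξ) [IsProbabilityMeasure θ]

open Classical in
/-- The mean of a functional of the joint state at the two roots, restricted to adjacent roots. -/
noncomputable def rootMean {k : ℕ} (q : PairState 𝒳 k → ℝ≥0∞) (g : DoublyRooted 𝒳) : ℝ≥0∞ :=
  if g.graph.Adj g.root g.root' then pairMean ϖ F θ q g.data g.root g.root' else 0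

variable (hF : ∀ k, Measurable
    (fun q : (Fin (k + 1) → 𝒳) × Unordered (Fin (k + 1) → 𝒳) × Ξ => F k q.1 q.2.1 q.2.2))

include hF in
theorem measurable_rootMean {k : ℕ} {q : PairState 𝒳 k → ℝ≥0∞} (hq : Measurable q) :
    Measurable (rootMean ϖ F θ q) := by
  classical
  -- Measurability of `pairMean` is available at fixed sites only, so the graphs are split according
  -- to the countably many positions of the two roots.
  have : rootMean ϖ F θ q = fun g => ∑' p : UHLabel × UHLabel,
      {g : DoublyRooted 𝒳 | g.root.1 = p.1 ∧ g.root'.1 = p.2}.indicator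
        (fun g => if g.data.2.1 (p.1, p.2) then pairMean ϖ F θ q g.data p.1 p.2 else 0) g := by
    ext g
    rw [tsum_eq_single (g.root.1, g.root'.1)]
    · rw [Set.indicator_of_mem (by simp)]
      rfl
    · rintro ⟨a, b⟩ hab
      rw [Set.indicator_of_notMem]
      rintro ⟨rfl, rfl⟩
      exact hab rfl
  rw [this]
  refine Measurable.tsum fun p => ?_
  refine Measurable.indicator (Measurable.ite ?_ ?_ measurable_const) (measurableSet_roots _ _)
  · exact measurableSet_setOfPred.2 ((measurable_pi_apply (p.1, p.2)).comp measurable_data.snd.fst)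
  · exact (measurable_pairMean ϖ F θ hF hq p.1 p.2).comp measurable_data

-- This is what lets `rootMean` descend to isomorphism classes, as a test function for unimodularity
-- must.
include hF in
theorem rootMean_congr {k : ℕ} {q : PairState 𝒳 k → ℝ≥0∞} (hq : Measurable q)
    {g h : DoublyRooted 𝒳} (hgh : Iso g h) : rootMean ϖ F θ q g = rootMean ϖ F θ q h := by
  classical
  obtain ⟨φ, h1, h2, h3⟩ := hgh
  have hadj : h.graph.Adj h.root h.root' ↔ g.graph.Adj g.root g.root' := by
    rw [← h1, ← h2]
    exact φ.map_adj_iff (v := g.root) (w := g.root')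
  -- The isomorphism acts on vertices; `ψ` extends it to all labels, and its values off the vertices
  -- play no role.
  let ψ : UHLabel → UHLabel := fun v => if hv : v ∈ g.graph.verts then (φ ⟨v, hv⟩).1 else v
  have hψ : ∀ v (hv : v ∈ g.graph.verts), ψ v = (φ ⟨v, hv⟩).1 := fun v hv => dif_pos hv
  unfold rootMean
  by_cases ha : g.graph.Adj g.root g.root'
  · rw [if_pos ha, if_pos (hadj.2 ha), ← h1, ← h2, ← hψ _ g.root.2, ← hψ _ g.root'.2]
    refine (pairMean_iso ϖ F θ hF hq (fun u v huv => g.graph.edge_vert (g.graph.symm.symm _ _ huv))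
      (fun u v huv => h.graph.edge_vert (h.graph.symm.symm _ _ huv)) ψ ⟨?_, ?_, ?_⟩ ?_ ?_ g.root.2 g.root'.2).symm
    · intro v hv
      simp only [hψ v hv]
      exact (φ ⟨v, hv⟩).2
    · intro v hv w hw hvw
      rw [hψ v hv, hψ w hw] at hvw
      exact congrArg Subtype.val (φ.injective (Subtype.ext hvw))
    · intro v hv
      refine ⟨(φ.symm ⟨v, hv⟩).1, (φ.symm ⟨v, hv⟩).2, ?_⟩
      rw [hψ _ (φ.symm ⟨v, hv⟩).2]
      exact congrArg Subtype.val (φ.apply_symm_apply ⟨v, hv⟩)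
    · intro u v hu hv
      rw [hψ u hu, hψ v hv]
      exact φ.map_adj_iff (v := ⟨u, hu⟩) (w := ⟨v, hv⟩)
    · intro v hv
      rw [hψ v hv]
      exact h3 ⟨v, hv⟩
  · rw [if_neg ha, if_neg fun h => ha (hadj.1 h)]

end DoublyRooted

/-! ### The particle system as a function of initial data and noise; transfer of unimodularity. -/

section Trajectories

variable {Ω 𝒳 Ξ : Type*}

/-- The unordered trajectories of the neighbors of `v`. -/
noncomputable def siteNbhd (T : Ω → UHTree) (X : UHLabel → ℕ → Ω → 𝒳) (k : ℕ) (v : UHLabel) (ω : Ω) :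
    Unordered (Fin (k + 1) → 𝒳) :=
  Unordered.ofFinset ((T ω).nbhd v) fun u => traj X u k ω

/-- The joint state of the particle system at two sites. -/
noncomputable def pairAt (T : Ω → UHTree) (X : UHLabel → ℕ → Ω → 𝒳) (k : ℕ) (o u : UHLabel) (ω : Ω) :
    PairState 𝒳 k :=
  (traj X o k ω, traj X u k ω, siteNbhd T X k o ω, siteNbhd T X k u ω)

theorem traj_succ {I : Type*} (X : I → ℕ → Ω → 𝒳) (v : I) (k : ℕ) (ω : Ω) :
    traj X v (k + 1) ω = Fin.snoc (α := fun _ => 𝒳) (traj X v k ω) (X v (k + 1) ω) := by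
  ext i
  refine Fin.lastCases ?_ (fun j => ?_) i
  · simp [traj]
  · simp [traj]

variable {ϖ : 𝒳} {ρ₀ ρ : PMF ℕ} {T : Ω → UHTree} {X : UHLabel → ℕ → Ω → 𝒳}
  {ξ : UHLabel → ℕ → Ω → Ξ}
  {F : (k : ℕ) → (Fin (k + 1) → 𝒳) → Unordered (Fin (k + 1) → 𝒳) → Ξ → 𝒳}

theorem siteNbhd_eq_ofMarked (k : ℕ) (v : UHLabel) (ω : Ω) : siteNbhd T X k v ω =
    Unordered.ofMarked fun u => ((T ω).Adj v u, traj X u k ω) :=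
  (Unordered.ofMarked_eq_of_coe_eq (q := fun u => ((T ω).Adj v u, traj X u k ω)) ((T ω).nbhd v)
    (by ext; simp)).symm

/-- Trajectories are a deterministic function of the initial marked tree and the noises. Noise
indices start at 0 in `graphTraj` and at 1 in the particle system, whence the shift. -/
theorem traj_eq_graphTraj (hX : IsParticleSystem ϖ T X ξ F) (k : ℕ) (v : UHLabel) (ω : Ω) :
    traj X v k ω = graphTraj ϖ F (UHTree.data (T ω, fun v => X v 0 ω))
      (fun p => ξ p.1 (p.2 + 1) ω) k v := by
  induction k generalizing v with
  | zero => ext i; fin_cases i; rfl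
  | succ k ih =>
    rw [traj_succ, hX k v ω, graphTraj]
    have := siteNbhd_eq_ofMarked (T := T) (X := X) k v ω
    rw [siteNbhd] at this
    rw [this]
    simp only [ih]
    rfl

theorem pairAt_eq_pairState (hX : IsParticleSystem ϖ T X ξ F) (k : ℕ) (o u : UHLabel) (ω : Ω) :
    pairAt T X k o u ω = pairState ϖ F (UHTree.data (T ω, fun v => X v 0 ω))
      (fun p => ξ p.1 (p.2 + 1) ω) k o u := by
  simp only [pairAt, pairState, siteNbhd_eq_ofMarked, traj_eq_graphTraj hX]
  rfl

variable [MeasurableSpace Ω] [MeasurableSpace 𝒳] [MeasurableSpace Ξ] {P : Measure Ω}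
  [IsProbabilityMeasure P]

namespace UGWCondition

variable (hcond : UGWCondition P ϖ ρ₀ ρ T X ξ F) (hX : IsParticleSystem ϖ T X ξ F)

include hcond

omit [IsProbabilityMeasure P] in
theorem measurable_initial : Measurable fun ω => (T ω, fun v => X v 0 ω) :=
  hcond.measurable_tree.prodMk (measurable_pi_lambda _ hcond.measurable_init)

omit [IsProbabilityMeasure P] in
theorem measurable_noises : Measurable fun ω (p : UHLabel × ℕ) => ξ p.1 (p.2 + 1) ω :=
  measurable_pi_lambda _ fun p => hcond.measurable_noise p.1 p.2

theorem isProbabilityMeasure_noise : IsProbabilityMeasure (P.map (ξ [] 1)) :=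
  Measure.isProbabilityMeasure_map (hcond.measurable_noise [] 0).aemeasurable

omit [IsProbabilityMeasure P] in
theorem map_noises : P.map (fun ω (p : UHLabel × ℕ) => ξ p.1 (p.2 + 1) ω) =
    Measure.infinitePi fun _ : UHLabel × ℕ => P.map (ξ [] 1) := by
  rw [iIndepFun.map_fun_eq_infinitePi_map (X := fun (p : UHLabel × ℕ) ω => ξ p.1 (p.2 + 1) ω)
    (fun p => hcond.measurable_noise p.1 p.2) hcond.indep_noise]
  congr 1
  ext p : 1
  exact (hcond.identDistrib_noise p.1 p.2).map_eq

theorem map_initial_noises : P.map (fun ω => ((T ω, fun v => X v 0 ω),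
      fun p : UHLabel × ℕ => ξ p.1 (p.2 + 1) ω)) =
    (P.map fun ω => (T ω, fun v => X v 0 ω)).prod
      (Measure.infinitePi fun _ : UHLabel × ℕ => P.map (ξ [] 1)) := by
  rw [(indepFun_iff_map_prod_eq_prod_map_map hcond.measurable_initial.aemeasurable
    hcond.measurable_noises.aemeasurable).1 hcond.indep_init_noise, hcond.map_noises]

omit [IsProbabilityMeasure P] in
include hX in
theorem measurable_traj (k : ℕ) (v : UHLabel) : Measurable (traj X v k) := by
  have := (measurable_graphTraj ϖ F hcond.measurable_update k v).comp
    ((UHTree.measurable_data.comp hcond.measurable_initial).prodMk hcond.measurable_noises)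
  convert this using 1
  ext1 ω
  exact traj_eq_graphTraj hX k v ω

omit [IsProbabilityMeasure P] in
include hX in
theorem measurable_pairAt (k : ℕ) (o u : UHLabel) : Measurable (pairAt T X k o u) := by
  have := (measurable_pairState (ϖ := ϖ) hcond.measurable_update k o u).comp
    ((UHTree.measurable_data.comp hcond.measurable_initial).prodMk hcond.measurable_noises)
  convert this using 1
  ext1 ω
  exact pairAt_eq_pairState hX k o u ω

include hX in
/-- Averaging over the noises. -/
theorem setLIntegral_pairAt {k : ℕ} {q : PairState 𝒳 k → ℝ≥0∞} (hq : Measurable q) (o u : UHLabel)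
    {s : Set (UHTree × (UHLabel → 𝒳))} (hs : MeasurableSet s) :
    ∫⁻ ω in (fun ω => (T ω, fun v => X v 0 ω)) ⁻¹' s, q (pairAt T X k o u ω) ∂P =
      ∫⁻ ω in (fun ω => (T ω, fun v => X v 0 ω)) ⁻¹' s,
        pairMean ϖ F (P.map (ξ [] 1)) q (UHTree.data (T ω, fun v => X v 0 ω)) o u ∂P := by
  have := hcond.isProbabilityMeasure_noise
  have : IsProbabilityMeasure (P.map fun ω => (T ω, fun v => X v 0 ω)) :=
    Measure.isProbabilityMeasure_map hcond.measurable_initial.aemeasurable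
  let G : (UHTree × (UHLabel → 𝒳)) × (UHLabel × ℕ → Ξ) → ℝ≥0∞ := fun p =>
    s.indicator (fun _ => 1) p.1 * q (pairState ϖ F (UHTree.data p.1) p.2 k o u)
  have hqm := hq.comp (measurable_pairState (ϖ := ϖ) hcond.measurable_update k o u)
  have hG : Measurable G := by
    refine ((measurable_const.indicator hs).comp measurable_fst).mul ?_
    exact hqm.comp ((UHTree.measurable_data.comp measurable_fst).prodMk measurable_snd)
  -- Initial data and noises are independent, so their joint law is a product and Tonelli integrates
  -- out the noise.
  have h1 : ∫⁻ ω, G ((T ω, fun v => X v 0 ω), fun p => ξ p.1 (p.2 + 1) ω) ∂P =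
      ∫⁻ ω, s.indicator (fun _ => 1) (T ω, fun v => X v 0 ω) *
        pairMean ϖ F (P.map (ξ [] 1)) q (UHTree.data (T ω, fun v => X v 0 ω)) o u ∂P := by
    rw [← lintegral_map (f := G) hG (hcond.measurable_initial.prodMk hcond.measurable_noises),
      hcond.map_initial_noises, lintegral_prod _ hG.aemeasurable,
      lintegral_map hG.lintegral_prod_right' hcond.measurable_initial]
    refine lintegral_congr fun ω => ?_
    simp only [G, pairMean]
    rw [lintegral_const_mul]
    exact hqm.comp (measurable_const.prodMk measurable_id)
  rw [← lintegral_indicator (hcond.measurable_initial hs),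
    ← lintegral_indicator (hcond.measurable_initial hs)]
  have hind : ∀ a : Ω → ℝ≥0∞, ((fun ω => (T ω, fun v => X v 0 ω)) ⁻¹' s).indicator a =
      fun ω => s.indicator (fun _ => 1) (T ω, fun v => X v 0 ω) * a ω := by
    intro a
    ext ω
    by_cases h : (T ω, fun v => X v 0 ω) ∈ s <;> simp [Set.indicator, h]
  rw [hind, hind, ← h1]
  simp only [G, ← pairAt_eq_pairState hX]

omit [IsProbabilityMeasure P] in
theorem measurableSet_mem (v : UHLabel) : MeasurableSet {ω | v ∈ (T ω).1} :=
  hcond.measurable_tree (UHTree.measurableSet_mem v)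

include hX in
theorem setLIntegral_pairAt_mem {k : ℕ} {q : PairState 𝒳 k → ℝ≥0∞} (hq : Measurable q)
    (o u v : UHLabel) : ∫⁻ ω in {ω | v ∈ (T ω).1}, q (pairAt T X k o u ω) ∂P =
      ∫⁻ ω in {ω | v ∈ (T ω).1},
        pairMean ϖ F (P.map (ξ [] 1)) q (UHTree.data (T ω, fun v => X v 0 ω)) o u ∂P :=
  hcond.setLIntegral_pairAt hX hq o u (measurable_fst (UHTree.measurableSet_mem v))

include hX in
/-- Unimodularity is inherited by the trajectories at adjacent sites. -/
theorem tsum_lintegral_pairAt {k : ℕ} {q : PairState 𝒳 k → ℝ≥0∞} (hq : Measurable q)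
    {C : ℝ≥0} (hC : ∀ x, q x ≤ C) :
    ∑' j : ℕ+, ∫⁻ ω in {ω | [j] ∈ (T ω).1}, q (pairAt T X k [] [j] ω) ∂P =
      ∑' j : ℕ+, ∫⁻ ω in {ω | [j] ∈ (T ω).1}, q (pairAt T X k [j] [] ω) ∂P := by
  classical
  have := hcond.isProbabilityMeasure_noise
  let θ := P.map (ξ [] 1)
  -- Unimodularity is assumed for the initial marked graph only. The mean over the noise depends on
  -- nothing else, and it vanishes unless the two roots are adjacent.
  let f : DoublyRootedClass 𝒳 → ℝ≥0∞ := Quotient.lift (DoublyRooted.rootMean ϖ F θ q)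
    fun g h hgh => DoublyRooted.rootMean_congr ϖ F θ hcond.measurable_update hq hgh
  have hf : Measurable f := measurable_from_quotient.2
    (DoublyRooted.measurable_rootMean ϖ F θ hcond.measurable_update hq)
  have hfC : ∀ g, f g ≤ C := by
    intro g
    induction g using Quotient.inductionOn with
    | h g =>
      change DoublyRooted.rootMean ϖ F θ q g ≤ C
      unfold DoublyRooted.rootMean
      split_ifs
      · exact pairMean_le ϖ F θ hC _ _ _
      · simp
  have huni := hcond.unimodular f hf ⟨C, hfC⟩
  -- A sum over all vertices that is supported on neighbors of the root is a sum over its children.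
  have hsum : ∀ (S : UHTree) (m : S.1 → ℝ≥0∞), (∀ u, ¬ S.Adj [] u.1 → m u = 0) →
      ∑' u : S.1, m u = ∑' j : ℕ+, if h : [j] ∈ S.1 then m ⟨[j], h⟩ else 0 := by
    intro S m hm
    have hinj : Function.Injective fun j : {j : ℕ+ // [j] ∈ S.1} => (⟨[j.1], j.2⟩ : S.1) := by
      intro a b hab
      simpa [Subtype.ext_iff] using hab
    rw [← hinj.tsum_eq (f := m)]
    · rw [← tsum_subtype_eq_of_support_subset (s := {j : ℕ+ | [j] ∈ S.1})]
      · refine tsum_congr fun j => ?_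
        have hj : [j.1] ∈ S.1 := j.2
        rw [dif_pos hj]
      · intro j hj
        by_contra h
        simp only [Set.mem_ofPred_eq] at h
        simp [h] at hj
    · intro u hu
      have : S.Adj [] u.1 := by
        by_contra h
        exact hu (hm u h)
      obtain ⟨j, hj, hju⟩ := (S.adj_root_iff _).1 this
      exact ⟨⟨j, hj⟩, Subtype.ext hju.symm⟩
  have key : ∀ (a b : ℕ+ → UHLabel), ∑' j : ℕ+, ∫⁻ ω in {ω | [j] ∈ (T ω).1},
        q (pairAt T X k (a j) (b j) ω) ∂P =
      ∫⁻ ω, ∑' j : ℕ+, (if [j] ∈ (T ω).1 then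
        pairMean ϖ F θ q (UHTree.data (T ω, fun v => X v 0 ω)) (a j) (b j) else 0) ∂P := by
    intro a b
    rw [lintegral_tsum]
    · refine tsum_congr fun j => ?_
      rw [hcond.setLIntegral_pairAt_mem hX hq, ← lintegral_indicator (hcond.measurableSet_mem [j])]
      rfl
    · intro j
      refine (Measurable.ite (hcond.measurableSet_mem [j]) ?_ measurable_const).aemeasurable
      exact (measurable_pairMean ϖ F θ hcond.measurable_update hq _ _).comp
        (UHTree.measurable_data.comp hcond.measurable_initial)
  rw [key (fun _ => []) (fun j => [j]), key (fun j => [j]) (fun _ => [])]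
  convert huni using 1
  · refine lintegral_congr fun ω => ?_
    refine Eq.symm ((hsum (T ω) _ ?_).trans ?_)
    · intro u hu
      exact if_neg hu
    · refine tsum_congr fun j => ?_
      by_cases h : [j] ∈ (T ω).1
      · rw [dif_pos h, if_pos h]
        exact if_pos (((T ω).adj_root_iff _).2 ⟨j, h, rfl⟩)
      · rw [dif_neg h, if_neg h]
  · refine lintegral_congr fun ω => ?_
    refine Eq.symm ((hsum (T ω) _ ?_).trans ?_)
    · intro u hu
      exact if_neg fun h => hu (UHTree.adj_symm h)
    · refine tsum_congr fun j => ?_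
      by_cases h : [j] ∈ (T ω).1
      · rw [dif_pos h, if_pos h]
        exact if_pos (UHTree.adj_symm (((T ω).adj_root_iff _).2 ⟨j, h, rfl⟩))
      · rw [dif_neg h, if_neg h]

end UGWCondition

end Trajectories

/-! ### Swapping two subtrees at the root; transfer of exchangeability. -/

namespace UHLabel

/-- The relabeling that permutes the first letters. -/
def relabel (τ : Equiv.Perm ℕ+) : UHLabel → UHLabel
  | [] => []
  | i :: w => τ i :: w

@[simp] theorem relabel_nil (τ : Equiv.Perm ℕ+) : relabel τ [] = [] := rfl

@[simp] theorem relabel_cons (τ : Equiv.Perm ℕ+) (i : ℕ+) (w : UHLabel) :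
    relabel τ (i :: w) = τ i :: w := rfl

theorem relabel_relabel {τ : Equiv.Perm ℕ+} (hτ : ∀ i, τ (τ i) = i) (v : UHLabel) :
    relabel τ (relabel τ v) = v := by
  cases v <;> simp [hτ]

theorem exists_relabel_append (τ : Equiv.Perm ℕ+) {u v : UHLabel} (h : ∃ k, v = u ++ [k]) :
    ∃ k, relabel τ v = relabel τ u ++ [k] := by
  obtain ⟨k, rfl⟩ := h
  cases u with
  | nil => exact ⟨τ k, rfl⟩
  | cons i w => exact ⟨k, rfl⟩

theorem exists_relabel_append_iff {τ : Equiv.Perm ℕ+} (hτ : ∀ i, τ (τ i) = i) {u v : UHLabel} :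
    (∃ k, relabel τ v = relabel τ u ++ [k]) ↔ ∃ k, v = u ++ [k] := by
  refine ⟨fun h => ?_, exists_relabel_append τ⟩
  simpa only [relabel_relabel hτ] using exists_relabel_append τ h

end UHLabel

namespace UHTree

open UHLabel

open Classical in
/-- The tree with the first and the `j`-th subtree at the root exchanged, if there are at least `j`
of them. -/
noncomputable def swapTree (j : ℕ+) (S : UHTree) : UHTree :=
  if h : [j] ∈ S.1 then ⟨{v | relabel (Equiv.swap 1 j) v ∈ S.1}, by
    refine ⟨S.2.root_mem, fun u w huw => ?_, fun v hv => ?_⟩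
    · cases u with
      | nil => exact S.2.root_mem
      | cons i u => exact S.2.mem_of_append_mem (relabel (Equiv.swap 1 j) (i :: u)) w huw
    · cases v with
      | nil =>
        refine ⟨(S.nbhd []).card, fun k => ?_⟩
        have hj := (S.singleton_mem_iff j).1 h
        have h1 : ((1 : ℕ+) : ℕ) ≤ (S.nbhd []).card := by
          have := j.pos
          simp only [PNat.one_coe]
          omega
        change [Equiv.swap 1 j k] ∈ S.1 ↔ _
        -- Both 1 and `j` label children, so exchanging them leaves the set of children unchanged.
        rw [S.singleton_mem_iff, Equiv.swap_apply_def]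
        split_ifs with hk hk'
        · subst hk; exact iff_of_true hj h1
        · subst hk'; exact iff_of_true h1 hj
        · rfl
      | cons i u => exact S.2.children (relabel (Equiv.swap 1 j) (i :: u)) hv⟩
  else S

theorem mem_swapTree {j : ℕ+} {S : UHTree} (h : [j] ∈ S.1) (v : UHLabel) :
    v ∈ (swapTree j S).1 ↔ relabel (Equiv.swap 1 j) v ∈ S.1 := by
  rw [swapTree, dif_pos h]
  rfl

theorem measurable_swapTree (j : ℕ+) : Measurable (swapTree j) := by
  rw [measurable_iff]
  intro v
  have : {S : UHTree | v ∈ (swapTree j S).1} =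
      ({S | [j] ∈ S.1} ∩ {S | relabel (Equiv.swap 1 j) v ∈ S.1}) ∪ ({S | [j] ∈ S.1}ᶜ ∩ {S | v ∈ S.1}) := by
    ext S
    by_cases h : [j] ∈ S.1
    · simp [h, mem_swapTree h]
    · simp [h, swapTree]
  rw [this]
  exact ((measurableSet_mem _).inter (measurableSet_mem _)).union
    ((measurableSet_mem _).compl.inter (measurableSet_mem _))

variable {𝒳 : Type*}

/-- The vertex indicators and the marks. -/
def coords (p : UHTree × (UHLabel → 𝒳)) (v : UHLabel) : Prop × 𝒳 := (v ∈ p.1.1, p.2 v)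

theorem measurable_coords [MeasurableSpace 𝒳] :
    Measurable (coords : UHTree × (UHLabel → 𝒳) → UHLabel → Prop × 𝒳) :=
  measurable_pi_lambda _ fun v => ((measurable_mem v).comp measurable_fst).prodMk
    ((measurable_pi_apply v).comp measurable_snd)

/-- A law on marked trees is determined by the law of the vertex indicators and the marks. -/
theorem ext_of_map_coords [MeasurableSpace 𝒳] {μ ν : Measure (UHTree × (UHLabel → 𝒳))}
    (h : μ.map coords = ν.map coords) : μ = ν := by
  have hle : (inferInstance : MeasurableSpace (UHTree × (UHLabel → 𝒳))) ≤
      MeasurableSpace.comap coords inferInstance := by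
    let m : MeasurableSpace (UHTree × (UHLabel → 𝒳)) := MeasurableSpace.comap coords inferInstance
    have hc : Measurable[m] (coords : UHTree × (UHLabel → 𝒳) → UHLabel → Prop × 𝒳) :=
      comap_measurable _
    refine sup_le ?_ ?_
    · refine Measurable.comap_le (m₁ := m) ?_
      refine (measurable_iff (f := (Prod.fst : UHTree × (UHLabel → 𝒳) → UHTree))).2 fun v => ?_
      exact measurableSet_setOfPred.2 ((measurable_pi_apply v).comp hc).fst
    · refine Measurable.comap_le (m₁ := m) ?_
      exact measurable_pi_lambda _ fun v => ((measurable_pi_apply v).comp hc).snd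
  ext s hs
  obtain ⟨t, ht, rfl⟩ := hle s hs
  rw [← Measure.map_apply measurable_coords ht, h, Measure.map_apply measurable_coords ht]

end UHTree

namespace UGWCondition

open UHLabel

variable {Ω 𝒳 Ξ : Type*} {ϖ : 𝒳} {ρ₀ ρ : PMF ℕ} {T : Ω → UHTree} {X : UHLabel → ℕ → Ω → 𝒳}
  {ξ : UHLabel → ℕ → Ω → Ξ}
  {F : (k : ℕ) → (Fin (k + 1) → 𝒳) → Unordered (Fin (k + 1) → 𝒳) → Ξ → 𝒳}
  [MeasurableSpace Ω] [MeasurableSpace 𝒳] [MeasurableSpace Ξ] {P : Measure Ω}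
  [IsProbabilityMeasure P]
  (hcond : UGWCondition P ϖ ρ₀ ρ T X ξ F) (hX : IsParticleSystem ϖ T X ξ F)

include hcond

omit [IsProbabilityMeasure P] in
theorem measurableSet_card (n : ℕ) : MeasurableSet {ω | ((T ω).nbhd []).card = n} :=
  (UHTree.measurable_card_nbhd []).comp hcond.measurable_tree (measurableSet_singleton n)

/-- This is exchangeability for one transposition, restated for whole marked trees. With `n`
children, every label outside the first `n` subtrees and different from the root is almost surely
dead, so the marked tree can be rebuilt from the root and those `n` subtrees. -/
theorem map_restrict_swap {j : ℕ+} {n : ℕ} (hj : (j : ℕ) ≤ n) :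
    (P.restrict {ω | ((T ω).nbhd []).card = n}).map
        (fun ω => (UHTree.swapTree j (T ω), fun v => X (relabel (Equiv.swap 1 j) v) 0 ω)) =
      (P.restrict {ω | ((T ω).nbhd []).card = n}).map (fun ω => (T ω, fun v => X v 0 ω)) := by
  classical
  set A := {ω | ((T ω).nbhd []).card = n} with hA
  have hAm : MeasurableSet A := hcond.measurableSet_card n
  by_cases hP : P A = 0
  · simp [Measure.restrict_eq_zero.2 hP]
  have hn : 1 ≤ n := le_trans j.pos hj
  -- The transposition of 1 and `j` with labels shifted to start at 0.
  let σ : Equiv.Perm (Fin n) := Equiv.swap ⟨0, by omega⟩ ⟨j.natPred, by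
    have := PNat.natPred_add_one j; omega⟩
  have hσ : ∀ i : Fin n, (σ i : ℕ).succPNat = Equiv.swap 1 j ((i : ℕ).succPNat) := by
    intro i
    simp only [σ, Equiv.swap_apply_def]
    have e1 : (i : ℕ).succPNat = 1 ↔ i = ⟨0, by omega⟩ := by
      rw [← PNat.coe_inj, Fin.ext_iff]; simp
    have e2 : (i : ℕ).succPNat = j ↔ i = ⟨j.natPred, by
        have := PNat.natPred_add_one j; omega⟩ := by
      rw [← PNat.coe_inj, Fin.ext_iff]
      have := PNat.natPred_add_one j
      simp only [Nat.succPNat_coe]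
      omega
    simp only [e1, e2]
    split_ifs
    · simp
    · rfl
    · rfl
  have hint := fun i v => (hcond.measurable_tree.prodMk (hcond.measurable_init (i ++ v)))
  have hinit : ∀ v, Measurable (initPair T X v) := fun v =>
    ((UHTree.measurable_mem v).comp hcond.measurable_tree).prodMk (hcond.measurable_init v)
  let D : Equiv.Perm (Fin n) → Ω → (Prop × 𝒳) × (Fin n → UHLabel → Prop × 𝒳) := fun σ ω =>
    (initPair T X [] ω, fun i v => initPair T X ((σ i : ℕ).succPNat :: v) ω)
  have hD : ∀ σ, Measurable (D σ) := fun σ => (hinit _).prodMk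
    (measurable_pi_lambda _ fun i => measurable_pi_lambda _ fun v => hinit _)
  -- Multiplying by the mass of the event turns the conditioned law into the restricted one.
  have hex : (P.restrict A).map (D σ) = (P.restrict A).map (D 1) := by
    have h1 := hcond.exchangeable n hn hP σ
    rw [← hA, ProbabilityTheory.cond, Measure.map_smul, Measure.map_smul] at h1
    have h2 := congrArg (fun μ => P A • μ) h1
    simp only [smul_smul, ENNReal.mul_inv_cancel hP (measure_ne_top P A), one_smul] at h2
    exact h2
  -- Rebuilds all coordinates from the root and the `n` subtrees; `i.natPred < n` means `i ≤ n`, and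
  -- other labels get the dead value.
  let R : (Prop × 𝒳) × (Fin n → UHLabel → Prop × 𝒳) → UHLabel → Prop × 𝒳 := fun y v =>
    match v with
    | [] => y.1
    | i :: w => if h : i.natPred < n then y.2 ⟨i.natPred, h⟩ w else (False, ϖ)
  have hR : Measurable R := by
    refine measurable_pi_lambda _ fun v => ?_
    cases v with
    | nil => exact measurable_fst
    | cons i w =>
      by_cases h : i.natPred < n
      · simp only [R, dif_pos h]
        exact (measurable_pi_apply w).comp ((measurable_pi_apply _).comp measurable_snd)
      · simp only [R, dif_neg h]
        exact measurable_const
  have hdead : ∀ᵐ ω ∂P.restrict A, ∀ (i : ℕ+) (w : UHLabel), ¬ i.natPred < n →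
      initPair T X (i :: w) ω = (False, ϖ) := by
    rw [ae_restrict_iff' hAm]
    filter_upwards [ae_all_iff.2 hcond.init_eq_iff] with ω hω hωA i w hi
    have h1 : i :: w ∉ (T ω).1 := by
      intro h
      have h2 := ((T ω).singleton_mem_iff i).1 ((T ω).2.mem_of_append_mem [i] w h)
      have h3 := PNat.natPred_add_one i
      have : ((T ω).nbhd []).card = n := hωA
      omega
    simp [initPair, h1, (hω _).2 h1]
  have hswap : Measurable fun ω =>
      (UHTree.swapTree j (T ω), fun v => X (relabel (Equiv.swap 1 j) v) 0 ω) :=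
    ((UHTree.measurable_swapTree j).comp hcond.measurable_tree).prodMk
      (measurable_pi_lambda _ fun v => hcond.measurable_init _)
  apply UHTree.ext_of_map_coords
  rw [Measure.map_map UHTree.measurable_coords hswap,
    Measure.map_map UHTree.measurable_coords hcond.measurable_initial]
  trans ((P.restrict A).map (D σ)).map R
  · rw [Measure.map_map hR (hD σ)]
    refine Measure.map_congr ?_
    filter_upwards [hdead, ae_restrict_mem hAm] with ω hω hωA
    have hjm : [j] ∈ (T ω).1 := ((T ω).singleton_mem_iff j).2 (by
      have : ((T ω).nbhd []).card = n := hωA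
      omega)
    ext1 v
    have hv : UHTree.coords (UHTree.swapTree j (T ω),
        fun v => X (relabel (Equiv.swap 1 j) v) 0 ω) v =
        initPair T X (relabel (Equiv.swap 1 j) v) ω :=
      Prod.ext (propext (UHTree.mem_swapTree hjm v)) rfl
    simp only [Function.comp_apply, hv]
    cases v with
    | nil => rfl
    | cons i w =>
      by_cases h : i.natPred < n
      · simp only [R, dif_pos h, D, hσ, relabel_cons, PNat.succPNat_natPred]
      · have h3 := PNat.natPred_add_one i
        have hi : Equiv.swap 1 j i = i := by
          refine Equiv.swap_apply_of_ne_of_ne ?_ ?_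
          · rintro rfl; exact h (by simp only [PNat.one_coe] at h3; omega)
          · rintro rfl; omega
        simp only [R, dif_neg h, relabel_cons, hi, hω i w h]
  · rw [hex, Measure.map_map hR (hD 1)]
    refine Measure.map_congr ?_
    filter_upwards [hdead] with ω hω
    ext1 v
    cases v with
    | nil => rfl
    | cons i w =>
      by_cases h : i.natPred < n
      · simp only [Function.comp_apply, R, dif_pos h, D, Equiv.Perm.coe_one, id_eq,
          PNat.succPNat_natPred]
        rfl
      · simp only [Function.comp_apply, R, dif_neg h]
        exact (hω i w h).symm

include hX in
/-- Exchangeability is inherited by the trajectories. -/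
theorem setLIntegral_pairAt_child {k : ℕ} {q : PairState 𝒳 k → ℝ≥0∞} (hq : Measurable q)
    {j : ℕ+} {n : ℕ} (hj : (j : ℕ) ≤ n) :
    ∫⁻ ω in {ω | ((T ω).nbhd []).card = n}, q (pairAt T X k [] [j] ω) ∂P =
      ∫⁻ ω in {ω | ((T ω).nbhd []).card = n}, q (pairAt T X k [] [1] ω) ∂P := by
  have := hcond.isProbabilityMeasure_noise
  have hs : MeasurableSet {p : UHTree × (UHLabel → 𝒳) | (p.1.nbhd []).card = n} :=
    (UHTree.measurable_card_nbhd []).comp measurable_fst (measurableSet_singleton n)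
  have h1 := hcond.setLIntegral_pairAt hX hq [] [j] hs
  have h2 := hcond.setLIntegral_pairAt hX hq [] [1] hs
  simp only [Set.preimage_ofPred_eq] at h1 h2
  rw [h1, h2]
  have hm : Measurable fun p => pairMean ϖ F (P.map (ξ [] 1)) q (UHTree.data p) [] [1] :=
    (measurable_pairMean ϖ F (P.map (ξ [] 1)) hcond.measurable_update hq [] [1]).comp
      UHTree.measurable_data
  have hswap : Measurable fun ω =>
      (UHTree.swapTree j (T ω), fun v => X (relabel (Equiv.swap 1 j) v) 0 ω) :=
    ((UHTree.measurable_swapTree j).comp hcond.measurable_tree).prodMk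
      (measurable_pi_lambda _ fun v => hcond.measurable_init _)
  rw [← lintegral_map hm hcond.measurable_initial, ← hcond.map_restrict_swap hj,
    lintegral_map hm hswap]
  refine setLIntegral_congr_fun (hcond.measurableSet_card n) fun ω hω => ?_
  have hω' : ((T ω).nbhd []).card = n := hω
  have hjm : [j] ∈ (T ω).1 := ((T ω).singleton_mem_iff j).2 (by omega)
  have hττ : ∀ i, Equiv.swap 1 j (Equiv.swap 1 j i) = i := fun i => Equiv.swap_apply_self 1 j i
  have hmem : ∀ v, relabel (Equiv.swap 1 j) v ∈ (UHTree.swapTree j (T ω)).1 ↔ v ∈ (T ω).1 := by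
    intro v
    rw [UHTree.mem_swapTree hjm, relabel_relabel hττ]
  -- The relabeling is an isomorphism from the original tree to the swapped one; it fixes the root
  -- and takes `[j]` to `[1]`.
  have := pairMean_iso ϖ F (P.map (ξ [] 1)) hcond.measurable_update hq
    (d := UHTree.data (T ω, fun v => X v 0 ω))
    (d' := UHTree.data (UHTree.swapTree j (T ω), fun v => X (relabel (Equiv.swap 1 j) v) 0 ω))
    (fun u v h => h.2.1) (fun u v h => h.2.1) (relabel (Equiv.swap 1 j))
    ⟨fun v hv => (hmem v).2 hv, fun u _ v _ h => by
      rw [← relabel_relabel hττ u, h, relabel_relabel hττ], fun v hv =>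
      ⟨relabel (Equiv.swap 1 j) v, (UHTree.mem_swapTree hjm v).1 hv, relabel_relabel hττ v⟩⟩
    (fun u v _ _ => by
      simp only [UHTree.data, UHTree.Adj, hmem, exists_relabel_append_iff hττ])
    (fun v _ => by simp only [UHTree.data, relabel_relabel hττ])
    (T ω).2.root_mem (show [j] ∈ (T ω).1 from hjm)
  simpa using this.symm

end UGWCondition

/-! ### Fresh noise and the mass transport identity. -/

theorem comap_reindex_le {ι γ Ξ : Type*} [MeasurableSpace Ξ] (ψ : γ → ι) :
    MeasurableSpace.comap (fun (e : ι → Ξ) a => e (ψ a)) inferInstance ≤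
      ⨆ i ∈ Set.range ψ, MeasurableSpace.comap (fun e : ι → Ξ => e i) inferInstance := by
  refine Measurable.comap_le ?_
  refine @measurable_pi_lambda _ _ _ (_) _ _ fun a => ?_
  exact Measurable.mono (comap_measurable _) (le_iSup₂_of_le (ψ a) ⟨a, rfl⟩ le_rfl) le_rfl

theorem indepFun_infinitePi_of_disjoint {ι α β Ξ : Type*} [MeasurableSpace Ξ] {θ : Measure Ξ}
    [IsProbabilityMeasure θ] {ψ₁ : α → ι} {ψ₂ : β → ι} (h : ∀ a b, ψ₁ a ≠ ψ₂ b) :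
    IndepFun (fun (e : ι → Ξ) a => e (ψ₁ a)) (fun (e : ι → Ξ) b => e (ψ₂ b))
      (Measure.infinitePi fun _ : ι => θ) := by
  have hi : iIndepFun (fun (i : ι) (e : ι → Ξ) => e i) (Measure.infinitePi fun _ : ι => θ) :=
    iIndepFun_infinitePi (X := fun _ x => x) fun _ => measurable_id
  have hd := indep_iSup_of_disjoint (fun i => (measurable_pi_apply i).comap_le)
    ((iIndepFun_iff_iIndep _ _ _).1 hi)
    (S := Set.range ψ₁) (T := Set.range ψ₂) (by
      rw [Set.disjoint_left]
      rintro _ ⟨a, rfl⟩ ⟨b, hb⟩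
      exact h a b hb.symm)
  exact (IndepFun_iff_Indep _ _ _).2
    (indep_of_indep_of_le_left (indep_of_indep_of_le_right hd (comap_reindex_le ψ₂))
      (comap_reindex_le ψ₁))

/-- Disjoint parts of an i.i.d. family are independent i.i.d. families. It serves twice: to separate
past from present noise, and the noise in a subtree from that outside. -/
theorem map_infinitePi_prod_of_disjoint {ι α β Ξ : Type*} [MeasurableSpace Ξ] {θ : Measure Ξ}
    [IsProbabilityMeasure θ] {ψ₁ : α → ι} {ψ₂ : β → ι} (h : ∀ a b, ψ₁ a ≠ ψ₂ b)
    (h₁ : Function.Injective ψ₁) (h₂ : Function.Injective ψ₂) :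
    (Measure.infinitePi fun _ : ι => θ).map (fun e => ((fun a => e (ψ₁ a)), (fun b => e (ψ₂ b)))) =
      (Measure.infinitePi fun _ : α => θ).prod (Measure.infinitePi fun _ : β => θ) := by
  rw [(indepFun_iff_map_prod_eq_prod_map_map
    (Measurable.aemeasurable (by fun_prop)) (Measurable.aemeasurable (by fun_prop))).1
    (indepFun_infinitePi_of_disjoint h), Measure.map_infinitePi_infinitePi_of_inj h₁,
    Measure.map_infinitePi_infinitePi_of_inj h₂]

namespace UGWCondition

variable {Ω 𝒳 Ξ : Type*} {ϖ : 𝒳} {ρ₀ ρ : PMF ℕ} {T : Ω → UHTree} {X : UHLabel → ℕ → Ω → 𝒳}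
  {ξ : UHLabel → ℕ → Ω → Ξ}
  {F : (k : ℕ) → (Fin (k + 1) → 𝒳) → Unordered (Fin (k + 1) → 𝒳) → Ξ → 𝒳}
  [MeasurableSpace Ω] [MeasurableSpace 𝒳] [MeasurableSpace Ξ] {P : Measure Ω}
  [IsProbabilityMeasure P]
  (hcond : UGWCondition P ϖ ρ₀ ρ T X ξ F) (hX : IsParticleSystem ϖ T X ξ F)

include hcond hX

/-- The noise of step `k + 1` is independent of the tree and the trajectories up to time `k`. -/
theorem lintegral_noise_step (k : ℕ)
    {H : (UHTree × (UHLabel → Fin (k + 1) → 𝒳)) × (UHLabel → Ξ) → ℝ≥0∞} (hH : Measurable H) :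
    ∫⁻ ω, H ((T ω, fun v => traj X v k ω), fun v => ξ v (k + 1) ω) ∂P =
      ∫⁻ ω, ∫⁻ η, H ((T ω, fun v => traj X v k ω), η)
        ∂(Measure.infinitePi fun _ : UHLabel => P.map (ξ [] 1)) ∂P := by
  classical
  have := hcond.isProbabilityMeasure_noise
  set θ := P.map (ξ [] 1) with hθ
  obtain ⟨ξ₀⟩ : Nonempty Ξ := nonempty_of_isProbabilityMeasure θ
  have : IsProbabilityMeasure (P.map fun ω => (T ω, fun v => X v 0 ω)) :=
    Measure.isProbabilityMeasure_map hcond.measurable_initial.aemeasurable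
  -- The past noises; the value `ξ₀` that `ext` gives to later ones is not read by trajectories up
  -- to time `k`.
  let S := {p : UHLabel × ℕ // p.2 < k}
  let ext : (S → Ξ) → UHLabel × ℕ → Ξ := fun g p => if h : p.2 < k then g ⟨p, h⟩ else ξ₀
  have hext : Measurable ext := by
    refine measurable_pi_lambda _ fun v => ?_
    by_cases h : v.2 < k
    · simpa [ext, h] using measurable_pi_apply _
    · simp [ext, h]
  let st : (UHTree × (UHLabel → 𝒳)) × (S → Ξ) → UHTree × (UHLabel → Fin (k + 1) → 𝒳) := fun p =>
    (p.1.1, fun v => graphTraj ϖ F (UHTree.data p.1) (ext p.2) k v)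
  have hst : Measurable st := by
    refine measurable_fst.fst.prodMk (measurable_pi_lambda _ fun v => ?_)
    exact (measurable_graphTraj ϖ F hcond.measurable_update k v).comp
      ((UHTree.measurable_data.comp measurable_fst).prodMk (hext.comp measurable_snd))
  have hst_eq : ∀ ω, (T ω, fun v => traj X v k ω) = st ((T ω, fun v => X v 0 ω),
      fun s => ξ s.1.1 (s.1.2 + 1) ω) := by
    intro ω
    refine Prod.ext rfl (funext fun v => ?_)
    change traj X v k ω = graphTraj ϖ F _ _ k v
    rw [traj_eq_graphTraj hX]
    exact graphTraj_congr_noise (fun v i hi => by simp [ext, hi]) v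
  let past : (UHLabel × ℕ → Ξ) → S → Ξ := fun e s => e s.1
  let now : (UHLabel × ℕ → Ξ) → UHLabel → Ξ := fun e v => e (v, k)
  have hpast : Measurable past := by fun_prop
  have hnow : Measurable now := by fun_prop
  have hsplit : (Measure.infinitePi fun _ : UHLabel × ℕ => θ).map (fun e => (past e, now e)) =
      (Measure.infinitePi fun _ : S => θ).prod (Measure.infinitePi fun _ : UHLabel => θ) :=
    map_infinitePi_prod_of_disjoint (ψ₁ := fun s : S => s.1) (ψ₂ := fun v => (v, k))
      (fun a b hab => by
        have := a.2
        rw [hab] at this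
        simp at this) Subtype.val_injective (fun a b hab => by simpa using hab)
  have hpastlaw : (Measure.infinitePi fun _ : UHLabel × ℕ => θ).map past =
      Measure.infinitePi fun _ : S => θ :=
    Measure.map_infinitePi_infinitePi_of_inj (P := fun _ : UHLabel × ℕ => θ) Subtype.val_injective
  have hG : Measurable fun p : ((UHTree × (UHLabel → 𝒳)) × (UHLabel × ℕ → Ξ)) =>
      H (st (p.1, past p.2), now p.2) :=
    hH.comp ((hst.comp (measurable_fst.prodMk (hpast.comp measurable_snd))).prodMk
      (hnow.comp measurable_snd))
  have hH' : Measurable fun s => ∫⁻ η, H (s, η) ∂(Measure.infinitePi fun _ : UHLabel => θ) :=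
    hH.lintegral_prod_right'
  have hG' : Measurable fun p : ((UHTree × (UHLabel → 𝒳)) × (UHLabel × ℕ → Ξ)) =>
      ∫⁻ η, H (st (p.1, past p.2), η) ∂(Measure.infinitePi fun _ : UHLabel => θ) :=
    hH'.comp (hst.comp (measurable_fst.prodMk (hpast.comp measurable_snd)))
  have hall := hcond.measurable_initial.prodMk hcond.measurable_noises
  simp only [hst_eq]
  have e1 := lintegral_map (μ := P) hG hall
  have e2 := lintegral_map (μ := P) hG' hall
  rw [hcond.map_initial_noises] at e1 e2
  change _ = ∫⁻ ω, H (st ((T ω, fun v => X v 0 ω), fun s => ξ s.1.1 (s.1.2 + 1) ω),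
    fun v => ξ v (k + 1) ω) ∂P at e1
  change _ = ∫⁻ ω, ∫⁻ η, H (st ((T ω, fun v => X v 0 ω), fun s => ξ s.1.1 (s.1.2 + 1) ω), η)
    ∂(Measure.infinitePi fun _ : UHLabel => θ) ∂P at e2
  rw [← e1, ← e2, lintegral_prod _ hG.aemeasurable, lintegral_prod _ hG'.aemeasurable]
  -- For fixed initial data the past noise determines the state, and the present noise is an
  -- independent factor.
  refine lintegral_congr fun i => ?_
  have hg1 : Measurable fun p : (S → Ξ) × (UHLabel → Ξ) => H (st (i, p.1), p.2) :=
    hH.comp ((hst.comp (measurable_const.prodMk measurable_fst)).prodMk measurable_snd)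
  have hg2 : Measurable fun p : (S → Ξ) =>
      ∫⁻ η, H (st (i, p), η) ∂(Measure.infinitePi fun _ : UHLabel => θ) :=
    hH'.comp (hst.comp (measurable_const.prodMk measurable_id))
  have e3 := lintegral_map (μ := Measure.infinitePi fun _ : UHLabel × ℕ => θ) hg1 (hpast.prodMk hnow)
  have e4 := lintegral_map (μ := Measure.infinitePi fun _ : UHLabel × ℕ => θ) hg2 hpast
  rw [hsplit, lintegral_prod _ hg1.aemeasurable] at e3
  rw [hpastlaw] at e4
  exact e3.symm.trans e4

/-- The sum over the children of the root of a functional of the joint state. -/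
theorem tsum_setLIntegral_eq {k : ℕ} {q : PairState 𝒳 k → ℝ≥0∞} (hq : Measurable q) :
    ∑' j : ℕ+, ∫⁻ ω in {ω | [j] ∈ (T ω).1}, q (pairAt T X k [] [j] ω) ∂P =
      ∫⁻ ω, ((T ω).nbhd []).card * q (pairAt T X k [] [1] ω) ∂P := by
  have hqm : ∀ j : ℕ+, Measurable fun ω => q (pairAt T X k [] [j] ω) := fun j =>
    hq.comp (hcond.measurable_pairAt hX k [] [j])
  have hdec : ∀ f : Ω → ℝ≥0∞, Measurable f →
      ∫⁻ ω, f ω ∂P = ∑' n : ℕ, ∫⁻ ω in {ω | ((T ω).nbhd []).card = n}, f ω ∂P := by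
    intro f hf
    rw [← lintegral_iUnion (fun n => hcond.measurableSet_card n)]
    · rw [show (⋃ n : ℕ, {ω | ((T ω).nbhd []).card = n}) = Set.univ by ext; simp,
        Measure.restrict_univ]
    · intro a b hab
      rw [Function.onFun, Set.disjoint_left]
      rintro ω h1 h2
      exact hab (h1.symm.trans h2)
  have hcount : ∀ n : ℕ, ∑' j : ℕ+, (if (j : ℕ) ≤ n then (1 : ℝ≥0∞) else 0) = n := by
    intro n
    rw [← Equiv.tsum_eq Equiv.pnatEquivNat.symm,
      tsum_eq_sum (s := Finset.range n)]
    · rw [Finset.sum_congr rfl fun i hi => if_pos ?_]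
      · simp
      · have := Finset.mem_range.1 hi
        simp only [Equiv.pnatEquivNat_symm_apply, Nat.succPNat_coe]
        omega
    · intro i hi
      have := Finset.mem_range.not.1 hi
      refine if_neg ?_
      simp only [Equiv.pnatEquivNat_symm_apply, Nat.succPNat_coe]
      omega
  -- On the event of `n` children, exchangeability replaces `[j]` by `[1]` for each `j ≤ n`. The
  -- term no longer depends on `j`, and the number of such labels is `n`.
  have hj : ∀ j : ℕ+, ∫⁻ ω in {ω | [j] ∈ (T ω).1}, q (pairAt T X k [] [j] ω) ∂P =
      ∑' n : ℕ, (if (j : ℕ) ≤ n then 1 else 0) *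
        ∫⁻ ω in {ω | ((T ω).nbhd []).card = n}, q (pairAt T X k [] [1] ω) ∂P := by
    intro j
    rw [← lintegral_indicator (hcond.measurableSet_mem [j]),
      hdec _ ((hqm j).indicator (hcond.measurableSet_mem [j]))]
    refine tsum_congr fun n => ?_
    by_cases hn : (j : ℕ) ≤ n
    · rw [if_pos hn, one_mul, ← hcond.setLIntegral_pairAt_child hX hq hn]
      refine setLIntegral_congr_fun (hcond.measurableSet_card n) fun ω hω => ?_
      refine Set.indicator_of_mem ?_ _
      exact ((T ω).singleton_mem_iff j).2 (by rw [show ((T ω).nbhd []).card = n from hω]; exact hn)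
    · rw [if_neg hn, zero_mul]
      refine (setLIntegral_congr_fun (hcond.measurableSet_card n) fun ω hω => ?_).trans
        (lintegral_zero)
      refine Set.indicator_of_notMem (fun h => hn ?_) _
      have := ((T ω).singleton_mem_iff j).1 h
      rwa [show ((T ω).nbhd []).card = n from hω] at this
  simp_rw [hj]
  rw [ENNReal.tsum_comm, hdec]
  · refine tsum_congr fun n => ?_
    rw [ENNReal.tsum_mul_right, hcount, ← lintegral_const_mul _ (hqm 1)]
    refine setLIntegral_congr_fun (hcond.measurableSet_card n) fun ω hω => ?_
    simp only [show ((T ω).nbhd []).card = n from hω]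
  · exact (measurable_from_top.comp
      ((UHTree.measurable_card_nbhd []).comp hcond.measurable_tree)).mul (hqm 1)

/-- The mass transport principle at the edge between the root and its first child. -/
theorem lintegral_card_mul {k : ℕ} {q : PairState 𝒳 k → ℝ≥0∞} (hq : Measurable q)
    {C : ℝ≥0} (hC : ∀ x, q x ≤ C) :
    ∫⁻ ω, ((T ω).nbhd []).card * q (pairAt T X k [] [1] ω) ∂P =
      ∫⁻ ω, ((T ω).nbhd []).card * q (pairAt T X k [1] [] ω) ∂P := by
  let sw : PairState 𝒳 k → PairState 𝒳 k := fun x => (x.2.1, x.1, x.2.2.2, x.2.2.1)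
  have hsw : Measurable sw := by fun_prop
  rw [← hcond.tsum_setLIntegral_eq hX hq, hcond.tsum_lintegral_pairAt hX hq hC]
  exact hcond.tsum_setLIntegral_eq hX (hq.comp hsw)

/-- The size-biased law of the trajectories at and around the root is the law of the trajectories at
and around the first child. -/
theorem lintegral_card_div_card {k : ℕ}
    {f : (Fin (k + 1) → 𝒳) × (Fin (k + 1) → 𝒳) × Unordered (Fin (k + 1) → 𝒳) → ℝ≥0∞}
    (hf : Measurable f) {C : ℝ≥0} (hC : ∀ x, f x ≤ C) :
    ∫⁻ ω in {ω | [1] ∈ (T ω).1}, ((T ω).nbhd []).card / ((T ω).nbhd [1]).card *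
        f (traj X [] k ω, traj X [1] k ω, siteNbhd T X k [] ω) ∂P =
      ∫⁻ ω in {ω | [1] ∈ (T ω).1}, f (traj X [1] k ω, traj X [] k ω, siteNbhd T X k [1] ω) ∂P := by
  -- The inverse degree, with value 0 rather than ∞ at degree 0 so that the test function below
  -- stays bounded.
  let wt : ℕ → ℝ≥0∞ := fun n => if n = 0 then 0 else (n : ℝ≥0∞)⁻¹
  have hwt : ∀ n, wt n ≤ 1 := by
    intro n
    by_cases h : n = 0
    · simp [wt, h]
    · simp only [wt, if_neg h, ENNReal.inv_le_one]
      exact_mod_cast Nat.one_le_iff_ne_zero.2 h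
  -- Dividing by the degree of the second site: with the root first, mass transport yields the
  -- weight |N_ø| / |N_1|; with the sites exchanged, the divisor is |N_ø| and cancels the factor
  -- |N_ø|.
  let q : PairState 𝒳 k → ℝ≥0∞ := fun x => f (x.1, x.2.1, x.2.2.1) * wt x.2.2.2.length
  have hq : Measurable q := by
    refine (hf.comp (by fun_prop)).mul ?_
    exact (measurable_from_top (f := wt)).comp
      (Unordered.measurable_length.comp measurable_snd.snd.snd)
  have hqC : ∀ x, q x ≤ C := fun x => (mul_le_mul' (hC _) (hwt _)).trans (by simp)
  have h := hcond.lintegral_card_mul hX hq hqC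
  have hroot : ∀ ω, [1] ∉ (T ω).1 → ((T ω).nbhd []).card = 0 := by
    intro ω hω
    have := ((T ω).singleton_mem_iff 1).not.1 hω
    simp only [PNat.one_coe] at this
    omega
  have hpos : ∀ ω, [1] ∈ (T ω).1 → ((T ω).nbhd []).card ≠ 0 ∧ ((T ω).nbhd [1]).card ≠ 0 := by
    intro ω hω
    refine ⟨Finset.card_ne_zero.2 ⟨[1], ?_⟩, Finset.card_ne_zero.2 ⟨[], ?_⟩⟩
    · exact (UHTree.mem_nbhd _ _ _).2 (((T ω).adj_root_iff _).2 ⟨1, hω, rfl⟩)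
    · exact (UHTree.mem_nbhd _ _ _).2 (UHTree.adj_symm (((T ω).adj_root_iff _).2 ⟨1, hω, rfl⟩))
  rw [← lintegral_indicator (hcond.measurableSet_mem [1]),
    ← lintegral_indicator (hcond.measurableSet_mem [1])]
  convert h using 1
  · refine lintegral_congr fun ω => ?_
    by_cases hω : [1] ∈ (T ω).1
    · rw [Set.indicator_of_mem (by exact hω)]
      simp only [q, pairAt, siteNbhd, Unordered.length_ofFinset, wt, if_neg (hpos ω hω).2,
        div_eq_mul_inv]
      ring
    · rw [Set.indicator_of_notMem (by exact hω), hroot ω hω]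
      simp
  · refine lintegral_congr fun ω => ?_
    by_cases hω : [1] ∈ (T ω).1
    · rw [Set.indicator_of_mem (by exact hω)]
      simp only [q, pairAt, siteNbhd, Unordered.length_ofFinset, wt, if_neg (hpos ω hω).1]
      rw [mul_comm, mul_assoc, ENNReal.inv_mul_cancel, mul_one]
      · exact_mod_cast (hpos ω hω).1
      · exact ENNReal.natCast_ne_top _
    · rw [Set.indicator_of_notMem (by exact hω), hroot ω hω]
      simp

end UGWCondition

/-! ### Conditional independence in terms of kernels. -/

/-- If `f` and `g` are conditionally independent given `h`, then the conditional law of `f` given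
`(g, h)` is the conditional law of `f` given `h`. -/
theorem CondIndepGiven.lintegral_eq {Ω α β γ : Type*} [mΩ : MeasurableSpace Ω] [MeasurableSpace α]
    [MeasurableSpace β] [mγ : MeasurableSpace γ] {P : Measure Ω} [IsProbabilityMeasure P]
    {f : Ω → α} {g : Ω → β} {h : Ω → γ} (hf : Measurable f) (hg : Measurable g) (hh : Measurable h)
    (hind : CondIndepGiven P f g h) (κ : Kernel γ α) [IsMarkovKernel κ]
    (hκ : ∀ A, MeasurableSet A → P⟦f ⁻¹' A | mγ.comap h⟧ =ᵐ[P] fun ω => (κ (h ω)).real A)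
    {φ : (β × γ) × α → ℝ≥0∞} (hφ : Measurable φ) :
    ∫⁻ ω, φ ((g ω, h ω), f ω) ∂P = ∫⁻ ω, ∫⁻ a, φ ((g ω, h ω), a) ∂(κ (h ω)) ∂P := by
  have hgh := hg.prodMk hh
  have : IsProbabilityMeasure (P.map fun ω => (g ω, h ω)) :=
    Measure.isProbabilityMeasure_map hgh.aemeasurable
  have : IsProbabilityMeasure (P.map fun ω => ((g ω, h ω), f ω)) :=
    Measure.isProbabilityMeasure_map (hgh.prodMk hf).aemeasurable
  -- It is enough to identify the joint law as a composition product, and for finite measures this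
  -- is checked on boxes.
  have key : P.map (fun ω => ((g ω, h ω), f ω)) =
      (P.map fun ω => (g ω, h ω)) ⊗ₘ (κ.comap Prod.snd measurable_snd) := by
    refine Measure.ext_prod₃' fun {B H A} hB hH hA => ?_
    rw [Measure.compProd_apply_prod (hB.prod hH) hA,
      Measure.map_apply (hgh.prodMk hf) ((hB.prod hH).prod hA), setLIntegral_map (hB.prod hH)
        ((Kernel.measurable_coe _ hA)) hgh]
    simp only [Kernel.comap_apply]
    have hm : mγ.comap h ≤ mΩ := hh.comap_le
    have hHm : MeasurableSet[mγ.comap h] (h ⁻¹' H) := ⟨H, hH, rfl⟩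
    have hκm : Measurable fun c => (κ c).real A := (Kernel.measurable_coe κ hA).ennreal_toReal
    have hκs : StronglyMeasurable[mγ.comap h] fun ω => (κ (h ω)).real A :=
      (hκm.comp (comap_measurable h)).stronglyMeasurable
    have hBi : Integrable ((g ⁻¹' B).indicator fun _ => (1 : ℝ)) P :=
      (integrable_const 1).indicator (hg hB)
    have hAB : MeasurableSet (f ⁻¹' A ∩ g ⁻¹' B) := (hf hA).inter (hg hB)
    -- The conditional probability of `f ⁻¹' A` is a bounded function of `h`, so it can be moved
    -- inside the conditional expectation of the indicator of `g ⁻¹' B`.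
    have e1 : P⟦f ⁻¹' A ∩ g ⁻¹' B | mγ.comap h⟧ =ᵐ[P]
        P[(fun ω => (κ (h ω)).real A) * (g ⁻¹' B).indicator (fun _ => (1 : ℝ)) | mγ.comap h] := by
      refine (hind A B hA hB).trans ?_
      refine Filter.EventuallyEq.trans ?_ (condExp_stronglyMeasurable_mul_of_bound hm hκs hBi 1
        (.of_forall fun ω => ?_)).symm
      · filter_upwards [hκ A hA] with ω hω
        simp [hω]
      · rw [Real.norm_of_nonneg measureReal_nonneg]
        exact measureReal_le_one
    have hprod : Integrable ((fun ω => (κ (h ω)).real A) * (g ⁻¹' B).indicator (fun _ => (1 : ℝ))) P := by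
      refine hBi.bdd_mul (c := 1) (hκm.comp hh).aestronglyMeasurable (.of_forall fun ω => ?_)
      rw [Real.norm_of_nonneg measureReal_nonneg]
      exact measureReal_le_one
    have e2 : ∫ ω in h ⁻¹' H, (f ⁻¹' A ∩ g ⁻¹' B).indicator (fun _ => (1 : ℝ)) ω ∂P =
        ∫ ω in h ⁻¹' H, ((fun ω => (κ (h ω)).real A) * (g ⁻¹' B).indicator (fun _ => (1 : ℝ))) ω ∂P := by
      rw [← setIntegral_condExp hm ((integrable_const 1).indicator hAB) hHm,
        ← setIntegral_condExp hm hprod hHm]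
      exact setIntegral_congr_ae (hh hH) (e1.mono fun ω h _ => h)
    have e3 : ((fun ω => (κ (h ω)).real A) * (g ⁻¹' B).indicator (fun _ => (1 : ℝ))) =
        (g ⁻¹' B).indicator fun ω => (κ (h ω)).real A := by
      ext ω
      by_cases hω : ω ∈ g ⁻¹' B <;> simp [hω]
    rw [e3, setIntegral_indicator (hg hB), setIntegral_indicator hAB] at e2
    have hset : (fun ω => ((g ω, h ω), f ω)) ⁻¹' ((B ×ˢ H) ×ˢ A) = h ⁻¹' H ∩ (f ⁻¹' A ∩ g ⁻¹' B) := by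
      ext ω
      simp only [Set.mem_preimage, Set.mem_prod, Set.mem_inter_iff]
      tauto
    have hset' : (fun ω => (g ω, h ω)) ⁻¹' (B ×ˢ H) = h ⁻¹' H ∩ g ⁻¹' B := by
      ext ω
      simp only [Set.mem_preimage, Set.mem_prod, Set.mem_inter_iff]
      tauto
    rw [hset, hset']
    have e4 : ∫⁻ ω in h ⁻¹' H ∩ g ⁻¹' B, κ (h ω) A ∂P =
        ENNReal.ofReal (∫ ω in h ⁻¹' H ∩ g ⁻¹' B, (κ (h ω)).real A ∂P) := by
      rw [ofReal_integral_eq_lintegral_ofReal]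
      · refine lintegral_congr fun ω => ?_
        simp
      · exact (Integrable.of_bound (hκm.comp hh).aestronglyMeasurable 1 (.of_forall fun ω => by
          rw [Function.comp_apply, Real.norm_of_nonneg measureReal_nonneg]
          exact measureReal_le_one)).integrableOn
      · exact .of_forall fun ω => measureReal_nonneg
    rw [e4, ← e2]
    simp
  have h1 := lintegral_map (μ := P) hφ (hgh.prodMk hf)
  rw [key, Measure.lintegral_compProd hφ, lintegral_map hφ.lintegral_kernel_prod_right' hgh] at h1
  exact h1.symm

/-! ### Locality of the dynamics. -/

/-- The state of a site: the indicator of being a vertex, and the trajectory up to time `k`. -/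
abbrev SiteState (𝒳 : Type*) (k : ℕ) : Type _ := Prop × (Fin (k + 1) → 𝒳)

section LocalDynamics

variable {Ω 𝒳 Ξ : Type*}

/-- The state of the site `v`. -/
def site (T : Ω → UHTree) (X : UHLabel → ℕ → Ω → 𝒳) (k : ℕ) (v : UHLabel) (ω : Ω) : SiteState 𝒳 k :=
  (v ∈ (T ω).1, traj X v k ω)

/-- The states of the potential neighbors of `v`: its parent and its children. -/
def aroundSite {k : ℕ} (f : UHLabel → SiteState 𝒳 k) (v : UHLabel) : Option ℕ+ → SiteState 𝒳 k
  | none => if v = [] then (False, (f v).2) else f v.dropLast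
  | some i => f (v ++ [i])

open Classical in
/-- The state at time `k + 1` at `v`, computed from the states at `v` and around `v`. -/
noncomputable def fieldStep (ϖ : 𝒳)
    (F : (k : ℕ) → (Fin (k + 1) → 𝒳) → Unordered (Fin (k + 1) → 𝒳) → Ξ → 𝒳) {k : ℕ}
    (f : UHLabel → SiteState 𝒳 k) (v : UHLabel) (e : Ξ) : 𝒳 :=
  if (f v).1 then F k (f v).2 (Unordered.ofMarked (aroundSite f v)) e else ϖ

def SiteState.extend {k : ℕ} (a : SiteState 𝒳 k) (x : 𝒳) : SiteState 𝒳 (k + 1) :=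
  (a.1, Fin.snoc (α := fun _ => 𝒳) a.2 x)

def SiteState.init {k : ℕ} (a : SiteState 𝒳 (k + 1)) : SiteState 𝒳 k := (a.1, fun i => a.2 i.castSucc)

@[simp] theorem SiteState.init_extend {k : ℕ} (a : SiteState 𝒳 k) (x : 𝒳) :
    (a.extend x).init = a := by
  refine Prod.ext rfl (funext fun i => ?_)
  simp [SiteState.extend, SiteState.init]

variable {ϖ : 𝒳} {T : Ω → UHTree} {X : UHLabel → ℕ → Ω → 𝒳} {ξ : UHLabel → ℕ → Ω → Ξ}
  {F : (k : ℕ) → (Fin (k + 1) → 𝒳) → Unordered (Fin (k + 1) → 𝒳) → Ξ → 𝒳}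

/-- `none` stands for the parent and `some i` for the `i`-th child; these labels differ because
their lengths do. At the root the slot of the parent is marked as absent. -/
theorem siteNbhd_eq_ofMarked_around (k : ℕ) (v : UHLabel) (ω : Ω) (hv : v ∈ (T ω).1) :
    siteNbhd T X k v ω = Unordered.ofMarked (aroundSite (fun u => site T X k u ω) v) := by
  rw [siteNbhd_eq_ofMarked]
  have hne : ∀ i, v ++ [i] ≠ v.dropLast := fun i h => by
    have := congrArg List.length h
    simp at this
    omega
  refine Unordered.ofMarked_eq_of_bijOn
    (fun o : Option ℕ+ => o.elim v.dropLast fun i => v ++ [i]) ⟨?_, ?_, ?_⟩ ?_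
  · rintro (_ | i) hi
    · rcases List.eq_nil_or_concat' v with rfl | ⟨u, a, rfl⟩
      · simp [aroundSite] at hi
      · simp only [Option.elim_none, Set.mem_ofPred_eq, List.dropLast_concat]
        refine ⟨hv, ?_, Or.inr ⟨a, rfl⟩⟩
        exact (T ω).2.mem_of_append_mem _ _ hv
    · exact ⟨hv, hi, Or.inl ⟨i, rfl⟩⟩
  · rintro (_ | i) _ (_ | j) _ hij
    · rfl
    · exact absurd hij.symm (hne j)
    · exact absurd hij (hne i)
    · simpa using hij
  · rintro u ⟨-, hu, ⟨i, rfl⟩ | ⟨i, rfl⟩⟩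
    · exact ⟨some i, hu, rfl⟩
    · refine ⟨none, ?_, by simp⟩
      simpa [aroundSite, site] using hu
  · rintro (_ | i) hi
    · by_cases h : v = []
      · simp [aroundSite, h] at hi
      · simp [aroundSite, h, site]
    · rfl

theorem eq_fieldStep (hX : IsParticleSystem ϖ T X ξ F) (k : ℕ) (v : UHLabel) (ω : Ω) :
    X v (k + 1) ω = fieldStep ϖ F (fun u => site T X k u ω) v (ξ v (k + 1) ω) := by
  rw [hX k v ω, fieldStep]
  by_cases hv : v ∈ (T ω).1
  · rw [if_pos hv, if_pos (show (site T X k v ω).1 from hv), ← siteNbhd_eq_ofMarked_around k v ω hv]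
    rfl
  · rw [if_neg hv, if_neg (show ¬ (site T X k v ω).1 from hv)]

theorem site_succ (hX : IsParticleSystem ϖ T X ξ F) (k : ℕ) (v : UHLabel) (ω : Ω) :
    site T X (k + 1) v ω = (site T X k v ω).extend
      (fieldStep ϖ F (fun u => site T X k u ω) v (ξ v (k + 1) ω)) := by
  rw [← eq_fieldStep hX, site, traj_succ]
  rfl

/-- A step at a site reads only the site, its children and its parent. This locality is what
decouples a subtree from its outside. -/
theorem fieldStep_congr {k : ℕ} {f g : UHLabel → SiteState 𝒳 k} {u v : UHLabel} (h0 : f u = g v)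
    (h1 : ∀ i : ℕ+, f (u ++ [i]) = g (v ++ [i])) (h2 : u = [] ↔ v = [])
    (h3 : u ≠ [] → f u.dropLast = g v.dropLast) (e : Ξ) :
    fieldStep ϖ F f u e = fieldStep ϖ F g v e := by
  have : aroundSite f u = aroundSite g v := by
    ext1 o
    cases o with
    | none =>
      by_cases hu : u = []
      · simp only [aroundSite, if_pos hu, if_pos (h2.1 hu), h0]
      · simp only [aroundSite, if_neg hu, if_neg (h2.not.1 hu), h3 hu]
    | some i => exact h1 i
  rw [fieldStep, fieldStep, h0, this]

section Measurability

variable [MeasurableSpace 𝒳] [MeasurableSpace Ξ]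

theorem measurable_aroundSite {k : ℕ} (v : UHLabel) :
    Measurable fun f : UHLabel → SiteState 𝒳 k => aroundSite f v := by
  refine measurable_pi_lambda _ fun o => ?_
  cases o with
  | none =>
    by_cases hv : v = []
    · simp only [aroundSite, if_pos hv]
      exact measurable_const.prodMk (measurable_snd.comp (measurable_pi_apply _))
    · simp only [aroundSite, if_neg hv]
      exact measurable_pi_apply _
  | some i => exact measurable_pi_apply _

theorem measurable_fieldStep (hF : ∀ k, Measurable
      (fun q : (Fin (k + 1) → 𝒳) × Unordered (Fin (k + 1) → 𝒳) × Ξ => F k q.1 q.2.1 q.2.2))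
    {k : ℕ} (v : UHLabel) :
    Measurable fun p : (UHLabel → SiteState 𝒳 k) × Ξ => fieldStep ϖ F p.1 v p.2 := by
  have hv : Measurable fun p : (UHLabel → SiteState 𝒳 k) × Ξ => p.1 v :=
    (measurable_pi_apply v).comp measurable_fst
  refine Measurable.ite (measurableSet_setOfPred.2 hv.fst) ?_ measurable_const
  exact (hF k).comp (hv.snd.prodMk (((Unordered.measurable_ofMarked.comp
    (measurable_aroundSite v)).comp measurable_fst).prodMk measurable_snd))

theorem SiteState.measurable_extend {k : ℕ} :
    Measurable fun p : SiteState 𝒳 k × 𝒳 => p.1.extend p.2 :=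
  measurable_fst.fst.prodMk ((measurable_snoc (k + 1)).comp (measurable_fst.snd.prodMk measurable_snd))

theorem SiteState.measurable_init {k : ℕ} :
    Measurable (SiteState.init : SiteState 𝒳 (k + 1) → SiteState 𝒳 k) :=
  measurable_fst.prodMk (measurable_pi_lambda _ fun _ => (measurable_pi_apply _).comp measurable_snd)

end Measurability

end LocalDynamics

/-! ### The Markov property of subtrees and its propagation in time. -/

section Subtrees

variable {Ω 𝒳 Ξ : Type*}

/-- The states at `[j]`, at the root, and at all labels that are not descendants of `[j]`. -/
abbrev OutsideState (𝒳 : Type*) (k : ℕ) (j : ℕ+) : Type _ :=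
  (UHLabel.below [j] → SiteState 𝒳 k) × (SiteState 𝒳 k × SiteState 𝒳 k)

/-- The states at the strict descendants of a vertex. -/
abbrev SubtreeState (𝒳 : Type*) (k : ℕ) : Type _ := UHLabel₀ → SiteState 𝒳 k

theorem UHLabel.mem_below_singleton_iff {j : ℕ+} {v : UHLabel} :
    v ∈ UHLabel.below [j] ↔ ∃ i w, v = i :: w ∧ i ≠ j := by
  simp only [UHLabel.below, UHLabel.above, Set.mem_compl_iff, Set.mem_union, Set.mem_ofPred_eq,
    Set.mem_insert_iff, Set.mem_singleton_iff, List.dropLast_singleton]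
  cases v with
  | nil => simp
  | cons i w =>
    by_cases hw : w = [] <;> simp [hw]

def outsideOf {k : ℕ} (j : ℕ+) (f : UHLabel → SiteState 𝒳 k) : OutsideState 𝒳 k j :=
  (fun u => f u, (f [j], f []))

def subtreeOf {k : ℕ} (j : ℕ+) (f : UHLabel → SiteState 𝒳 k) : SubtreeState 𝒳 k :=
  fun u => f (j :: u.1)

open Classical in
/-- A field with prescribed states outside of the strict descendants of `[j]`. -/
noncomputable def outsideField {k : ℕ} (j : ℕ+) (c : OutsideState 𝒳 k j) (v : UHLabel) :
    SiteState 𝒳 k :=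
  if h : v ∈ UHLabel.below [j] then c.1 ⟨v, h⟩ else if v = [] then c.2.2 else c.2.1

open Classical in
/-- A field with prescribed states at the root and at `[1]` and its descendants. -/
noncomputable def subtreeField {k : ℕ} (p : (SiteState 𝒳 k × SiteState 𝒳 k) × SubtreeState 𝒳 k) :
    UHLabel → SiteState 𝒳 k
  | [] => p.1.2
  | _ :: w => if h : w = [] then p.1.1 else p.2 ⟨w, h⟩

theorem outsideField_outsideOf {k : ℕ} (j : ℕ+) (f : UHLabel → SiteState 𝒳 k) {v : UHLabel}
    (hv : v ∈ UHLabel.below [j] ∨ v = [] ∨ v = [j]) : outsideField j (outsideOf j f) v = f v := by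
  by_cases h : v ∈ UHLabel.below [j]
  · simp [outsideField, outsideOf, h]
  · rcases hv with hv | rfl | rfl
    · exact absurd hv h
    · simp [outsideField, outsideOf, h]
    · simp [outsideField, outsideOf, h]

theorem subtreeField_subtreeOf {k : ℕ} (j : ℕ+) (f : UHLabel → SiteState 𝒳 k) (w : UHLabel) :
    subtreeField ((outsideOf j f).2, subtreeOf j f) (1 :: w) = f (j :: w) := by
  by_cases h : w = []
  · simp [subtreeField, outsideOf, h]
  · simp [subtreeField, subtreeOf, h]

/-- The labels that are not in the subtree of `[j]`. -/
abbrev OffSubtree (j : ℕ+) : Type := {v : UHLabel // v ∈ UHLabel.below [j] ∨ v = []}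

variable (ϖ : 𝒳) (F : (k : ℕ) → (Fin (k + 1) → 𝒳) → Unordered (Fin (k + 1) → 𝒳) → Ξ → 𝒳)

/-- The evolution outside of the subtree of `[j]`, where `x` is the new state of `[j]`. -/
noncomputable def outsideStep {k : ℕ} (j : ℕ+) (p : OutsideState 𝒳 k j × (OffSubtree j → Ξ) × 𝒳) :
    OutsideState 𝒳 (k + 1) j :=
  (fun u => (p.1.1 u).extend (fieldStep ϖ F (outsideField j p.1) u (p.2.1 ⟨u, Or.inl u.2⟩)),
    (p.1.2.1.extend p.2.2,
      p.1.2.2.extend (fieldStep ϖ F (outsideField j p.1) [] (p.2.1 ⟨[], Or.inr rfl⟩))))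

/-- The evolution in a subtree. -/
noncomputable def subtreeStep {k : ℕ}
    (p : (SiteState 𝒳 k × SiteState 𝒳 k) × SubtreeState 𝒳 k × (UHLabel → Ξ)) :
    𝒳 × SubtreeState 𝒳 (k + 1) :=
  (fieldStep ϖ F (subtreeField (p.1, p.2.1)) [1] (p.2.2 []),
    fun w => (p.2.1 w).extend
      (fieldStep ϖ F (subtreeField (p.1, p.2.1)) (1 :: w.1) (p.2.2 w.1)))

variable {ϖ F} {T : Ω → UHTree} {X : UHLabel → ℕ → Ω → 𝒳} {ξ : UHLabel → ℕ → Ω → Ξ}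

/-- Every neighbor of a label in the subtree of `[j]` is in that subtree or is the root. Placing the
subtree at `[1]` gives an update that is the same for all `j`. -/
theorem fieldStep_subtreeField {k : ℕ} (j : ℕ+) (f : UHLabel → SiteState 𝒳 k) (w : UHLabel) (e : Ξ) :
    fieldStep ϖ F (subtreeField ((outsideOf j f).2, subtreeOf j f)) (1 :: w) e =
      fieldStep ϖ F f (j :: w) e := by
  refine fieldStep_congr (subtreeField_subtreeOf j f w)
    (fun i => subtreeField_subtreeOf j f (w ++ [i])) (by simp) (fun _ => ?_) e
  by_cases hw : w = []
  · subst hw; rfl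
  · rw [List.dropLast_cons_of_ne_nil hw, List.dropLast_cons_of_ne_nil hw]
    exact subtreeField_subtreeOf j f _

/-- A label off the subtree of `[j]` has neighbors off it as well, except that the root also sees
`[j]`, whose state is among the data. -/
theorem fieldStep_outsideField {k : ℕ} (j : ℕ+) (f : UHLabel → SiteState 𝒳 k) (v : OffSubtree j)
    (e : Ξ) : fieldStep ϖ F (outsideField j (outsideOf j f)) v.1 e = fieldStep ϖ F f v.1 e := by
  obtain ⟨v, hv⟩ := v
  refine fieldStep_congr (outsideField_outsideOf j f (by tauto)) (fun i => ?_) Iff.rfl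
    (fun hne => ?_) e
  · refine outsideField_outsideOf j f ?_
    rcases hv with hv | rfl
    · obtain ⟨a, w, rfl, ha⟩ := UHLabel.mem_below_singleton_iff.1 hv
      exact Or.inl (UHLabel.mem_below_singleton_iff.2 ⟨a, w ++ [i], rfl, ha⟩)
    · by_cases hi : i = j
      · subst hi; exact Or.inr (Or.inr rfl)
      · exact Or.inl (UHLabel.mem_below_singleton_iff.2 ⟨i, [], rfl, hi⟩)
  · refine outsideField_outsideOf j f ?_
    rcases hv with hv | rfl
    · obtain ⟨a, w, rfl, ha⟩ := UHLabel.mem_below_singleton_iff.1 hv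
      by_cases hw : w = []
      · subst hw; exact Or.inr (Or.inl rfl)
      · exact Or.inl (UHLabel.mem_below_singleton_iff.2
          ⟨a, w.dropLast, List.dropLast_cons_of_ne_nil hw, ha⟩)
    · exact absurd rfl hne

theorem subtreeStep_site (hX : IsParticleSystem ϖ T X ξ F) (k : ℕ) (j : ℕ+) (ω : Ω) :
    subtreeStep ϖ F ((outsideOf j fun u => site T X k u ω).2, (subtreeOf j fun u => site T X k u ω),
        fun w => ξ (j :: w) (k + 1) ω) =
      (X [j] (k + 1) ω, subtreeOf j fun u => site T X (k + 1) u ω) := by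
  refine Prod.ext ?_ (funext fun w => ?_)
  · exact (fieldStep_subtreeField j _ [] _).trans (eq_fieldStep hX k [j] ω).symm
  · simp only [subtreeStep, fieldStep_subtreeField, subtreeOf, site_succ hX]

/-- All that the outside has to learn from the subtree during a step is the new state of `[j]`. -/
theorem outsideStep_site (hX : IsParticleSystem ϖ T X ξ F) (k : ℕ) (j : ℕ+) (ω : Ω) :
    outsideStep ϖ F j ((outsideOf j fun u => site T X k u ω),
        (fun v => ξ v.1 (k + 1) ω), X [j] (k + 1) ω) =
      outsideOf j fun u => site T X (k + 1) u ω := by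
  have h : ∀ v : OffSubtree j, fieldStep ϖ F (outsideField j (outsideOf j fun u => site T X k u ω))
      v.1 (ξ v.1 (k + 1) ω) = X v.1 (k + 1) ω := fun v => by
    rw [fieldStep_outsideField, eq_fieldStep hX]
  have h2 : ∀ v, site T X (k + 1) v ω = (site T X k v ω).extend (X v (k + 1) ω) := fun v => by
    rw [site_succ hX, eq_fieldStep hX]
  refine Prod.ext (funext fun u => ?_) (Prod.ext ?_ ?_)
  · have := h ⟨u.1, Or.inl u.2⟩
    simp only [outsideStep, this]
    simp only [outsideOf, h2]
  · simp only [outsideStep, outsideOf, h2]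
  · have := h ⟨[], Or.inr rfl⟩
    simp only [outsideStep, this]
    simp only [outsideOf, h2]

section Measurability

variable [MeasurableSpace 𝒳] [MeasurableSpace Ξ]

theorem measurable_outsideOf {k : ℕ} (j : ℕ+) :
    Measurable (outsideOf j : (UHLabel → SiteState 𝒳 k) → OutsideState 𝒳 k j) :=
  (measurable_pi_lambda _ fun u => measurable_pi_apply u.1).prodMk
    ((measurable_pi_apply _).prodMk (measurable_pi_apply _))

theorem measurable_subtreeOf {k : ℕ} (j : ℕ+) :
    Measurable (subtreeOf j : (UHLabel → SiteState 𝒳 k) → SubtreeState 𝒳 k) :=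
  measurable_pi_lambda _ fun u => measurable_pi_apply (j :: u.1)

theorem measurable_outsideField {k : ℕ} (j : ℕ+) :
    Measurable (outsideField j : OutsideState 𝒳 k j → UHLabel → SiteState 𝒳 k) := by
  refine measurable_pi_lambda _ fun v => ?_
  unfold outsideField
  split_ifs
  · exact (measurable_pi_apply _).comp measurable_fst
  · exact measurable_snd.snd
  · exact measurable_snd.fst

theorem measurable_subtreeField {k : ℕ} : Measurable (subtreeField :
    (SiteState 𝒳 k × SiteState 𝒳 k) × SubtreeState 𝒳 k → UHLabel → SiteState 𝒳 k) := by
  refine measurable_pi_lambda _ fun v => ?_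
  cases v with
  | nil => exact measurable_fst.snd
  | cons i w =>
    by_cases h : w = []
    · simp only [subtreeField, dif_pos h]
      exact measurable_fst.fst
    · simp only [subtreeField, dif_neg h]
      exact (measurable_pi_apply _).comp measurable_snd

variable (hF : ∀ k, Measurable
    (fun q : (Fin (k + 1) → 𝒳) × Unordered (Fin (k + 1) → 𝒳) × Ξ => F k q.1 q.2.1 q.2.2))

include hF in
theorem measurable_outsideStep {k : ℕ} (j : ℕ+) : Measurable (outsideStep ϖ F j :
    OutsideState 𝒳 k j × (OffSubtree j → Ξ) × 𝒳 → OutsideState 𝒳 (k + 1) j) := by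
  have h : ∀ v : OffSubtree j, Measurable fun p : OutsideState 𝒳 k j × (OffSubtree j → Ξ) × 𝒳 =>
      fieldStep ϖ F (outsideField j p.1) v.1 (p.2.1 v) := fun v =>
    (measurable_fieldStep hF v.1).comp (((measurable_outsideField j).comp measurable_fst).prodMk
      ((measurable_pi_apply v).comp measurable_snd.fst))
  refine Measurable.prodMk (measurable_pi_lambda _ fun u => ?_) (Measurable.prodMk ?_ ?_)
  · exact SiteState.measurable_extend.comp
      (((measurable_pi_apply u).comp measurable_fst.fst).prodMk (h ⟨u.1, Or.inl u.2⟩))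
  · exact SiteState.measurable_extend.comp (measurable_fst.snd.fst.prodMk measurable_snd.snd)
  · exact SiteState.measurable_extend.comp (measurable_fst.snd.snd.prodMk (h ⟨[], Or.inr rfl⟩))

include hF in
theorem measurable_subtreeStep {k : ℕ} : Measurable (subtreeStep ϖ F :
    (SiteState 𝒳 k × SiteState 𝒳 k) × SubtreeState 𝒳 k × (UHLabel → Ξ) →
      𝒳 × SubtreeState 𝒳 (k + 1)) := by
  have h : ∀ w : UHLabel, Measurable
      fun p : (SiteState 𝒳 k × SiteState 𝒳 k) × SubtreeState 𝒳 k × (UHLabel → Ξ) =>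
      fieldStep ϖ F (subtreeField (p.1, p.2.1)) (1 :: w) (p.2.2 w) := fun w =>
    (measurable_fieldStep hF (1 :: w)).comp ((measurable_subtreeField.comp
      (measurable_fst.prodMk measurable_snd.fst)).prodMk
      ((measurable_pi_apply w).comp measurable_snd.snd))
  exact (h []).prodMk (measurable_pi_lambda _ fun w => SiteState.measurable_extend.comp
    (((measurable_pi_apply w).comp measurable_snd.fst).prodMk (h w.1)))

end Measurability

variable [MeasurableSpace Ω] [MeasurableSpace 𝒳] [MeasurableSpace Ξ]

/-- The kernel `κ` is, for each child `[j]` of the root, a version of the conditional law of the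
states at the strict descendants of `[j]` given all other states, and it depends only on the states
at `[j]` and at the root. -/
def IsSubtreeKernel (P : Measure Ω) (T : Ω → UHTree) (X : UHLabel → ℕ → Ω → 𝒳) (k : ℕ)
    (κ : Kernel (SiteState 𝒳 k × SiteState 𝒳 k) (SubtreeState 𝒳 k)) : Prop :=
  ∀ (j : ℕ+) (f : OutsideState 𝒳 k j × SubtreeState 𝒳 k → ℝ≥0∞), Measurable f →
    ∫⁻ ω, f (outsideOf j fun u => site T X k u ω, subtreeOf j fun u => site T X k u ω) ∂P =
      ∫⁻ ω, ∫⁻ d, f (outsideOf j fun u => site T X k u ω, d)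
        ∂(κ (outsideOf j fun u => site T X k u ω).2) ∂P

namespace UGWCondition

variable {ρ₀ ρ : PMF ℕ} {P : Measure Ω} [IsProbabilityMeasure P]
  (hcond : UGWCondition P ϖ ρ₀ ρ T X ξ F) (hX : IsParticleSystem ϖ T X ξ F)

include hcond

/-- The Markov random field assumption lets the other labels be dropped from the conditioning, and
homogeneity provides one kernel for every `j`. The rest translates between initial pairs and
trajectories of length one. -/
theorem exists_isSubtreeKernel_zero :
    ∃ κ : Kernel (SiteState 𝒳 0 × SiteState 𝒳 0) (SubtreeState 𝒳 0),
      IsMarkovKernel κ ∧ IsSubtreeKernel P T X 0 κ := by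
  obtain ⟨κ, hκ, hκv⟩ := hcond.homogeneous
  have hinit : ∀ v, Measurable (initPair T X v) := fun v =>
    ((UHTree.measurable_mem v).comp hcond.measurable_tree).prodMk (hcond.measurable_init v)
  let c : Prop × 𝒳 → SiteState 𝒳 0 := fun p => (p.1, fun _ => p.2)
  have hc : Measurable c :=
    measurable_fst.prodMk (measurable_pi_lambda _ fun _ => measurable_snd)
  have hcs : ∀ v ω, site T X 0 v ω = c (initPair T X v ω) := by
    intro v ω
    refine Prod.ext rfl (funext fun i => ?_)
    fin_cases i
    rfl
  let r : SiteState 𝒳 0 → Prop × 𝒳 := fun p => (p.1, p.2 0)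
  have hr : Measurable r := measurable_fst.prodMk ((measurable_pi_apply 0).comp measurable_snd)
  have hrr : Measurable (Prod.map r r) := hr.prodMap hr
  let cc : (UHLabel₀ → Prop × 𝒳) → SubtreeState 𝒳 0 := fun d u => c (d u)
  have hcc : Measurable cc :=
    measurable_pi_lambda _ fun u => hc.comp (measurable_pi_apply u)
  refine ⟨(κ.comap _ hrr).map cc, Kernel.IsMarkovKernel.map _ hcc, fun j f hf => ?_⟩
  have hne : ([j] : UHLabel) ≠ [] := by simp
  let re : (UHLabel.above [j] → Prop × 𝒳) → UHLabel₀ → Prop × 𝒳 := fun d w =>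
    d ⟨[j] ++ w.1, w.1, w.2, rfl⟩
  have hre : Measurable re := measurable_pi_lambda _ fun w => measurable_pi_apply _
  have hind : CondIndepGiven P (fun ω (w : UHLabel₀) => initPair T X ([j] ++ w.1) ω)
      (fun ω (u : UHLabel.below [j]) => initPair T X u ω)
      (fun ω => (initPair T X [j] ω, initPair T X [] ω)) := fun A B hA hB =>
    hcond.markov [j] hne (re ⁻¹' A) B (hre hA) hB
  let φ : ((UHLabel.below [j] → Prop × 𝒳) × ((Prop × 𝒳) × (Prop × 𝒳))) × (UHLabel₀ → Prop × 𝒳) →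
      ℝ≥0∞ := fun p => f ((fun u => c (p.1.1 u), (c p.1.2.1, c p.1.2.2)), cc p.2)
  have hφ : Measurable φ := by
    refine hf.comp (Measurable.prodMk (Measurable.prodMk ?_ ?_) (hcc.comp measurable_snd))
    · exact measurable_pi_lambda _ fun u => hc.comp ((measurable_pi_apply u).comp measurable_fst.fst)
    · exact (hc.comp measurable_fst.snd.fst).prodMk (hc.comp measurable_fst.snd.snd)
  have := hind.lintegral_eq (measurable_pi_lambda _ fun w => hinit _)
    (measurable_pi_lambda _ fun u => hinit _) ((hinit _).prodMk (hinit _)) κ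
    (fun A hA => hκv [j] hne A hA) hφ
  convert this using 1
  · simp only [hcs]
    rfl
  · refine lintegral_congr fun ω => ?_
    simp only [hcs]
    have hfd : Measurable fun d => f (outsideOf j fun u => c (initPair T X u ω), d) :=
      hf.comp (measurable_const.prodMk measurable_id)
    rw [Kernel.lintegral_map _ hcc _ hfd, Kernel.comap_apply]
    rfl

-- Given the outside at time `k`, the new state of `[j]` and the new subtree are produced from the
-- old subtree and the noise in the subtree of `[j]`, with a joint conditional law depending only on
-- `[j]` and the root; the noise outside is independent of all this. The outside at time `k + 1` is
-- a function of the old outside, the outside noise and the new state of `[j]`. Conditioning on it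
-- thus amounts to disintegrating that joint law along the new state of `[j]`, which is where the
-- standard Borel property enters.
include hX in
theorem exists_isSubtreeKernel_succ [StandardBorelSpace 𝒳]
    {k : ℕ} (κ : Kernel (SiteState 𝒳 k × SiteState 𝒳 k) (SubtreeState 𝒳 k)) [IsMarkovKernel κ]
    (hκ : IsSubtreeKernel P T X k κ) :
    ∃ κ' : Kernel (SiteState 𝒳 (k + 1) × SiteState 𝒳 (k + 1)) (SubtreeState 𝒳 (k + 1)),
      IsMarkovKernel κ' ∧ IsSubtreeKernel P T X (k + 1) κ' := by
  have := hcond.isProbabilityMeasure_noise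
  have : Nonempty 𝒳 := ⟨ϖ⟩
  set θ := P.map (ξ [] 1) with hθ
  let Λ : Measure (UHLabel → Ξ) := Measure.infinitePi fun _ => θ
  have hstep := measurable_subtreeStep (ϖ := ϖ) hcond.measurable_update (k := k)
  -- The joint law of the new state of `[j]` and the new subtree, given the old states of `[j]` and
  -- of the root.
  let K : Kernel (SiteState 𝒳 k × SiteState 𝒳 k) (𝒳 × SubtreeState 𝒳 (k + 1)) :=
    (Kernel.id ×ₖ (κ ×ₖ Kernel.const _ Λ)).map (subtreeStep ϖ F)
  have hKm : IsMarkovKernel K := Kernel.IsMarkovKernel.map _ hstep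
  have hK : ∀ (h : SiteState 𝒳 k × SiteState 𝒳 k) (g : 𝒳 × SubtreeState 𝒳 (k + 1) → ℝ≥0∞),
      Measurable g → ∫⁻ y, g y ∂K h = ∫⁻ d, ∫⁻ η, g (subtreeStep ϖ F (h, d, η)) ∂Λ ∂κ h := by
    intro h g hg
    have hg1 : Measurable fun p => g (subtreeStep ϖ F p) := hg.comp hstep
    have hg2 : Measurable fun p => g (subtreeStep ϖ F (h, p)) :=
      hg1.comp (measurable_const.prodMk measurable_id)
    rw [Kernel.lintegral_map _ hstep _ hg, Kernel.lintegral_id_prod hg1,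
      Kernel.lintegral_prod _ _ _ hg2]
    rfl
  -- Given the old outside, the outside noise has its own product law and the new subtree, together
  -- with the new state of `[j]`, has law `K`, independently.
  have main : ∀ (j : ℕ+)
      (H : OutsideState 𝒳 k j × (OffSubtree j → Ξ) × (𝒳 × SubtreeState 𝒳 (k + 1)) → ℝ≥0∞),
      Measurable H →
      ∫⁻ ω, H (outsideOf j fun u => site T X k u ω, (fun v => ξ v.1 (k + 1) ω),
          X [j] (k + 1) ω, subtreeOf j fun u => site T X (k + 1) u ω) ∂P =
        ∫⁻ ω, ∫⁻ ζ, ∫⁻ y, H (outsideOf j fun u => site T X k u ω, ζ, y)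
          ∂(K (outsideOf j fun u => site T X k u ω).2)
          ∂(Measure.infinitePi fun _ : OffSubtree j => θ) ∂P := by
    intro j H hH
    let Λ' : Measure (OffSubtree j → Ξ) := Measure.infinitePi fun _ => θ
    let off : (UHLabel → Ξ) → OffSubtree j → Ξ := fun e v => e v.1
    let sub : (UHLabel → Ξ) → UHLabel → Ξ := fun e w => e (j :: w)
    have hoff : Measurable off := by fun_prop
    have hsub : Measurable sub := by fun_prop
    have hsplit : Λ.map (fun e => (off e, sub e)) = Λ'.prod Λ :=
      map_infinitePi_prod_of_disjoint (ψ₁ := fun v : OffSubtree j => v.1) (ψ₂ := fun w => j :: w)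
        (by
          rintro ⟨v, hv | rfl⟩ w h
          · obtain ⟨i, w', rfl, hi⟩ := UHLabel.mem_below_singleton_iff.1 hv
            exact hi (List.cons.inj h).1
          · simp at h)
        Subtype.val_injective (fun a b h => (List.cons.inj h).2)
    let fld : UHTree × (UHLabel → Fin (k + 1) → 𝒳) → UHLabel → SiteState 𝒳 k := fun s v =>
      (v ∈ s.1.1, s.2 v)
    have hfld : Measurable fld := measurable_pi_lambda _ fun v =>
      ((UHTree.measurable_mem v).comp measurable_fst).prodMk
        ((measurable_pi_apply v).comp measurable_snd)
    let G : (OutsideState 𝒳 k j × SubtreeState 𝒳 k) × ((OffSubtree j → Ξ) × (UHLabel → Ξ)) → ℝ≥0∞ :=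
      fun p => H (p.1.1, p.2.1, subtreeStep ϖ F (p.1.1.2, p.1.2, p.2.2))
    have hG : Measurable G :=
      hH.comp (measurable_fst.fst.prodMk (measurable_snd.fst.prodMk (hstep.comp
        (measurable_fst.fst.snd.prodMk (measurable_fst.snd.prodMk measurable_snd.snd)))))
    have hG2 : Measurable fun p : (UHTree × (UHLabel → Fin (k + 1) → 𝒳)) × (UHLabel → Ξ) =>
        G ((outsideOf j (fld p.1), subtreeOf j (fld p.1)), (off p.2, sub p.2)) :=
      hG.comp ((((measurable_outsideOf j).comp (hfld.comp measurable_fst)).prodMk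
        ((measurable_subtreeOf j).comp (hfld.comp measurable_fst))).prodMk
        ((hoff.comp measurable_snd).prodMk (hsub.comp measurable_snd)))
    have e1 := hcond.lintegral_noise_step hX k hG2
    have e2 : ∀ cd, ∫⁻ η, G (cd, (off η, sub η)) ∂Λ = ∫⁻ p, G (cd, p) ∂(Λ'.prod Λ) := by
      intro cd
      have hGd : Measurable fun p => G (cd, p) := hG.comp (measurable_const.prodMk measurable_id)
      rw [← hsplit, lintegral_map hGd (hoff.prodMk hsub)]
    have e3 := hκ j _ (hG.lintegral_prod_right' (ν := Λ'.prod Λ))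
    have e4 : ∀ c, ∫⁻ d, ∫⁻ p, G ((c, d), p) ∂(Λ'.prod Λ) ∂(κ c.2) =
        ∫⁻ ζ, ∫⁻ y, H (c, ζ, y) ∂(K c.2) ∂Λ' := by
      intro c
      have hGc : Measurable fun p : (SubtreeState 𝒳 k × (OffSubtree j → Ξ)) × (UHLabel → Ξ) =>
          G ((c, p.1.1), (p.1.2, p.2)) :=
        hG.comp ((measurable_const.prodMk measurable_fst.fst).prodMk
          (measurable_fst.snd.prodMk measurable_snd))
      have h1 : ∀ d, ∫⁻ p, G ((c, d), p) ∂(Λ'.prod Λ) = ∫⁻ ζ, ∫⁻ η, G ((c, d), (ζ, η)) ∂Λ ∂Λ' :=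
        fun d => lintegral_prod _ (hG.comp (measurable_const.prodMk measurable_id)).aemeasurable
      simp_rw [h1]
      rw [lintegral_lintegral_swap hGc.lintegral_prod_right'.aemeasurable]
      refine lintegral_congr fun ζ => ?_
      have hHd : Measurable fun y => H (c, ζ, y) :=
        hH.comp (measurable_const.prodMk (measurable_const.prodMk measurable_id))
      rw [hK _ _ hHd]
    rw [← lintegral_congr fun ω => e4 (outsideOf j fun u => site T X k u ω), ← e3]
    refine Eq.trans (lintegral_congr fun ω => ?_) (e1.trans (lintegral_congr fun ω =>
      e2 (outsideOf j fun u => site T X k u ω, subtreeOf j fun u => site T X k u ω)))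
    have := subtreeStep_site hX k j ω
    change H (_, _, _) = H (_, _, subtreeStep ϖ F ((outsideOf j fun u => site T X k u ω).2,
      (subtreeOf j fun u => site T X k u ω), fun w => ξ (j :: w) (k + 1) ω))
    rw [this]
    rfl
  -- The new kernel reads the old states of `[j]` and of the root and the last state of `[j]`. The
  -- last state of the root is ignored: it comes from the outside alone.
  let pr : SiteState 𝒳 (k + 1) × SiteState 𝒳 (k + 1) → (SiteState 𝒳 k × SiteState 𝒳 k) × 𝒳 :=
    fun h => ((h.1.init, h.2.init), h.1.2 (Fin.last _))
  have hpr : Measurable pr := by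
    refine Measurable.prodMk (Measurable.prodMk ?_ ?_) ?_
    · exact SiteState.measurable_init.comp measurable_fst
    · exact SiteState.measurable_init.comp measurable_snd
    · exact (measurable_pi_apply _).comp measurable_fst.snd
  refine ⟨K.condKernel.comap pr hpr, inferInstance, fun j f hf => ?_⟩
  have hout := measurable_outsideStep (ϖ := ϖ) hcond.measurable_update (k := k) j
  let Q : OutsideState 𝒳 k j × (OffSubtree j → Ξ) × (𝒳 × SubtreeState 𝒳 (k + 1)) →
      OutsideState 𝒳 (k + 1) j := fun p => outsideStep ϖ F j (p.1, p.2.1, p.2.2.1)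
  have hQ : Measurable Q := hout.comp
    (measurable_fst.prodMk (measurable_snd.fst.prodMk measurable_snd.snd.fst))
  let H₁ : OutsideState 𝒳 k j × (OffSubtree j → Ξ) × (𝒳 × SubtreeState 𝒳 (k + 1)) → ℝ≥0∞ :=
    fun p => f (Q p, p.2.2.2)
  have hH₁ : Measurable H₁ := hf.comp (hQ.prodMk measurable_snd.snd.snd)
  let H₂ : OutsideState 𝒳 k j × (OffSubtree j → Ξ) × (𝒳 × SubtreeState 𝒳 (k + 1)) → ℝ≥0∞ :=
    fun p => ∫⁻ d, f (Q p, d) ∂(K.condKernel (pr (Q p).2))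
  have hH₂ : Measurable H₂ :=
    (Measurable.lintegral_kernel_prod_right' (κ := K.condKernel.comap
      (fun c : OutsideState 𝒳 (k + 1) j => pr c.2) (hpr.comp measurable_snd)) hf).comp hQ
  have hpq : ∀ p, pr (Q p).2 = (p.1.2, p.2.2.1) := by
    intro p
    simp only [pr, Q, outsideStep, SiteState.init_extend]
    refine Prod.ext rfl ?_
    simp [SiteState.extend]
  have h1 := main j H₁ hH₁
  have h2 := main j H₂ hH₂
  simp only [H₁, H₂, Q] at h1 h2
  simp only [outsideStep_site hX] at h1 h2
  rw [h1]
  refine Eq.trans ?_ h2.symm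
  refine lintegral_congr fun ω => lintegral_congr fun ζ => ?_
  set c := outsideOf j fun u => site T X k u ω
  have hd := K.disintegrate K.condKernel
  have g1 : Measurable fun y : 𝒳 × SubtreeState 𝒳 (k + 1) => H₁ (c, ζ, y) :=
    hH₁.comp (measurable_const.prodMk (measurable_const.prodMk measurable_id))
  have g2 : Measurable fun y : 𝒳 × SubtreeState 𝒳 (k + 1) => H₂ (c, ζ, y) :=
    hH₂.comp (measurable_const.prodMk (measurable_const.prodMk measurable_id))
  change ∫⁻ y, H₁ (c, ζ, y) ∂(K c.2) = ∫⁻ y, H₂ (c, ζ, y) ∂(K c.2)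
  -- Disintegrating `K` exposes the new state of `[j]`. With it fixed, the outside is fixed too, and
  -- the inner integrals coincide.
  have hd1 : ∀ g : 𝒳 × SubtreeState 𝒳 (k + 1) → ℝ≥0∞, Measurable g →
      ∫⁻ y, g y ∂(K c.2) = ∫⁻ x, ∫⁻ d, g (x, d) ∂(K.condKernel (c.2, x)) ∂(K.fst c.2) := by
    intro g hg
    rw [← Kernel.lintegral_compProd _ _ _ hg, hd]
  rw [hd1 _ g1, hd1 _ g2]
  refine lintegral_congr fun x => ?_
  simp only [H₂, hpq]
  simp [H₁, Q]

include hX in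
theorem exists_isSubtreeKernel [StandardBorelSpace 𝒳] (k : ℕ) :
    ∃ κ : Kernel (SiteState 𝒳 k × SiteState 𝒳 k) (SubtreeState 𝒳 k),
      IsMarkovKernel κ ∧ IsSubtreeKernel P T X k κ := by
  induction k with
  | zero => exact hcond.exists_isSubtreeKernel_zero
  | succ k ih =>
    obtain ⟨κ, hm, hκ⟩ := ih
    exact hcond.exists_isSubtreeKernel_succ hX κ hκ

end UGWCondition

end Subtrees

/-! ### Conditional expectations as identities between integrals. -/

section CondExp

variable {Ω γ : Type*} [mΩ : MeasurableSpace Ω] [mγ : MeasurableSpace γ] {P : Measure Ω}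
  [IsProbabilityMeasure P] {h : Ω → γ}

/-- Both directions test on the sets `h ⁻¹' H`, which are all the sets of the conditioning
σ-algebra. -/
theorem condExp_comap_eq_iff (hh : Measurable h) {a b : Ω → ℝ} (ha : Integrable a P)
    (hb : Integrable b P) (ha0 : 0 ≤ a) (hb0 : 0 ≤ b) :
    P[a | mγ.comap h] =ᵐ[P] P[b | mγ.comap h] ↔ ∀ H, MeasurableSet H →
      ∫⁻ ω in h ⁻¹' H, ENNReal.ofReal (a ω) ∂P = ∫⁻ ω in h ⁻¹' H, ENNReal.ofReal (b ω) ∂P := by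
  have hm : mγ.comap h ≤ mΩ := hh.comap_le
  have key : ∀ H, (∫⁻ ω in h ⁻¹' H, ENNReal.ofReal (a ω) ∂P =
      ∫⁻ ω in h ⁻¹' H, ENNReal.ofReal (b ω) ∂P) ↔ ∫ ω in h ⁻¹' H, a ω ∂P = ∫ ω in h ⁻¹' H, b ω ∂P := by
    intro H
    rw [← ofReal_integral_eq_lintegral_ofReal ha.integrableOn (.of_forall ha0),
      ← ofReal_integral_eq_lintegral_ofReal hb.integrableOn (.of_forall hb0),
      ENNReal.ofReal_eq_ofReal_iff (integral_nonneg ha0) (integral_nonneg hb0)]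
  constructor
  · intro hab H hH
    rw [key, ← setIntegral_condExp hm ha ⟨H, hH, rfl⟩, ← setIntegral_condExp hm hb ⟨H, hH, rfl⟩]
    exact setIntegral_congr_ae (hh hH) (hab.mono fun ω hω _ => hω)
  · intro hab
    refine ae_eq_condExp_of_forall_setIntegral_eq hm hb (fun s _ _ => integrable_condExp.integrableOn)
      ?_ stronglyMeasurable_condExp.aestronglyMeasurable
    rintro s ⟨H, hH, rfl⟩ _
    rw [setIntegral_condExp hm ha ⟨H, hH, rfl⟩]
    exact (key H).1 (hab H hH)

/-- On the measurable event where the conditional expectation is nonpositive, `r` has nonpositive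
integral although it is almost surely positive, so the event is null. -/
theorem condExp_pos_of_pos (hh : Measurable h) {r : Ω → ℝ} (hr : Integrable r P)
    (hr0 : ∀ᵐ ω ∂P, 0 < r ω) : ∀ᵐ ω ∂P, 0 < (P[r | mγ.comap h]) ω := by
  have hm : mγ.comap h ≤ mΩ := hh.comap_le
  have hs : MeasurableSet[mγ.comap h] {ω | (P[r | mγ.comap h]) ω ≤ 0} :=
    (stronglyMeasurable_condExp (m := mγ.comap h) (μ := P) (f := r)).measurable
      (measurableSet_Iic (a := (0 : ℝ)))
  have h1 : ∫ ω in {ω | (P[r | mγ.comap h]) ω ≤ 0}, r ω ∂P ≤ 0 := by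
    rw [← setIntegral_condExp hm hr hs]
    exact setIntegral_nonpos (hm _ hs) fun ω hω => hω
  have h2 : P {ω | (P[r | mγ.comap h]) ω ≤ 0} = 0 := by
    by_contra hne
    refine absurd h1 (not_le.2 ?_)
    rw [setIntegral_pos_iff_support_of_nonneg_ae (ae_restrict_of_ae (hr0.mono fun ω h => h.le))
      hr.integrableOn]
    rw [pos_iff_ne_zero]
    intro h0
    refine hne (measure_mono_null ?_ (measure_union_null h0 (ae_iff.1 hr0)))
    intro ω hω
    by_cases hrω : r ω = 0
    · exact Or.inr (by simp [hrω])
    · exact Or.inl ⟨hrω, hω⟩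
  rw [ae_iff]
  simpa using h2

theorem condExp_indicator_eq_iff (hh : Measurable h) {A : Set Ω} (hA : MeasurableSet A) {g : γ → ℝ}
    (hg : Measurable g) (hg0 : 0 ≤ g) (hg1 : ∀ c, g c ≤ 1) :
    P⟦A | mγ.comap h⟧ =ᵐ[P] (fun ω => g (h ω)) ↔ ∀ H, MeasurableSet H →
      P (h ⁻¹' H ∩ A) = ∫⁻ ω in h ⁻¹' H, ENNReal.ofReal (g (h ω)) ∂P := by
  have hgi : Integrable (fun ω => g (h ω)) P :=
    Integrable.of_bound (hg.comp hh).aestronglyMeasurable 1 (.of_forall fun ω => by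
      rw [Real.norm_of_nonneg (hg0 _)]; exact hg1 _)
  have hgm : StronglyMeasurable[mγ.comap h] fun ω => g (h ω) :=
    (hg.comp (comap_measurable h)).stronglyMeasurable
  have h1 := condExp_comap_eq_iff hh ((integrable_const (1 : ℝ)).indicator hA) hgi
    (Set.indicator_nonneg fun _ _ => zero_le_one) (fun ω => hg0 _)
  rw [condExp_of_stronglyMeasurable hh.comap_le hgm hgi] at h1
  rw [h1]
  refine forall₂_congr fun H hH => ?_
  have : ∫⁻ ω in h ⁻¹' H, ENNReal.ofReal (A.indicator (fun _ => (1 : ℝ)) ω) ∂P = P (h ⁻¹' H ∩ A) := by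
    have : (fun ω => ENNReal.ofReal (A.indicator (fun _ => (1 : ℝ)) ω)) =
        A.indicator fun _ => (1 : ℝ≥0∞) := by
      ext ω
      by_cases hω : ω ∈ A <;> simp [hω]
    rw [this, lintegral_indicator hA, setLIntegral_one, Measure.restrict_apply hA, Set.inter_comm]
  rw [this]

/-- The denominator is almost surely positive, so it can be cleared, and `g ∘ h` moves inside the
conditional expectation. The resulting identities involve only the joint law of `h`, `r` and the
event, hence can be compared across probability spaces. -/
theorem ratio_condExp_eq_iff (hh : Measurable h) {A : Set Ω} (hA : MeasurableSet A) {g : γ → ℝ}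
    (hg : Measurable g) (hg0 : 0 ≤ g) (hg1 : ∀ c, g c ≤ 1) {r : Ω → ℝ} (hr : Integrable r P)
    (hr0 : ∀ ω, 0 ≤ r ω) (hrpos : ∀ᵐ ω ∂P, 0 < r ω) :
    (fun ω => g (h ω)) =ᵐ[P]
        (fun ω => (P[A.indicator r | mγ.comap h]) ω / (P[r | mγ.comap h]) ω) ↔
      ∀ H, MeasurableSet H → ∫⁻ ω in h ⁻¹' H, ENNReal.ofReal (g (h ω)) * ENNReal.ofReal (r ω) ∂P =
        ∫⁻ ω in h ⁻¹' H ∩ A, ENNReal.ofReal (r ω) ∂P := by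
  have hgb : ∀ ω, ‖g (h ω)‖ ≤ 1 := fun ω => by rw [Real.norm_of_nonneg (hg0 _)]; exact hg1 _
  have hgm : StronglyMeasurable[mγ.comap h] fun ω => g (h ω) :=
    (hg.comp (comap_measurable h)).stronglyMeasurable
  have hgr : Integrable ((fun ω => g (h ω)) * r) P :=
    hr.bdd_mul (c := 1) (hg.comp hh).aestronglyMeasurable (.of_forall hgb)
  have h1 := condExp_comap_eq_iff hh hgr (hr.indicator hA) (fun ω => mul_nonneg (hg0 _) (hr0 ω))
    (Set.indicator_nonneg fun ω _ => hr0 ω)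
  have h2 := condExp_stronglyMeasurable_mul_of_bound hh.comap_le hgm hr 1 (.of_forall hgb)
  have h3 : (fun ω => g (h ω)) =ᵐ[P]
        (fun ω => (P[A.indicator r | mγ.comap h]) ω / (P[r | mγ.comap h]) ω) ↔
      P[(fun ω => g (h ω)) * r | mγ.comap h] =ᵐ[P] P[A.indicator r | mγ.comap h] := by
    constructor
    · intro h
      filter_upwards [h, h2, condExp_pos_of_pos hh hr hrpos] with ω e1 e2 e3
      rw [e2, Pi.mul_apply, e1, div_mul_cancel₀ _ e3.ne']
    · intro h
      filter_upwards [h, h2, condExp_pos_of_pos hh hr hrpos] with ω e1 e2 e3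
      rw [eq_div_iff e3.ne', ← e1, e2, Pi.mul_apply]
  rw [h3, h1]
  refine forall₂_congr fun H hH => ?_
  have e1 : ∀ ω, ENNReal.ofReal (((fun ω => g (h ω)) * r) ω) =
      ENNReal.ofReal (g (h ω)) * ENNReal.ofReal (r ω) := fun ω => ENNReal.ofReal_mul (hg0 _)
  have e2 : (fun ω => ENNReal.ofReal (A.indicator r ω)) = A.indicator fun ω => ENNReal.ofReal (r ω) := by
    ext ω
    by_cases hω : ω ∈ A <;> simp [hω]
  simp only [e1]
  rw [e2, lintegral_indicator hA, Measure.restrict_restrict hA, Set.inter_comm]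

end CondExp

/-! ### The phantom kernel of the particle system. -/

section PhantomKernel

variable {𝒳 : Type*}

/-- The unordered trajectories of the neighbors of a child of the root, computed from the states of
that child and of the root, and from those in the subtree of the child. -/
noncomputable def childNbhd {k : ℕ} (p : (SiteState 𝒳 k × SiteState 𝒳 k) × SubtreeState 𝒳 k) :
    Unordered (Fin (k + 1) → 𝒳) :=
  Unordered.ofMarked (aroundSite (subtreeField p) [1])

theorem childNbhd_eq {k : ℕ} (j : ℕ+) (f : UHLabel → SiteState 𝒳 k) :
    childNbhd ((outsideOf j f).2, subtreeOf j f) = Unordered.ofMarked (aroundSite f [j]) := by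
  have : aroundSite (subtreeField ((outsideOf j f).2, subtreeOf j f)) [1] = aroundSite f [j] := by
    ext1 o
    cases o with
    | none => rfl
    | some i => exact subtreeField_subtreeOf j f [i]
  rw [childNbhd, this]

theorem aroundSite_outsideField {k : ℕ} {i j : ℕ+} (hij : i ≠ j) (f : UHLabel → SiteState 𝒳 k) :
    aroundSite (outsideField j (outsideOf j f)) [i] = aroundSite f [i] := by
  ext1 o
  cases o with
  | none => exact outsideField_outsideOf j f (Or.inr (Or.inl rfl))
  | some a =>
    exact outsideField_outsideOf j f (v := [i] ++ [a])
      (Or.inl (UHLabel.mem_below_singleton_iff.2 ⟨i, [a], rfl, hij⟩))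

variable [MeasurableSpace 𝒳]

theorem measurable_childNbhd {k : ℕ} : Measurable (childNbhd :
    (SiteState 𝒳 k × SiteState 𝒳 k) × SubtreeState 𝒳 k → Unordered (Fin (k + 1) → 𝒳)) :=
  Unordered.measurable_ofMarked.comp ((measurable_aroundSite [1]).comp measurable_subtreeField)

/-- The state of a site with a given trajectory: it is a vertex if it is not in the cemetery. -/
def SiteState.ofPath (ϖ : 𝒳) {k : ℕ} (x : Fin (k + 1) → 𝒳) : SiteState 𝒳 k := (x 0 ≠ ϖ, x)

variable {ϖ : 𝒳} (hϖ : MeasurableSet ({ϖ} : Set 𝒳))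

theorem measurableSet_dead (hϖ : MeasurableSet ({ϖ} : Set 𝒳)) {k : ℕ} :
    MeasurableSet {x : Fin (k + 1) → 𝒳 | x 0 = ϖ} :=
  (measurable_pi_apply (0 : Fin (k + 1)) : Measurable fun x : Fin (k + 1) → 𝒳 => x 0) hϖ

theorem SiteState.measurable_ofPath (hϖ : MeasurableSet ({ϖ} : Set 𝒳)) {k : ℕ} :
    Measurable (SiteState.ofPath ϖ : (Fin (k + 1) → 𝒳) → SiteState 𝒳 k) :=
  (measurableSet_setOfPred.1 (measurableSet_dead hϖ).compl).prodMk measurable_id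

open Classical in
/-- The conditional law of the unordered trajectories of the neighbors of a vertex given the
trajectories of that vertex and of one of its neighbors. -/
noncomputable def phantomKernel (hϖ : MeasurableSet ({ϖ} : Set 𝒳)) {k : ℕ}
    (κ : Kernel (SiteState 𝒳 k × SiteState 𝒳 k) (SubtreeState 𝒳 k)) :
    Kernel ((Fin (k + 1) → 𝒳) × (Fin (k + 1) → 𝒳)) (Unordered (Fin (k + 1) → 𝒳)) :=
  -- A dead second argument occurs for (X_ø, X_1) when the tree is a single vertex. The root then
  -- has no neighbors and the weight is 0/0 = 1, so the defining formula asks for the point mass at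
  -- the empty sequence.
  Kernel.piecewise (s := {p | p.2 0 = ϖ}) (measurable_snd (measurableSet_dead hϖ))
    (Kernel.const _ (Measure.dirac (Unordered.ofFinset (∅ : Finset ℕ+) fun _ _ => ϖ)))
    (((Kernel.id ×ₖ κ).map childNbhd).comap (Prod.map (SiteState.ofPath ϖ) (SiteState.ofPath ϖ))
      ((SiteState.measurable_ofPath hϖ).prodMap (SiteState.measurable_ofPath hϖ)))

instance {k : ℕ} (κ : Kernel (SiteState 𝒳 k × SiteState 𝒳 k) (SubtreeState 𝒳 k)) [IsMarkovKernel κ] :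
    IsMarkovKernel (phantomKernel hϖ κ) := by
  have : IsMarkovKernel ((Kernel.id ×ₖ κ).map childNbhd) :=
    Kernel.IsMarkovKernel.map _ measurable_childNbhd
  unfold phantomKernel
  infer_instance

theorem phantomKernel_dead {k : ℕ} (κ : Kernel (SiteState 𝒳 k × SiteState 𝒳 k) (SubtreeState 𝒳 k))
    {x y : Fin (k + 1) → 𝒳} (hy : y 0 = ϖ) : phantomKernel hϖ κ (x, y) =
      Measure.dirac (Unordered.ofFinset (∅ : Finset ℕ+) fun _ _ => ϖ) := by
  classical
  rw [phantomKernel, Kernel.piecewise_apply, if_pos (by exact hy), Kernel.const_apply]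

theorem lintegral_phantomKernel {k : ℕ}
    (κ : Kernel (SiteState 𝒳 k × SiteState 𝒳 k) (SubtreeState 𝒳 k)) [IsMarkovKernel κ]
    {x y : Fin (k + 1) → 𝒳} (hy : y 0 ≠ ϖ) {g : Unordered (Fin (k + 1) → 𝒳) → ℝ≥0∞}
    (hg : Measurable g) : ∫⁻ z, g z ∂(phantomKernel hϖ κ (x, y)) =
      ∫⁻ d, g (childNbhd ((SiteState.ofPath ϖ x, SiteState.ofPath ϖ y), d))
        ∂(κ (SiteState.ofPath ϖ x, SiteState.ofPath ϖ y)) := by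
  classical
  have hgc : Measurable fun p => g (childNbhd p) := hg.comp measurable_childNbhd
  rw [phantomKernel, Kernel.piecewise_apply, if_neg (by exact hy), Kernel.comap_apply,
    Kernel.lintegral_map _ measurable_childNbhd _ hg, Kernel.lintegral_id_prod hgc]
  rfl

end PhantomKernel

/-! ### Conditional independence of the neighborhoods of the children. -/

section Children

variable {𝒳 : Type*} [MeasurableSpace 𝒳] {k : ℕ}
  (B : ℕ+ → Set (Unordered (Fin (k + 1) → 𝒳)))

open Classical in
/-- The indicator of the event that the neighbors of `[i]` have trajectories in `B i`; it is one if
`[i]` is not a vertex. -/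
noncomputable def childIndicator (i : ℕ+) (f : UHLabel → SiteState 𝒳 k) : ℝ≥0∞ :=
  if (f [i]).1 then (B i).indicator 1 (Unordered.ofMarked (aroundSite f [i])) else 1

open Classical in
/-- The conditional probability of the event that the neighbors of `[i]` have trajectories in `B i`;
it is one if `[i]` is not a vertex. -/
noncomputable def childProb
    (γ : Kernel ((Fin (k + 1) → 𝒳) × (Fin (k + 1) → 𝒳)) (Unordered (Fin (k + 1) → 𝒳))) (i : ℕ+)
    (f : UHLabel₁ → SiteState 𝒳 k) : ℝ≥0∞ :=
  if (f (.child i)).1 then γ ((f (.child i)).2, (f .root).2) (B i) else 1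

variable {B}

theorem measurable_childIndicator (hB : ∀ i, MeasurableSet (B i)) (i : ℕ+) :
    Measurable (childIndicator B i) := by
  refine Measurable.ite ?_ ?_ measurable_const
  · exact measurableSet_setOfPred.2 (measurable_pi_apply [i]).fst
  · exact (measurable_one.indicator (hB i)).comp
      (Unordered.measurable_ofMarked.comp (measurable_aroundSite [i]))

theorem measurable_childProb (hB : ∀ i, MeasurableSet (B i))
    (γ : Kernel ((Fin (k + 1) → 𝒳) × (Fin (k + 1) → 𝒳)) (Unordered (Fin (k + 1) → 𝒳))) (i : ℕ+) :
    Measurable (childProb B γ i) := by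
  refine Measurable.ite ?_ ?_ measurable_const
  · exact measurableSet_setOfPred.2 (measurable_pi_apply (UHLabel₁.child i)).fst
  · exact (Kernel.measurable_coe γ (hB i)).comp
      ((measurable_pi_apply (UHLabel₁.child i)).snd.prodMk (measurable_pi_apply UHLabel₁.root).snd)

-- The neighborhood of a sibling `[i]` is visible from outside the subtree of `[j]`; this permits
-- treating the children one at a time.
omit [MeasurableSpace 𝒳] in
theorem childIndicator_outsideField {i j : ℕ+} (hij : i ≠ j) (f : UHLabel → SiteState 𝒳 k) :
    childIndicator B i (outsideField j (outsideOf j f)) = childIndicator B i f := by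
  rw [childIndicator, childIndicator, aroundSite_outsideField hij, outsideField_outsideOf]
  exact Or.inl (UHLabel.mem_below_singleton_iff.2 ⟨i, [], rfl, hij⟩)

omit [MeasurableSpace 𝒳] in
theorem outsideField_apply₁ (j : ℕ+) (f : UHLabel → SiteState 𝒳 k) (v : UHLabel₁) :
    outsideField j (outsideOf j f) v.1 = f v.1 := by
  refine outsideField_outsideOf j f ?_
  obtain ⟨v, hv⟩ := v
  match v, hv with
  | [], _ => exact Or.inr (Or.inl rfl)
  | [i], _ =>
    by_cases hi : i = j
    · subst hi; exact Or.inr (Or.inr rfl)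
    · exact Or.inl (UHLabel.mem_below_singleton_iff.2 ⟨i, [], rfl, hi⟩)
  | _ :: _ :: _, hv => simp at hv

end Children

namespace UGWCondition

variable {Ω 𝒳 Ξ : Type*} {ϖ : 𝒳} {ρ₀ ρ : PMF ℕ} {T : Ω → UHTree} {X : UHLabel → ℕ → Ω → 𝒳}
  {ξ : UHLabel → ℕ → Ω → Ξ}
  {F : (k : ℕ) → (Fin (k + 1) → 𝒳) → Unordered (Fin (k + 1) → 𝒳) → Ξ → 𝒳}
  [MeasurableSpace Ω] [MeasurableSpace 𝒳] [MeasurableSpace Ξ] {P : Measure Ω}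
  [IsProbabilityMeasure P]
  (hcond : UGWCondition P ϖ ρ₀ ρ T X ξ F) (hX : IsParticleSystem ϖ T X ξ F)
  (hϖ : MeasurableSet ({ϖ} : Set 𝒳))

include hcond hX

omit [IsProbabilityMeasure P] in
theorem measurable_siteNbhd (k : ℕ) (v : UHLabel) : Measurable (siteNbhd T X k v) := by
  have := (hcond.measurable_pairAt hX k v v).snd.snd.fst
  exact this

omit [IsProbabilityMeasure P] hX in
/-- The conditional law of the trajectories of the neighbors of a child of the root. -/
theorem setLIntegral_siteNbhd {k : ℕ} {κ : Kernel (SiteState 𝒳 k × SiteState 𝒳 k) (SubtreeState 𝒳 k)}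
    [IsMarkovKernel κ] (hκ : IsSubtreeKernel P T X k κ) (j : ℕ+)
    {f : OutsideState 𝒳 k j × Unordered (Fin (k + 1) → 𝒳) → ℝ≥0∞} (hf : Measurable f) :
    ∫⁻ ω in {ω | [j] ∈ (T ω).1},
        f (outsideOf j fun u => site T X k u ω, siteNbhd T X k [j] ω) ∂P =
      ∫⁻ ω in {ω | [j] ∈ (T ω).1}, ∫⁻ z, f (outsideOf j fun u => site T X k u ω, z)
        ∂(phantomKernel hϖ κ (traj X [j] k ω, traj X [] k ω)) ∂P := by
  classical
  let g : OutsideState 𝒳 k j × SubtreeState 𝒳 k → ℝ≥0∞ := fun p =>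
    if p.1.2.1.1 then f (p.1, childNbhd (p.1.2, p.2)) else 0
  have hg : Measurable g := by
    refine Measurable.ite ?_ ?_ measurable_const
    · exact measurableSet_setOfPred.2 measurable_fst.snd.fst.fst
    · exact hf.comp (measurable_fst.prodMk (measurable_childNbhd.comp
        (measurable_fst.snd.prodMk measurable_snd)))
  have h := hκ j g hg
  rw [← lintegral_indicator (hcond.measurableSet_mem [j]),
    ← lintegral_indicator (hcond.measurableSet_mem [j])]
  convert h using 1
  · refine lintegral_congr fun ω => ?_
    by_cases hω : [j] ∈ (T ω).1
    · rw [Set.indicator_of_mem (by exact hω), siteNbhd_eq_ofMarked_around k [j] ω hω, ← childNbhd_eq]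
      exact (if_pos hω).symm
    · rw [Set.indicator_of_notMem (by exact hω)]
      exact (if_neg hω).symm
  · refine lintegral_congr_ae ?_
    -- Almost surely, being a vertex can be read off from the initial state, so trajectories
    -- determine the full states that `κ` takes as arguments.
    filter_upwards [hcond.init_eq_iff [j], hcond.init_eq_iff []] with ω h1 h2
    by_cases hω : [j] ∈ (T ω).1
    · rw [Set.indicator_of_mem (by exact hω)]
      have e1 : SiteState.ofPath ϖ (traj X [j] k ω) = site T X k [j] ω :=
        Prod.ext (propext (by
          change X [j] 0 ω ≠ ϖ ↔ _
          rw [Ne, h1, not_not]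
          rfl)) rfl
      have e2 : SiteState.ofPath ϖ (traj X [] k ω) = site T X k [] ω :=
        Prod.ext (propext (by
          change X [] 0 ω ≠ ϖ ↔ _
          rw [Ne, h2, not_not]
          rfl)) rfl
      have hroot : traj X [] k ω 0 ≠ ϖ := by
        change X [] 0 ω ≠ ϖ
        rw [Ne, h2, not_not]
        exact (T ω).2.root_mem
      have hfm : Measurable fun z => f (outsideOf j fun u => site T X k u ω, z) :=
        hf.comp (measurable_const.prodMk measurable_id)
      rw [lintegral_phantomKernel hϖ κ hroot hfm, e1, e2]
      refine lintegral_congr fun d => ?_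
      exact (if_pos hω).symm
    · rw [Set.indicator_of_notMem (by exact hω)]
      symm
      refine (lintegral_congr fun d => ?_).trans lintegral_zero
      exact if_neg hω

-- If `[j]` is a vertex, this is the conditional law of its neighborhood given the outside;
-- otherwise both factors are one.
omit [IsProbabilityMeasure P] hX in
theorem lintegral_childIndicator {k : ℕ}
    {κ : Kernel (SiteState 𝒳 k × SiteState 𝒳 k) (SubtreeState 𝒳 k)} [IsMarkovKernel κ]
    (hκ : IsSubtreeKernel P T X k κ) {B : ℕ+ → Set (Unordered (Fin (k + 1) → 𝒳))}
    (hB : ∀ i, MeasurableSet (B i)) (j : ℕ+) {f : OutsideState 𝒳 k j → ℝ≥0∞} (hf : Measurable f) :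
    ∫⁻ ω, f (outsideOf j fun u => site T X k u ω) * childIndicator B j (fun u => site T X k u ω) ∂P =
      ∫⁻ ω, f (outsideOf j fun u => site T X k u ω) *
        childProb B (phantomKernel hϖ κ) j (fun u => site T X k u.1 ω) ∂P := by
  have hm := hcond.measurableSet_mem [j]
  rw [← lintegral_add_compl _ hm, ← lintegral_add_compl (fun ω => f _ * childProb B _ j _) hm]
  congr 1
  · have h := hcond.setLIntegral_siteNbhd hϖ hκ j
      (f := fun p => f p.1 * (B j).indicator 1 p.2)
      ((hf.comp measurable_fst).mul ((measurable_one.indicator (hB j)).comp measurable_snd))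
    convert h using 1
    · refine setLIntegral_congr_fun hm fun ω hω => ?_
      have hω' : [j] ∈ (T ω).1 := hω
      simp only [childIndicator, if_pos (show (site T X k [j] ω).1 from hω'),
        siteNbhd_eq_ofMarked_around k [j] ω hω']
    · refine setLIntegral_congr_fun hm fun ω hω => ?_
      have hω' : [j] ∈ (T ω).1 := hω
      simp only [childProb]
      rw [if_pos (by exact hω'), lintegral_const_mul _ (measurable_one.indicator (hB j)),
        lintegral_indicator_one (hB j)]
      rfl
  · refine setLIntegral_congr_fun hm.compl fun ω hω => ?_
    have hω' : [j] ∉ (T ω).1 := hω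
    simp only [childIndicator, childProb, if_neg (show ¬ (site T X k [j] ω).1 from hω')]
    rw [if_neg (by exact hω')]

omit [IsProbabilityMeasure P] hX in
/-- Given the trajectories at the root and at its children, the trajectories around the children are
independent. -/
theorem lintegral_prod_childIndicator {k : ℕ}
    {κ : Kernel (SiteState 𝒳 k × SiteState 𝒳 k) (SubtreeState 𝒳 k)} [IsMarkovKernel κ]
    (hκ : IsSubtreeKernel P T X k κ) {B : ℕ+ → Set (Unordered (Fin (k + 1) → 𝒳))}
    (hB : ∀ i, MeasurableSet (B i)) (J : Finset ℕ+) {f : (UHLabel₁ → SiteState 𝒳 k) → ℝ≥0∞}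
    (hf : Measurable f) :
    ∫⁻ ω, f (fun u => site T X k u.1 ω) * ∏ j ∈ J, childIndicator B j (fun u => site T X k u ω) ∂P =
      ∫⁻ ω, f (fun u => site T X k u.1 ω) *
        ∏ j ∈ J, childProb B (phantomKernel hϖ κ) j (fun u => site T X k u.1 ω) ∂P := by
  classical
  induction J using Finset.induction_on generalizing f with
  | empty => simp
  | insert j J hj ih =>
    have hr : Measurable fun (f : UHLabel → SiteState 𝒳 k) (u : UHLabel₁) => f u.1 :=
      measurable_pi_lambda _ fun u => measurable_pi_apply u.1
    -- The factors of the other children are functions of the outside of `[j]`, so the factor of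
    -- `[j]` can be integrated out first.
    let Φ : (UHLabel → SiteState 𝒳 k) → ℝ≥0∞ := fun s =>
      f (fun u => s u.1) * ∏ i ∈ J, childIndicator B i s
    have hΦ : Measurable Φ := (hf.comp hr).mul
      (Finset.measurable_fun_prod _ fun i _ => measurable_childIndicator hB i)
    have hΦj : ∀ s, Φ (outsideField j (outsideOf j s)) = Φ s := by
      intro s
      simp only [Φ, outsideField_apply₁]
      congr 1
      refine Finset.prod_congr rfl fun i hi => childIndicator_outsideField ?_ s
      rintro rfl
      exact hj hi
    have h1 := hcond.lintegral_childIndicator hϖ hκ hB j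
      (f := fun c => Φ (outsideField j c)) (hΦ.comp (measurable_outsideField j))
    simp only [hΦj] at h1
    -- The resulting conditional probability depends only on the root and its children, and is
    -- absorbed into `f`.
    have h2 := ih (f := fun s => f s * childProb B (phantomKernel hϖ κ) j s)
      (hf.mul (measurable_childProb hB _ j))
    calc _ = ∫⁻ ω, Φ (fun u => site T X k u ω) * childIndicator B j (fun u => site T X k u ω) ∂P := by
            refine lintegral_congr fun ω => ?_
            rw [Finset.prod_insert hj]
            ring
      _ = ∫⁻ ω, Φ (fun u => site T X k u ω) *
            childProb B (phantomKernel hϖ κ) j (fun u => site T X k u.1 ω) ∂P := h1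
      _ = ∫⁻ ω, f (fun u => site T X k u.1 ω) *
            childProb B (phantomKernel hϖ κ) j (fun u => site T X k u.1 ω) *
            ∏ i ∈ J, childIndicator B i (fun u => site T X k u ω) ∂P := by
            refine lintegral_congr fun ω => ?_
            simp only [Φ]
            ring
      _ = _ := h2.trans (by
            refine lintegral_congr fun ω => ?_
            rw [Finset.prod_insert hj]
            ring)

end UGWCondition

/-! ### The truncated tree and the ratio of degrees. -/

namespace UHTree

theorem mem_trunc₁ (T : UHTree) (v : UHLabel₁) : v.1 ∈ T.trunc₁.1 ↔ v.1 ∈ T.1 :=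
  ⟨fun h => h.1, fun h => ⟨h, v.2⟩⟩

theorem child_mem_trunc₁ (T : UHTree) (j : ℕ+) : [j] ∈ T.trunc₁.1 ↔ [j] ∈ T.1 :=
  T.mem_trunc₁ (.child j)

theorem rootChildren_trunc₁ (T : UHTree) : T.trunc₁.rootChildren = T.rootChildren := by
  ext j
  simp [child_mem_trunc₁]

theorem card_nbhd_root (T : UHTree) : (T.nbhd []).card = T.rootChildren.card := by
  rw [nbhd_root_eq, Finset.card_map]

theorem card_nbhd_root_trunc₁ (T : UHTree) : (T.trunc₁.nbhd []).card = (T.nbhd []).card := by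
  rw [card_nbhd_root, card_nbhd_root, rootChildren_trunc₁]

theorem measurable_trunc₁ : Measurable trunc₁ := by
  refine UHTree.measurable_iff.2 fun v => ?_
  exact (UHTree.measurableSet_mem v).inter (MeasurableSet.const _)

theorem measurableSet_rootChildren_eq (J : Finset ℕ+) :
    MeasurableSet {T : UHTree | T.rootChildren = J} := by
  have : {T : UHTree | T.rootChildren = J} = ⋂ j : ℕ+, {T | [j] ∈ T.1 ↔ j ∈ J} := by
    ext T
    simp [Finset.ext_iff]
  rw [this]
  refine MeasurableSet.iInter fun j => ?_
  by_cases hj : j ∈ J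
  · simpa [hj] using UHTree.measurableSet_mem [j]
  · simp only [hj, iff_false]
    exact (UHTree.measurableSet_mem [j]).compl

/-- The random index set takes countably many values, and for each of them the product is over a
fixed set. -/
theorem measurable_prod_rootChildren {α β : Type*} [MeasurableSpace α] [MeasurableSpace β] [CommMonoid β]
    [MeasurableMul₂ β] {f : ℕ+ → α → β} (hf : ∀ j, Measurable (f j)) :
    Measurable fun p : UHTree × α => ∏ j ∈ p.1.rootChildren, f j p.2 := by
  let _ : MeasurableSpace (Finset ℕ+) := ⊤
  have h1 : Measurable fun T : UHTree => T.rootChildren :=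
    measurable_to_countable' fun J => measurableSet_rootChildren_eq J
  have h2 : Measurable fun q : Finset ℕ+ × α => ∏ j ∈ q.1, f j q.2 :=
    measurable_from_prod_countable_right fun J => Finset.measurable_fun_prod J fun j _ => hf j
  exact h2.comp (h1.prodMap measurable_id)

theorem mem_one_iff_card_ne_zero (T : UHTree) : [1] ∈ T.1 ↔ (T.nbhd []).card ≠ 0 := by
  rw [singleton_mem_iff, PNat.one_coe]
  omega

theorem card_nbhd_one_ne_zero {T : UHTree} (h : [1] ∈ T.1) : (T.nbhd [1]).card ≠ 0 :=
  Finset.card_ne_zero_of_mem ((T.mem_nbhd [] [1]).2 ⟨h, T.2.root_mem, Or.inr ⟨1, rfl⟩⟩)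

theorem card_nbhd_of_notMem {T : UHTree} {v : UHLabel} (h : v ∉ T.1) : (T.nbhd v).card = 0 := by
  rw [Finset.card_eq_zero, Finset.eq_empty_iff_forall_notMem]
  exact fun u hu => h ((T.mem_nbhd u v).1 hu).1

end UHTree

/-- It allows events about a tree to be expressed through its underlying set of labels, so that a
tree need not be constructed from arbitrary states. -/
theorem measurableSet_prod_subtype {α β : Type*} [MeasurableSpace α] [MeasurableSpace β] {p : α → Prop}
    {H : Set ({a // p a} × β)} (hH : MeasurableSet H) :
    ∃ H₀ : Set (α × β), MeasurableSet H₀ ∧ H = (fun q => (q.1.1, q.2)) ⁻¹' H₀ := by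
  have h : Prod.instMeasurableSpace (α := {a // p a}) (β := β) =
      MeasurableSpace.comap (fun q => (q.1.1, q.2)) Prod.instMeasurableSpace := by
    change MeasurableSpace.prod _ _ = MeasurableSpace.comap _ (MeasurableSpace.prod _ _)
    simp only [MeasurableSpace.prod, MeasurableSpace.comap_sup, MeasurableSpace.comap_comp]
    rw [Subtype.instMeasurableSpace, MeasurableSpace.comap_comp]
    rfl
  rw [h] at hH
  obtain ⟨H₀, h0, h1⟩ := hH
  exact ⟨H₀, h0, h1.symm⟩

theorem ratio_pos_iff {a b : ℕ} : 0 < ratio a b ↔ (a = 0 ∧ b = 0) ∨ (a ≠ 0 ∧ b ≠ 0) := by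
  unfold ratio
  split_ifs with h
  · simp [h]
  · rw [div_pos_iff]
    constructor
    · rintro (⟨h1, h2⟩ | ⟨h1, _⟩)
      · exact Or.inr ⟨by rintro rfl; simp at h1, by rintro rfl; simp at h2⟩
      · exact absurd h1 (not_lt.2 (Nat.cast_nonneg a))
    · rintro (h' | ⟨h1, h2⟩)
      · exact absurd h' h
      · exact Or.inl ⟨by exact_mod_cast Nat.pos_of_ne_zero h1, by exact_mod_cast Nat.pos_of_ne_zero h2⟩

theorem ratio_nonneg (a b : ℕ) : 0 ≤ ratio a b := by
  unfold ratio
  split_ifs <;> positivity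

theorem measurable_ratio : Measurable fun p : ℕ × ℕ => ratio p.1 p.2 := measurable_of_countable _

theorem ofReal_ratio {a b : ℕ} (hb : b ≠ 0) : ENNReal.ofReal (ratio a b) = a / b := by
  rw [ratio, if_neg (fun h => hb h.2), ENNReal.ofReal_div_of_pos (by positivity),
    ENNReal.ofReal_natCast, ENNReal.ofReal_natCast]

theorem rootNbhdTraj_trunc₁ {Ω 𝒳 : Type*} (T : Ω → UHTree) (X : UHLabel → ℕ → Ω → 𝒳) (k : ℕ) :
    rootNbhdTraj (fun ω => (T ω).trunc₁) (fun v => X v.1) k = siteNbhd T X k [] := by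
  ext1 ω
  rw [rootNbhdTraj, siteNbhd, UHTree.rootChildren_trunc₁, UHTree.nbhd_root_eq]
  simp only [Unordered.ofFinset, Finset.map_val, Multiset.map_map]
  rfl

/-! ### The size-biased formula holds for the particle system. -/

namespace UGWCondition

variable {Ω 𝒳 Ξ : Type*} {ϖ : 𝒳} {ρ₀ ρ : PMF ℕ} {T : Ω → UHTree} {X : UHLabel → ℕ → Ω → 𝒳}
  {ξ : UHLabel → ℕ → Ω → Ξ}
  {F : (k : ℕ) → (Fin (k + 1) → 𝒳) → Unordered (Fin (k + 1) → 𝒳) → Ξ → 𝒳}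
  [MeasurableSpace Ω] [MeasurableSpace 𝒳] [MeasurableSpace Ξ] {P : Measure Ω}
  [IsProbabilityMeasure P]
  (hcond : UGWCondition P ϖ ρ₀ ρ T X ξ F) (hX : IsParticleSystem ϖ T X ξ F)
  (hϖ : MeasurableSet ({ϖ} : Set 𝒳))

-- If `[1]` is a vertex, the edge to the root makes both degrees positive; otherwise both vanish and
-- the ratio is 0/0 = 1.
omit [MeasurableSpace Ω] in
theorem ratio_card_pos (ω : Ω) : 0 < ratio ((T ω).nbhd []).card ((T ω).nbhd [1]).card := by
  rw [ratio_pos_iff]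
  by_cases h : [1] ∈ (T ω).1
  · exact Or.inr ⟨(T ω).mem_one_iff_card_ne_zero.1 h, UHTree.card_nbhd_one_ne_zero h⟩
  · refine Or.inl ⟨?_, UHTree.card_nbhd_of_notMem h⟩
    by_contra h'
    exact h ((T ω).mem_one_iff_card_ne_zero.2 h')

include hcond

omit [IsProbabilityMeasure P] in
theorem measurable_ratio_card :
    Measurable fun ω => ratio ((T ω).nbhd []).card ((T ω).nbhd [1]).card :=
  measurable_ratio.comp (((UHTree.measurable_card_nbhd []).comp hcond.measurable_tree).prodMk
    ((UHTree.measurable_card_nbhd [1]).comp hcond.measurable_tree))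

include hX

/-- The integral of a functional of the trajectories at the root, at its first child, and around the
root, with the weight `|N_ø| / |N_1|`. -/
theorem setLIntegral_ratio {k : ℕ}
    {f : (Fin (k + 1) → 𝒳) × (Fin (k + 1) → 𝒳) × Unordered (Fin (k + 1) → 𝒳) → ℝ≥0∞}
    (hf : Measurable f) {C : ℝ≥0} (hC : ∀ x, f x ≤ C) :
    ∫⁻ ω in {ω | [1] ∈ (T ω).1}, f (traj X [] k ω, traj X [1] k ω, siteNbhd T X k [] ω) *
        ENNReal.ofReal (ratio ((T ω).nbhd []).card ((T ω).nbhd [1]).card) ∂P =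
      ∫⁻ ω in {ω | [1] ∈ (T ω).1}, f (traj X [1] k ω, traj X [] k ω, siteNbhd T X k [1] ω) ∂P := by
  rw [← hcond.lintegral_card_div_card hX hf hC]
  refine setLIntegral_congr_fun (hcond.measurableSet_mem [1]) fun ω hω => ?_
  rw [ofReal_ratio (UHTree.card_nbhd_one_ne_zero hω), mul_comm]

/-- Mass transport with the constant function 1 bounds the mean on the event that `[1]` is a vertex
by a probability; elsewhere the ratio is 1. -/
theorem integrable_ratio_card :
    Integrable (fun ω => ratio ((T ω).nbhd []).card ((T ω).nbhd [1]).card) P := by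
  refine ⟨hcond.measurable_ratio_card.aestronglyMeasurable, ?_⟩
  rw [hasFiniteIntegral_iff_ofReal (.of_forall fun ω => ratio_nonneg _ _),
    ← lintegral_add_compl _ (hcond.measurableSet_mem [1])]
  refine ENNReal.add_lt_top.2 ⟨?_, ?_⟩
  · have h := hcond.setLIntegral_ratio hX (k := 0) (f := fun _ => 1) measurable_const (C := 1)
      (fun _ => by simp)
    simp only [one_mul, lintegral_const] at h
    rw [h]
    exact measure_lt_top _ _
  · refine (setLIntegral_congr_fun (g := fun _ => 1) (hcond.measurableSet_mem [1]).compl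
      fun ω hω => ?_).trans_lt ?_
    · have h1 : [1] ∉ (T ω).1 := hω
      have h2 : ((T ω).nbhd []).card = 0 := by
        by_contra h'
        exact h1 ((T ω).mem_one_iff_card_ne_zero.2 h')
      simp [ratio, h2, UHTree.card_nbhd_of_notMem h1]
    · rw [setLIntegral_one]
      exact measure_lt_top _ _

/-- If the root has a child, mass transport removes the weight and exchanges the root with `[1]` on
both sides of the integrated formula. What remains is that `γ` is the conditional law of the
neighborhood of `[1]` given the trajectories of `[1]` and the root. If the root has no child, both
sides concern the point mass at the empty sequence. -/
theorem isPhantomKernel_phantomKernel {k : ℕ} {κ : Kernel (SiteState 𝒳 k × SiteState 𝒳 k) (SubtreeState 𝒳 k)}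
    [IsMarkovKernel κ] (hκ : IsSubtreeKernel P T X k κ) :
    IsPhantomKernel P (fun ω => (T ω).trunc₁) (fun v => X v.1) (fun _ ω => ((T ω).nbhd [1]).card) k
      (phantomKernel hϖ κ) := by
  refine ⟨inferInstance, fun B hB => ?_⟩
  simp only [UHTree.card_nbhd_root_trunc₁, rootNbhdTraj_trunc₁]
  set γ := phantomKernel hϖ κ with hγ
  have hm := hcond.measurableSet_mem [1]
  have hγB : Measurable fun p => γ p B := Kernel.measurable_coe γ hB
  refine (ratio_condExp_eq_iff (h := fun ω => (traj X [] k ω, traj X [1] k ω))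
    (g := fun p => (γ p).real B)
    ((hcond.measurable_traj hX k []).prodMk (hcond.measurable_traj hX k [1]))
    (hcond.measurable_siteNbhd hX k [] hB) hγB.ennreal_toReal
    (fun _ => measureReal_nonneg) (fun _ => measureReal_le_one) (hcond.integrable_ratio_card hX)
    (fun ω => ratio_nonneg _ _) (.of_forall fun ω => ratio_card_pos ω)).2 fun H hH => ?_
  have hHm : MeasurableSet ((fun ω => (traj X [] k ω, traj X [1] k ω)) ⁻¹' H) :=
    ((hcond.measurable_traj hX k []).prodMk (hcond.measurable_traj hX k [1])) hH
  have hBm := hcond.measurable_siteNbhd hX k [] hB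
  rw [← lintegral_indicator hHm, ← lintegral_indicator (hHm.inter hBm)]
  let f : (Fin (k + 1) → 𝒳) × (Fin (k + 1) → 𝒳) × Unordered (Fin (k + 1) → 𝒳) → ℝ≥0∞ := fun p =>
    H.indicator (fun q => γ q B) (p.1, p.2.1)
  let f' : (Fin (k + 1) → 𝒳) × (Fin (k + 1) → 𝒳) × Unordered (Fin (k + 1) → 𝒳) → ℝ≥0∞ := fun p =>
    H.indicator 1 (p.1, p.2.1) * B.indicator 1 p.2.2
  have hf : Measurable f := (hγB.indicator hH).comp
    (measurable_fst.prodMk (measurable_fst.comp measurable_snd))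
  have hf' : Measurable f' := ((measurable_one.indicator hH).comp
    (measurable_fst.prodMk (measurable_fst.comp measurable_snd))).mul
    ((measurable_one.indicator hB).comp (measurable_snd.comp measurable_snd))
  have hfC : ∀ p, f p ≤ (1 : ℝ≥0) := fun p => by
    simp only [f]
    exact Set.indicator_le' (fun _ _ => prob_le_one) (fun _ _ => zero_le) _
  have hfC' : ∀ p, f' p ≤ (1 : ℝ≥0) := fun p => by
    refine mul_le_one' ?_ ?_ <;> exact Set.indicator_le' (fun _ _ => le_rfl) (fun _ _ => zero_le) _
  have hlhs : ∀ ω, ((fun ω => (traj X [] k ω, traj X [1] k ω)) ⁻¹' H).indicator (fun ω =>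
      ENNReal.ofReal ((γ (traj X [] k ω, traj X [1] k ω)).real B) *
        ENNReal.ofReal (ratio ((T ω).nbhd []).card ((T ω).nbhd [1]).card)) ω =
      f (traj X [] k ω, traj X [1] k ω, siteNbhd T X k [] ω) *
        ENNReal.ofReal (ratio ((T ω).nbhd []).card ((T ω).nbhd [1]).card) := by
    intro ω
    by_cases h : (traj X [] k ω, traj X [1] k ω) ∈ H
    · rw [Set.indicator_of_mem (by exact h)]
      simp only [f, Set.indicator_of_mem h]
      rw [ofReal_measureReal]
    · rw [Set.indicator_of_notMem (by exact h)]
      simp only [f, Set.indicator_of_notMem h, zero_mul]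
  have hrhs : ∀ ω, ((fun ω => (traj X [] k ω, traj X [1] k ω)) ⁻¹' H ∩ siteNbhd T X k [] ⁻¹' B).indicator
      (fun ω => ENNReal.ofReal (ratio ((T ω).nbhd []).card ((T ω).nbhd [1]).card)) ω =
      f' (traj X [] k ω, traj X [1] k ω, siteNbhd T X k [] ω) *
        ENNReal.ofReal (ratio ((T ω).nbhd []).card ((T ω).nbhd [1]).card) := by
    intro ω
    by_cases h : (traj X [] k ω, traj X [1] k ω) ∈ H <;> by_cases h' : siteNbhd T X k [] ω ∈ B <;>
      simp [f', h, h']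
  simp only [hlhs, hrhs]
  rw [← lintegral_add_compl _ hm, ← lintegral_add_compl (fun ω => f' _ * _) hm,
    hcond.setLIntegral_ratio hX hf hfC, hcond.setLIntegral_ratio hX hf' hfC']
  congr 1
  · let f₁ : OutsideState 𝒳 k 1 × Unordered (Fin (k + 1) → 𝒳) → ℝ≥0∞ := fun p =>
      f' (p.1.2.1.2, p.1.2.2.2, p.2)
    have hf₁ : Measurable f₁ := hf'.comp (measurable_fst.snd.fst.snd.prodMk
      (measurable_fst.snd.snd.snd.prodMk measurable_snd))
    have h := hcond.setLIntegral_siteNbhd hϖ hκ 1 hf₁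
    refine (Eq.trans h ?_).symm
    refine setLIntegral_congr_fun hm fun ω _ => ?_
    change ∫⁻ z, H.indicator 1 (traj X [1] k ω, traj X [] k ω) * B.indicator 1 z
      ∂(γ (traj X [1] k ω, traj X [] k ω)) = _
    rw [lintegral_const_mul _ (measurable_one.indicator hB), lintegral_indicator_one hB]
    by_cases h : (traj X [1] k ω, traj X [] k ω) ∈ H <;> simp [f, h]
  · refine lintegral_congr_ae ((ae_restrict_iff' hm.compl).2 ?_)
    filter_upwards [hcond.init_eq_iff [1]] with ω h1 hω
    have h1' : [1] ∉ (T ω).1 := hω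
    have hdead : traj X [1] k ω 0 = ϖ := h1.2 h1'
    have hnb : siteNbhd T X k [] ω = Unordered.ofFinset (∅ : Finset ℕ+) fun _ _ => ϖ := by
      have h2 : (T ω).nbhd [] = ∅ := by
        rw [← Finset.card_eq_zero]
        by_contra h'
        exact h1' ((T ω).mem_one_iff_card_ne_zero.2 h')
      rw [siteNbhd, h2]
      rfl
    congr 1
    by_cases h : (traj X [] k ω, traj X [1] k ω) ∈ H
    · simp only [f, f', Set.indicator_of_mem h, hnb]
      rw [hγ, phantomKernel_dead hϖ κ hdead, Measure.dirac_apply' _ hB]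
      simp
    · simp [f, f', h]

end UGWCondition

/-! ### The particle system is a local-field process. -/

theorem UHTree.lintegral_eq_tsum_rootChildren {Ω : Type*} [MeasurableSpace Ω] {P : Measure Ω}
    {T : Ω → UHTree} (hT : Measurable T) (g : Ω → ℝ≥0∞) :
    ∫⁻ ω, g ω ∂P = ∑' J : Finset ℕ+, ∫⁻ ω in {ω | (T ω).rootChildren = J}, g ω ∂P := by
  have hm : ∀ J, MeasurableSet {ω | (T ω).rootChildren = J} := fun J =>
    hT (UHTree.measurableSet_rootChildren_eq J)
  rw [← lintegral_iUnion hm]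
  · rw [show (⋃ J : Finset ℕ+, {ω | (T ω).rootChildren = J}) = Set.univ by ext; simp,
      Measure.restrict_univ]
  · intro a b hab
    rw [Function.onFun, Set.disjoint_left]
    rintro ω h1 h2
    exact hab (h1.symm.trans h2)

/-- The tree and the trajectories at the root and at its children, as a function of the states. -/
def treePaths {𝒳 : Type*} {k : ℕ} (s : UHLabel₁ → SiteState 𝒳 k) :
    Set UHLabel × (UHLabel₁ → Fin (k + 1) → 𝒳) :=
  ({v | ∃ h : v.length ≤ 1, (s ⟨v, h⟩).1}, fun u => (s u).2)

theorem measurable_treePaths {𝒳 : Type*} [MeasurableSpace 𝒳] {k : ℕ} :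
    Measurable (treePaths : (UHLabel₁ → SiteState 𝒳 k) → _) := by
  refine Measurable.prodMk ?_ (measurable_pi_lambda _ fun u => (measurable_pi_apply u).snd)
  refine measurable_pi_iff.2 fun v => ?_
  change Measurable fun s : UHLabel₁ → SiteState 𝒳 k => ∃ h : v.length ≤ 1, (s ⟨v, h⟩).1
  by_cases h : v.length ≤ 1
  · simpa only [h, exists_true_left] using (measurable_pi_apply (⟨v, h⟩ : UHLabel₁)).fst
  · simp [h]

theorem treePaths_site {Ω 𝒳 : Type*} (T : Ω → UHTree) (X : UHLabel → ℕ → Ω → 𝒳) (k : ℕ) (ω : Ω) :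
    treePaths (fun u : UHLabel₁ => site T X k u.1 ω) =
      ((T ω).trunc₁.1, fun v : UHLabel₁ => traj X v.1 k ω) := by
  refine Prod.ext ?_ rfl
  ext v
  exact ⟨fun ⟨h, hv⟩ => ⟨hv, h⟩, fun ⟨hv, h⟩ => ⟨h, hv⟩⟩

namespace UGWCondition

variable {Ω 𝒳 Ξ : Type*} {ϖ : 𝒳} {ρ₀ ρ : PMF ℕ} {T : Ω → UHTree} {X : UHLabel → ℕ → Ω → 𝒳}
  {ξ : UHLabel → ℕ → Ω → Ξ}
  {F : (k : ℕ) → (Fin (k + 1) → 𝒳) → Unordered (Fin (k + 1) → 𝒳) → Ξ → 𝒳}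
  [MeasurableSpace Ω] [MeasurableSpace 𝒳] [MeasurableSpace Ξ] {P : Measure Ω}
  [IsProbabilityMeasure P]
  (hcond : UGWCondition P ϖ ρ₀ ρ T X ξ F) (hX : IsParticleSystem ϖ T X ξ F)
  (hϖ : MeasurableSet ({ϖ} : Set 𝒳))

include hcond hX

omit [IsProbabilityMeasure P] in
theorem measurable_trunc₁_traj (k : ℕ) :
    Measurable fun ω => ((T ω).trunc₁, fun v : UHLabel₁ => traj X v.1 k ω) :=
  (UHTree.measurable_trunc₁.comp hcond.measurable_tree).prodMk
    (measurable_pi_lambda _ fun v => hcond.measurable_traj hX k v.1)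

/-- Splitting according to the set `J` of children makes the index set of the product deterministic;
then the identity for a fixed finite set of children applies. -/
theorem condExp_children {k : ℕ} {κ : Kernel (SiteState 𝒳 k × SiteState 𝒳 k) (SubtreeState 𝒳 k)}
    [IsMarkovKernel κ] (hκ : IsSubtreeKernel P T X k κ) {B : ℕ+ → Set (Unordered (Fin (k + 1) → 𝒳))}
    (hB : ∀ j, MeasurableSet (B j)) :
    P⟦{ω | ∀ j ∈ (T ω).trunc₁.rootChildren, siteNbhd T X k [j] ω ∈ B j} |
        MeasurableSpace.comap (fun ω => ((T ω).trunc₁, fun v : UHLabel₁ => traj X v.1 k ω))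
          inferInstance⟧ =ᵐ[P]
      fun ω => ∏ j ∈ (T ω).trunc₁.rootChildren,
        (phantomKernel hϖ κ (traj X [j] k ω, traj X [] k ω)).real (B j) := by
  classical
  set γ := phantomKernel hϖ κ with hγ
  have hA : MeasurableSet {ω | ∀ j ∈ (T ω).trunc₁.rootChildren, siteNbhd T X k [j] ω ∈ B j} := by
    have : {ω | ∀ j ∈ (T ω).trunc₁.rootChildren, siteNbhd T X k [j] ω ∈ B j} =
        ⋂ j : ℕ+, {ω | [j] ∈ (T ω).1}ᶜ ∪ siteNbhd T X k [j] ⁻¹' B j := by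
      ext ω
      simp [UHTree.rootChildren_trunc₁, imp_iff_not_or]
    rw [this]
    exact MeasurableSet.iInter fun j =>
      (hcond.measurableSet_mem [j]).compl.union (hcond.measurable_siteNbhd hX k [j] (hB j))
  have hg : Measurable fun p : UHTree × (UHLabel₁ → Fin (k + 1) → 𝒳) =>
      ∏ j ∈ p.1.rootChildren, (γ (p.2 (.child j), p.2 .root)).real (B j) :=
    UHTree.measurable_prod_rootChildren
      (f := fun j (x : UHLabel₁ → Fin (k + 1) → 𝒳) => (γ (x (.child j), x .root)).real (B j))
      fun j => (Kernel.measurable_coe γ (hB j)).ennreal_toReal.comp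
        ((measurable_pi_apply _).prodMk (measurable_pi_apply _))
  refine (condExp_indicator_eq_iff (hcond.measurable_trunc₁_traj hX k) hA hg
    (fun p => Finset.prod_nonneg fun _ _ => measureReal_nonneg)
    (fun p => Finset.prod_le_one (fun _ _ => measureReal_nonneg) fun _ _ => measureReal_le_one)).2
    fun H hH => ?_
  have hHm := hcond.measurable_trunc₁_traj hX k hH
  obtain ⟨H₀, hH₀, rfl⟩ := measurableSet_prod_subtype hH
  rw [← lintegral_indicator hHm, ← lintegral_indicator_one (hHm.inter hA),
    UHTree.lintegral_eq_tsum_rootChildren hcond.measurable_tree,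
    UHTree.lintegral_eq_tsum_rootChildren hcond.measurable_tree]
  refine tsum_congr fun J => ?_
  -- The event `H` together with the requirement that the set of children be `J`, as a condition on
  -- states alone.
  let S : Set (UHLabel₁ → SiteState 𝒳 k) :=
    treePaths ⁻¹' H₀ ∩ ⋂ j : ℕ+, {s | (s (.child j)).1 ↔ j ∈ J}
  have hS : MeasurableSet S := by
    refine (measurable_treePaths hH₀).inter (MeasurableSet.iInter fun j => ?_)
    have hj : MeasurableSet {s : UHLabel₁ → SiteState 𝒳 k | (s (.child j)).1} :=
      measurableSet_setOfPred.2 (measurable_pi_apply (UHLabel₁.child j)).fst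
    by_cases h : j ∈ J
    · simpa only [h, iff_true] using hj
    · simp only [h, iff_false]
      exact hj.compl
  have hSiff : ∀ ω, (fun u : UHLabel₁ => site T X k u.1 ω) ∈ S ↔
      ((T ω).trunc₁.1, fun v : UHLabel₁ => traj X v.1 k ω) ∈ H₀ ∧ (T ω).rootChildren = J := by
    intro ω
    simp only [S, Set.mem_inter_iff, Set.mem_preimage, treePaths_site, Set.mem_iInter,
      Set.mem_ofPred_eq, Finset.ext_iff, UHTree.mem_rootChildren]
    rfl
  have hJm : MeasurableSet {ω | (T ω).rootChildren = J} :=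
    hcond.measurable_tree (UHTree.measurableSet_rootChildren_eq J)
  have h := hcond.lintegral_prod_childIndicator hϖ hκ hB J
    (f := S.indicator 1) (measurable_one.indicator hS)
  rw [← lintegral_indicator hJm, ← lintegral_indicator hJm]
  convert h using 1
  · refine lintegral_congr fun ω => ?_
    by_cases hJ : (T ω).rootChildren = J
    · rw [Set.indicator_of_mem (by exact hJ)]
      by_cases hω : ((T ω).trunc₁.1, fun v : UHLabel₁ => traj X v.1 k ω) ∈ H₀
      · rw [Set.indicator_of_mem ((hSiff ω).2 ⟨hω, hJ⟩), Pi.one_apply, one_mul]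
        have hc : ∀ j ∈ J, childIndicator B j (fun u => site T X k u ω) =
            (B j).indicator 1 (siteNbhd T X k [j] ω) := by
          intro j hj
          have hjT : [j] ∈ (T ω).1 := (UHTree.mem_rootChildren _ j).1 (hJ ▸ hj)
          rw [childIndicator, if_pos (by exact hjT), siteNbhd_eq_ofMarked_around k [j] ω hjT]
        rw [Finset.prod_congr rfl hc]
        by_cases hA' : ∀ j ∈ J, siteNbhd T X k [j] ω ∈ B j
        · rw [Set.indicator_of_mem, Finset.prod_eq_one]
          · rfl
          · exact fun j hj => Set.indicator_of_mem (hA' j hj) _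
          · refine ⟨hω, ?_⟩
            simpa only [Set.mem_ofPred_eq, UHTree.rootChildren_trunc₁, hJ] using hA'
        · rw [Set.indicator_of_notMem]
          · push Not at hA'
            obtain ⟨j, hj, hjB⟩ := hA'
            rw [Finset.prod_eq_zero hj (Set.indicator_of_notMem hjB _)]
          · rintro ⟨-, h'⟩
            apply hA'
            simpa only [Set.mem_ofPred_eq, UHTree.rootChildren_trunc₁, hJ] using h'
      · rw [Set.indicator_of_notMem (fun h => hω h.1),
          Set.indicator_of_notMem (fun h => hω ((hSiff ω).1 h).1), zero_mul]
    · rw [Set.indicator_of_notMem (by exact hJ),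
        Set.indicator_of_notMem (fun h => hJ ((hSiff ω).1 h).2), zero_mul]
  · refine lintegral_congr fun ω => ?_
    by_cases hJ : (T ω).rootChildren = J
    · rw [Set.indicator_of_mem (by exact hJ)]
      by_cases hω : ((T ω).trunc₁.1, fun v : UHLabel₁ => traj X v.1 k ω) ∈ H₀
      · rw [Set.indicator_of_mem ((hSiff ω).2 ⟨hω, hJ⟩), Set.indicator_of_mem (by exact hω),
          Pi.one_apply, one_mul, ENNReal.ofReal_prod_of_nonneg fun _ _ => measureReal_nonneg,
          UHTree.rootChildren_trunc₁, hJ]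
        refine Finset.prod_congr rfl fun j hj => ?_
        have hjT : [j] ∈ (T ω).1 := (UHTree.mem_rootChildren _ j).1 (hJ ▸ hj)
        rw [childProb, if_pos (by exact hjT), ofReal_measureReal]
        rfl
      · rw [Set.indicator_of_notMem (by exact hω),
          Set.indicator_of_notMem (fun h => hω ((hSiff ω).1 h).1), zero_mul]
    · rw [Set.indicator_of_notMem (by exact hJ),
        Set.indicator_of_notMem (fun h => hJ ((hSiff ω).1 h).2), zero_mul]

/-- The particle system, restricted to the root and its children, is a local-field process. -/
theorem isLocalFieldProcess {κ : (k : ℕ) → Kernel (SiteState 𝒳 k × SiteState 𝒳 k) (SubtreeState 𝒳 k)}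
    [∀ k, IsMarkovKernel (κ k)] (hκ : ∀ k, IsSubtreeKernel P T X k (κ k)) :
    IsLocalFieldProcess P ϖ F
      (P.map (fun ω => ((T ω).trunc₁, fun v => X v.1 0 ω, ((T ω).nbhd [1]).card)))
      (P.map (ξ [] 1)) (fun ω => (T ω).trunc₁) (fun v : UHLabel₁ => X v.1)
      (fun _ ω => ((T ω).nbhd [1]).card) (fun v => ξ v.1) (fun k j => siteNbhd T X k [j])
      (fun k => phantomKernel hϖ (κ k)) where
  measurable_tree := UHTree.measurable_trunc₁.comp hcond.measurable_tree
  measurable_state v k := by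
    have := (measurable_pi_apply (Fin.last k)).comp (hcond.measurable_traj hX k v.1)
    exact this
  measurable_count k := (UHTree.measurable_card_nbhd [1]).comp hcond.measurable_tree
  measurable_noise v k := hcond.measurable_noise v.1 k
  measurable_phantom k j := hcond.measurable_siteNbhd hX k [j]
  law_init := rfl
  kernel k := hcond.isPhantomKernel_phantomKernel hX hϖ (hκ k)
  law_phantom k B hB := hcond.condExp_children hX hϖ (hκ k) hB
  indep_noise k := by
    have h : Function.Injective fun v : UHLabel₁ => (v.1, k) := fun a b h =>
      Subtype.ext (Prod.mk.inj h).1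
    exact hcond.indep_noise.precomp h
  law_noise k v := (hcond.identDistrib_noise v.1 k).map_eq
  fresh_noise k := by
    have := hcond.isProbabilityMeasure_noise
    set θ := P.map (ξ [] 1)
    have hW : Measurable fun ω => (T ω, fun v => traj X v k ω) :=
      hcond.measurable_tree.prodMk (measurable_pi_lambda _ fun v => hcond.measurable_traj hX k v)
    have hξ : Measurable fun ω v => ξ v (k + 1) ω :=
      measurable_pi_lambda _ fun v => hcond.measurable_noise v k
    -- Taking product test functions in `lintegral_noise_step` gives independence of the noise from
    -- the entire tree and all trajectories up to time `k`.
    have key : IndepFun (fun ω v => ξ v (k + 1) ω) (fun ω => (T ω, fun v => traj X v k ω)) P := by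
      refine IndepFun.symm ?_
      rw [indepFun_iff_measure_inter_preimage_eq_mul]
      intro s t hs ht
      have h1 := hcond.lintegral_noise_step hX k (H := fun p => s.indicator 1 p.1 * t.indicator 1 p.2)
        (((measurable_one.indicator hs).comp measurable_fst).mul
          ((measurable_one.indicator ht).comp measurable_snd))
      have h2 := hcond.lintegral_noise_step hX k (H := fun p => t.indicator 1 p.2)
        ((measurable_one.indicator ht).comp measurable_snd)
      simp only [lintegral_const_mul _ (measurable_one.indicator ht), lintegral_indicator_one ht] at h1 h2
      rw [lintegral_const, measure_univ, mul_one] at h2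
      have hsW : Measurable fun ω => s.indicator (1 : UHTree × (UHLabel → Fin (k + 1) → 𝒳) → ℝ≥0∞) (T ω, fun v => traj X v k ω) :=
        (measurable_one.indicator hs).comp hW
      rw [lintegral_mul_const _ hsW] at h1
      have e1 : ∫⁻ ω, s.indicator (1 : UHTree × (UHLabel → Fin (k + 1) → 𝒳) → ℝ≥0∞) (T ω, fun v => traj X v k ω) ∂P =
          P ((fun ω => (T ω, fun v => traj X v k ω)) ⁻¹' s) := by
        rw [← lintegral_indicator_one (hW hs)]
        rfl
      have e2 : ∫⁻ ω, t.indicator (1 : (UHLabel → Ξ) → ℝ≥0∞) (fun v => ξ v (k + 1) ω) ∂P =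
          P ((fun ω v => ξ v (k + 1) ω) ⁻¹' t) := by
        rw [← lintegral_indicator_one (hξ ht)]
        rfl
      rw [← e2, h2, ← e1, ← h1, ← lintegral_indicator_one ((hW hs).inter (hξ ht))]
      refine lintegral_congr fun ω => ?_
      rw [Set.inter_indicator_one]
      rfl
    have hψ : Measurable fun e : UHLabel → Ξ => fun v : UHLabel₁ => e v.1 :=
      measurable_pi_lambda _ fun v => measurable_pi_apply v.1
    -- The phantoms are neighborhoods in the tree, hence functions of the tree and the trajectories,
    -- and inherit the independence.
    have hφ : Measurable fun p : UHTree × (UHLabel → Fin (k + 1) → 𝒳) =>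
        (p.1.trunc₁, fun v : UHLabel₁ => p.2 v.1, fun j : ℕ+ =>
          Unordered.ofMarked fun u => (p.1.Adj [j] u, p.2 u)) := by
      refine (UHTree.measurable_trunc₁.comp measurable_fst).prodMk (Measurable.prodMk
        (measurable_pi_lambda _ fun v => (measurable_pi_apply v.1).comp measurable_snd)
        (measurable_pi_lambda _ fun j => Unordered.measurable_ofMarked.comp
          (measurable_pi_lambda _ fun u => ((UHTree.measurable_adj [j] u).comp measurable_fst).prodMk
            ((measurable_pi_apply u).comp measurable_snd))))
    have h := key.comp hψ hφ
    have e : ∀ j ω, Unordered.ofMarked (fun u => ((T ω).Adj [j] u, traj X u k ω)) =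
        siteNbhd T X k [j] ω := fun j ω => (siteNbhd_eq_ofMarked k [j] ω).symm
    have e' : (fun p : UHTree × (UHLabel → Fin (k + 1) → 𝒳) =>
        (p.1.trunc₁, fun v : UHLabel₁ => p.2 v.1, fun j : ℕ+ =>
          Unordered.ofMarked fun u => (p.1.Adj [j] u, p.2 u))) ∘
        (fun ω => (T ω, fun v => traj X v k ω)) = fun ω => ((T ω).trunc₁,
          fun v : UHLabel₁ => traj X v.1 k ω, fun j => siteNbhd T X k [j] ω) := by
      ext1 ω
      simp only [Function.comp_apply, e]
    rw [e'] at h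
    exact h
  -- The length of the neighborhood of `[1]` is its degree, so the count is constant in time. If
  -- `[1]` is no vertex, both branches give 0.
  count_succ k := by
    refine .of_forall fun ω => ?_
    by_cases h : [1] ∈ (T ω).1
    · rw [if_neg, siteNbhd, Unordered.length_ofFinset]
      intro h'
      have := ((T ω).child_mem_trunc₁ 1).2 h
      rw [h'] at this
      simp at this
    · rw [siteNbhd, Unordered.length_ofFinset, UHTree.card_nbhd_of_notMem h]
      simp
  root_succ k := by
    refine .of_forall fun ω => ?_
    rw [rootNbhdTraj_trunc₁]
    exact (hX k [] ω).trans (if_pos (T ω).2.root_mem)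
  child_succ k j := by
    refine .of_forall fun ω => ?_
    refine (hX k [j] ω).trans ?_
    by_cases h : [j] ∈ (T ω).1
    · rw [if_pos h, if_pos (((T ω).child_mem_trunc₁ j).2 h)]
      rfl
    · rw [if_neg h, if_neg fun h' => h (((T ω).child_mem_trunc₁ j).1 h')]

end UGWCondition

/-! ### The phantom kernel depends only on the law of the state. -/

section FieldState

variable {Ω 𝒳 : Type*} {k : ℕ}

/-- The tree, the trajectories at the root and at its children, and the count of a local-field
process. -/
def fieldState (T : Ω → UHTree) (X : UHLabel₁ → ℕ → Ω → 𝒳) (N : ℕ → Ω → ℕ) (k : ℕ) (ω : Ω) :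
    UHTree × (UHLabel₁ → Fin (k + 1) → 𝒳) × ℕ :=
  (T ω, fun v => traj X v k ω, N k ω)

/-- The unordered paths of the children of the root. -/
noncomputable def childrenPaths {Z : Type*} (p : UHTree × (UHLabel₁ → Z)) : Unordered Z :=
  Unordered.ofMarked fun j : ℕ+ => ([j] ∈ p.1.1, p.2 (.child j))

theorem measurable_childrenPaths {Z : Type*} [MeasurableSpace Z] :
    Measurable (childrenPaths : UHTree × (UHLabel₁ → Z) → Unordered Z) :=
  Unordered.measurable_ofMarked.comp (measurable_pi_lambda _ fun j =>
    ((UHTree.measurable_mem [j]).comp measurable_fst).prodMk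
      ((measurable_pi_apply (UHLabel₁.child j)).comp measurable_snd))

theorem rootNbhdTraj_eq (T : Ω → UHTree) (X : UHLabel₁ → ℕ → Ω → 𝒳) (k : ℕ) (ω : Ω) :
    rootNbhdTraj T X k ω = childrenPaths (T ω, fun v => traj X v k ω) := by
  rw [rootNbhdTraj, childrenPaths]
  exact (Unordered.ofMarked_eq_of_coe_eq (q := fun j : ℕ+ => ([j] ∈ (T ω).1, traj X (.child j) k ω))
    (T ω).rootChildren (by ext j; simp)).symm

variable [MeasurableSpace Ω] [MeasurableSpace 𝒳] {P : Measure Ω} [IsProbabilityMeasure P]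
  {T : Ω → UHTree} {X : UHLabel₁ → ℕ → Ω → 𝒳} {N : ℕ → Ω → ℕ}

/-- The ratio of the number of children of the root and the count. -/
noncomputable def fieldRatio (s : UHTree × (UHLabel₁ → Fin (k + 1) → 𝒳) × ℕ) : ℝ :=
  ratio (s.1.nbhd []).card s.2.2

theorem measurable_fieldRatio :
    Measurable (fieldRatio : UHTree × (UHLabel₁ → Fin (k + 1) → 𝒳) × ℕ → ℝ) :=
  measurable_ratio.comp (((UHTree.measurable_card_nbhd []).comp measurable_fst).prodMk
    measurable_snd.snd)

/-- A kernel is a phantom kernel if and only if it satisfies a family of identities that involve only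
the law of the state of the process. -/
theorem isPhantomKernel_iff (hs : Measurable (fieldState T X N k))
    (hr : Integrable fieldRatio (P.map (fieldState T X N k)))
    (hpos : ∀ᵐ s ∂(P.map (fieldState T X N k)), 0 < fieldRatio s)
    (γ : Kernel ((Fin (k + 1) → 𝒳) × (Fin (k + 1) → 𝒳)) (Unordered (Fin (k + 1) → 𝒳)))
    [IsMarkovKernel γ] :
    IsPhantomKernel P T X N k γ ↔ ∀ B, MeasurableSet B → ∀ H, MeasurableSet H →
      ∫⁻ s in {s | (s.2.1 .root, s.2.1 (.child 1)) ∈ H},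
        ENNReal.ofReal ((γ (s.2.1 .root, s.2.1 (.child 1))).real B) * ENNReal.ofReal (fieldRatio s)
          ∂(P.map (fieldState T X N k)) =
      ∫⁻ s in {s | (s.2.1 .root, s.2.1 (.child 1)) ∈ H} ∩ {s | childrenPaths (s.1, s.2.1) ∈ B},
        ENNReal.ofReal (fieldRatio s) ∂(P.map (fieldState T X N k)) := by
  have hpair : Measurable fun s : UHTree × (UHLabel₁ → Fin (k + 1) → 𝒳) × ℕ =>
      (s.2.1 .root, s.2.1 (.child 1)) :=
    ((measurable_pi_apply _).comp measurable_snd.fst).prodMk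
      ((measurable_pi_apply _).comp measurable_snd.fst)
  have hch : Measurable fun s : UHTree × (UHLabel₁ → Fin (k + 1) → 𝒳) × ℕ =>
      childrenPaths (s.1, s.2.1) :=
    measurable_childrenPaths.comp (measurable_fst.prodMk measurable_snd.fst)
  rw [IsPhantomKernel, and_iff_right (inferInstanceAs (IsMarkovKernel γ))]
  refine forall₂_congr fun B hB => ?_
  have hγB : Measurable fun p => (γ p).real B := (Kernel.measurable_coe γ hB).ennreal_toReal
  have hr' := hr.comp_measurable hs
  have h := ratio_condExp_eq_iff (P := P) (h := fun ω => (traj X .root k ω, traj X (.child 1) k ω))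
    (A := rootNbhdTraj T X k ⁻¹' B) (g := fun p => (γ p).real B) (hpair.comp hs)
    (by
      have : rootNbhdTraj T X k ⁻¹' B =
          fieldState T X N k ⁻¹' ((fun s => childrenPaths (s.1, s.2.1)) ⁻¹' B) := by
        ext ω
        simp only [Set.mem_preimage, rootNbhdTraj_eq]
        rfl
      rw [this]
      exact hs (hch hB))
    hγB (fun _ => measureReal_nonneg) (fun _ => measureReal_le_one) hr'
    (fun ω => ratio_nonneg _ _) (ae_of_ae_map hs.aemeasurable hpos)
  refine h.trans (forall₂_congr fun H hH => ?_)
  have hint : Measurable fun s : UHTree × (UHLabel₁ → Fin (k + 1) → 𝒳) × ℕ =>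
      ENNReal.ofReal ((γ (s.2.1 .root, s.2.1 (.child 1))).real B) * ENNReal.ofReal (fieldRatio s) :=
    (hγB.comp hpair).ennreal_ofReal.mul measurable_fieldRatio.ennreal_ofReal
  have hHm : MeasurableSet {s : UHTree × (UHLabel₁ → Fin (k + 1) → 𝒳) × ℕ |
      (s.2.1 .root, s.2.1 (.child 1)) ∈ H} := hpair hH
  have hBm : MeasurableSet {s : UHTree × (UHLabel₁ → Fin (k + 1) → 𝒳) × ℕ |
      childrenPaths (s.1, s.2.1) ∈ B} := hch hB
  rw [setLIntegral_map hHm hint hs,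
    setLIntegral_map (hHm.inter hBm) measurable_fieldRatio.ennreal_ofReal hs]
  have e : fieldState T X N k ⁻¹' ({s | (s.2.1 .root, s.2.1 (.child 1)) ∈ H} ∩
      {s | childrenPaths (s.1, s.2.1) ∈ B}) =
      (fun ω => (traj X .root k ω, traj X (.child 1) k ω)) ⁻¹' H ∩ rootNbhdTraj T X k ⁻¹' B := by
    ext ω
    simp only [Set.mem_preimage, Set.mem_inter_iff, rootNbhdTraj_eq]
    rfl
  rw [e]
  rfl

end FieldState

/-! ### One step as a measurable map. -/

section Step

variable {𝒳 Ξ : Type*} {k : ℕ}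

open Classical in
/-- The phantoms, with those at labels that are not vertices replaced by the empty sequence. -/
noncomputable def livePhantoms {Z : Type*} (t : UHTree) (z : ℕ+ → Unordered Z) : ℕ+ → Unordered Z :=
  fun j => if [j] ∈ t.1 then z j else (0 : Multiset Z)

theorem livePhantoms_of_mem {Z : Type*} {t : UHTree} (z : ℕ+ → Unordered Z) {j : ℕ+} (h : [j] ∈ t.1) :
    livePhantoms t z j = z j := if_pos h

theorem livePhantoms_of_notMem {Z : Type*} {t : UHTree} (z : ℕ+ → Unordered Z) {j : ℕ+}
    (h : [j] ∉ t.1) : livePhantoms t z j = (0 : Multiset Z) := if_neg h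

theorem measurable_livePhantoms {Z : Type*} [MeasurableSpace Z] :
    Measurable fun p : UHTree × (ℕ+ → Unordered Z) => livePhantoms p.1 p.2 :=
  measurable_pi_lambda _ fun j => Measurable.ite
    (measurable_fst (UHTree.measurableSet_mem [j])) ((measurable_pi_apply j).comp measurable_snd)
    measurable_const

variable (ϖ : 𝒳) (F : (k : ℕ) → (Fin (k + 1) → 𝒳) → Unordered (Fin (k + 1) → 𝒳) → Ξ → 𝒳)

open Classical in
/-- One step of a local-field process. -/
noncomputable def localFieldStep (p : (UHLabel₁ → Ξ) × (UHTree × (UHLabel₁ → Fin (k + 1) → 𝒳)) ×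
    (ℕ+ → Unordered (Fin (k + 1) → 𝒳))) : UHTree × (UHLabel₁ → Fin (k + 2) → 𝒳) × ℕ :=
  (p.2.1.1, fun v => Fin.snoc (α := fun _ => 𝒳) (p.2.1.2 v)
    (match v.1 with
      | [] => F k (p.2.1.2 .root) (childrenPaths p.2.1) (p.1 .root)
      | j :: _ => if [j] ∈ p.2.1.1.1 then F k (p.2.1.2 (.child j)) (p.2.2 j) (p.1 (.child j)) else ϖ),
    if [1] ∈ p.2.1.1.1 then (p.2.2 1).length else 0)

variable [MeasurableSpace 𝒳] [MeasurableSpace Ξ]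

variable {F} in
theorem measurable_localFieldStep (hF : Measurable
    (fun q : (Fin (k + 1) → 𝒳) × Unordered (Fin (k + 1) → 𝒳) × Ξ => F k q.1 q.2.1 q.2.2)) :
    Measurable (localFieldStep ϖ F (k := k)) := by
  refine measurable_snd.fst.fst.prodMk (Measurable.prodMk ?_ ?_)
  · refine measurable_pi_lambda _ fun v => (measurable_snoc (k + 1)).comp (Measurable.prodMk
      ((measurable_pi_apply v).comp measurable_snd.fst.snd) ?_)
    obtain ⟨v, hv⟩ := v
    cases v with
    | nil =>
      have h : Measurable fun p : (UHLabel₁ → Ξ) × (UHTree × (UHLabel₁ → Fin (k + 1) → 𝒳)) ×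
          (ℕ+ → Unordered (Fin (k + 1) → 𝒳)) =>
          (p.2.1.2 .root, childrenPaths p.2.1, p.1 .root) :=
        ((measurable_pi_apply UHLabel₁.root).comp measurable_snd.fst.snd).prodMk
          ((measurable_childrenPaths.comp measurable_snd.fst).prodMk
            ((measurable_pi_apply UHLabel₁.root).comp measurable_fst))
      exact hF.comp h
    | cons j w =>
      refine Measurable.ite (measurable_snd.fst.fst (UHTree.measurableSet_mem [j])) ?_
        measurable_const
      have h : Measurable fun p : (UHLabel₁ → Ξ) × (UHTree × (UHLabel₁ → Fin (k + 1) → 𝒳)) ×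
          (ℕ+ → Unordered (Fin (k + 1) → 𝒳)) =>
          (p.2.1.2 (.child j), p.2.2 j, p.1 (.child j)) :=
        ((measurable_pi_apply (UHLabel₁.child j)).comp measurable_snd.fst.snd).prodMk
          (((measurable_pi_apply j).comp measurable_snd.snd).prodMk
            ((measurable_pi_apply (UHLabel₁.child j)).comp measurable_fst))
      exact hF.comp h
  · exact Measurable.ite (measurable_snd.fst.fst (UHTree.measurableSet_mem [1]))
      (Unordered.measurable_length.comp ((measurable_pi_apply 1).comp measurable_snd.snd))
      measurable_const

end Step

theorem UHTree.eq_singleton_iff (T : UHTree) : T.1 = {[]} ↔ [1] ∉ T.1 := by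
  constructor
  · intro h h1
    rw [h] at h1
    simp at h1
  · intro h
    ext v
    simp only [Set.mem_singleton_iff]
    constructor
    · intro hv
      cases v with
      | nil => rfl
      | cons a w =>
        have ha := (T.singleton_mem_iff a).1 (T.2.mem_of_append_mem [a] w hv)
        refine absurd ((T.singleton_mem_iff 1).2 (le_trans ?_ ha)) h
        exact a.pos
    · rintro rfl
      exact T.2.root_mem

/-! ### Joint laws of state, phantoms and noise in a local-field process. -/

namespace IsLocalFieldProcess

variable {Ω 𝒳 Ξ : Type*} [MeasurableSpace Ω] [MeasurableSpace 𝒳] [MeasurableSpace Ξ] {P : Measure Ω}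
  {ϖ : 𝒳} {F : (k : ℕ) → (Fin (k + 1) → 𝒳) → Unordered (Fin (k + 1) → 𝒳) → Ξ → 𝒳}
  {ν : Measure (UHTree × (UHLabel₁ → 𝒳) × ℕ)} {θ : Measure Ξ}
  {T : Ω → UHTree} {X : UHLabel₁ → ℕ → Ω → 𝒳} {N : ℕ → Ω → ℕ} {ξ : UHLabel₁ → ℕ → Ω → Ξ}
  {Z : (k : ℕ) → ℕ+ → Ω → Unordered (Fin (k + 1) → 𝒳)}
  {γ : (k : ℕ) → Kernel ((Fin (k + 1) → 𝒳) × (Fin (k + 1) → 𝒳)) (Unordered (Fin (k + 1) → 𝒳))}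
  (hL : IsLocalFieldProcess P ϖ F ν θ T X N ξ Z γ)

include hL

theorem measurable_traj (v : UHLabel₁) (k : ℕ) : Measurable (traj X v k) :=
  measurable_pi_lambda _ fun i => hL.measurable_state v i

theorem measurable_treeTraj (k : ℕ) : Measurable fun ω => (T ω, fun v => traj X v k ω) :=
  hL.measurable_tree.prodMk (measurable_pi_lambda _ fun v => hL.measurable_traj v k)

theorem measurable_fieldState (k : ℕ) : Measurable (fieldState T X N k) :=
  hL.measurable_tree.prodMk ((measurable_pi_lambda _ fun v => hL.measurable_traj v k).prodMk
    (hL.measurable_count k))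

theorem measurable_livePhantoms (k : ℕ) :
    Measurable fun ω => livePhantoms (T ω) (fun j => Z k j ω) :=
  _root_.measurable_livePhantoms.comp
    (hL.measurable_tree.prodMk (measurable_pi_lambda _ fun j => hL.measurable_phantom k j))

/-- Phantoms at labels that are not vertices are never read. They are replaced by the empty sequence
because the axioms leave their law free. -/
theorem fieldState_succ (k : ℕ) : ∀ᵐ ω ∂P, fieldState T X N (k + 1) ω =
    localFieldStep ϖ F (fun v => ξ v (k + 1) ω, (T ω, fun v => traj X v k ω),
      livePhantoms (T ω) (fun j => Z k j ω)) := by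
  filter_upwards [hL.count_succ k, hL.root_succ k, ae_all_iff.2 (hL.child_succ k)] with ω h1 h2 h3
  refine Prod.ext rfl (Prod.ext ?_ ?_)
  · ext1 v
    refine (traj_succ X v k ω).trans ?_
    congr 1
    obtain ⟨v, hv⟩ := v
    match v, hv with
    | [], _ => exact h2.trans (by rw [rootNbhdTraj_eq])
    | [j], _ =>
      refine (h3 j).trans ?_
      by_cases hj : [j] ∈ (T ω).1
      · refine (if_pos hj).trans (Eq.symm ((if_pos hj).trans ?_))
        exact congrArg (fun z => F k (traj X (.child j) k ω) z (ξ (.child j) (k + 1) ω))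
          (livePhantoms_of_mem (fun j => Z k j ω) hj)
      · exact (if_neg hj).trans (if_neg hj).symm
    | _ :: _ :: _, hv => simp at hv
  · refine h1.trans ?_
    by_cases hj : [1] ∈ (T ω).1
    · rw [if_neg fun h => (T ω).eq_singleton_iff.1 h hj]
      refine ((if_pos hj).trans ?_).symm
      exact congrArg Unordered.length (livePhantoms_of_mem (fun j => Z k j ω) hj)
    · rw [if_pos ((T ω).eq_singleton_iff.2 hj)]
      exact (if_neg hj).symm

variable [IsProbabilityMeasure P]

omit [IsProbabilityMeasure P] in
theorem map_noise (k : ℕ) :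
    P.map (fun ω v => ξ v (k + 1) ω) = Measure.infinitePi fun _ : UHLabel₁ => θ := by
  rw [iIndepFun.map_fun_eq_infinitePi_map (X := fun (v : UHLabel₁) ω => ξ v (k + 1) ω)
    (fun v => hL.measurable_noise v k) (hL.indep_noise k)]
  simp only [hL.law_noise]

/-- The live phantoms are a function of the tree and the phantoms, from which the fresh noise is
independent. -/
theorem map_noise_phantoms (k : ℕ) :
    P.map (fun ω => (fun v => ξ v (k + 1) ω, (T ω, fun v => traj X v k ω),
      livePhantoms (T ω) (fun j => Z k j ω))) =
    (Measure.infinitePi fun _ : UHLabel₁ => θ).prod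
      (P.map fun ω => ((T ω, fun v => traj X v k ω), livePhantoms (T ω) (fun j => Z k j ω))) := by
  have hφ : Measurable fun p : UHTree × (UHLabel₁ → Fin (k + 1) → 𝒳) ×
      (ℕ+ → Unordered (Fin (k + 1) → 𝒳)) => ((p.1, p.2.1), livePhantoms p.1 p.2.2) :=
    (measurable_fst.prodMk measurable_snd.fst).prodMk
      (_root_.measurable_livePhantoms.comp (measurable_fst.prodMk measurable_snd.snd))
  have h := (hL.fresh_noise k).comp measurable_id hφ
  have h2 := (indepFun_iff_map_prod_eq_prod_map_map
    (measurable_pi_lambda _ fun v => hL.measurable_noise v k).aemeasurable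
    ((hL.measurable_treeTraj k).prodMk (hL.measurable_livePhantoms k)).aemeasurable).1 h
  rw [← hL.map_noise k]
  exact h2

/-- The probability of a joint event for the phantoms, the tree and the trajectories. -/
theorem measure_phantoms (k : ℕ) {B : ℕ+ → Set (Unordered (Fin (k + 1) → 𝒳))}
    (hB : ∀ j, MeasurableSet (B j)) {H : Set (UHTree × (UHLabel₁ → Fin (k + 1) → 𝒳))}
    (hH : MeasurableSet H) :
    P ((fun ω => (T ω, fun v => traj X v k ω)) ⁻¹' H ∩
        {ω | ∀ j ∈ (T ω).rootChildren, Z k j ω ∈ B j}) =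
      ∫⁻ p in H, ENNReal.ofReal (∏ j ∈ p.1.rootChildren, (γ k (p.2 (.child j), p.2 .root)).real (B j))
        ∂(P.map fun ω => (T ω, fun v => traj X v k ω)) := by
  have := (hL.kernel k).1
  have hA : MeasurableSet {ω | ∀ j ∈ (T ω).rootChildren, Z k j ω ∈ B j} := by
    have : {ω | ∀ j ∈ (T ω).rootChildren, Z k j ω ∈ B j} =
        ⋂ j : ℕ+, {ω | [j] ∈ (T ω).1}ᶜ ∪ Z k j ⁻¹' B j := by
      ext ω
      simp [imp_iff_not_or]
    rw [this]
    exact MeasurableSet.iInter fun j =>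
      (hL.measurable_tree (UHTree.measurableSet_mem [j])).compl.union (hL.measurable_phantom k j (hB j))
  have hg : Measurable fun p : UHTree × (UHLabel₁ → Fin (k + 1) → 𝒳) =>
      ∏ j ∈ p.1.rootChildren, (γ k (p.2 (.child j), p.2 .root)).real (B j) :=
    UHTree.measurable_prod_rootChildren
      (f := fun j (x : UHLabel₁ → Fin (k + 1) → 𝒳) => (γ k (x (.child j), x .root)).real (B j))
      fun j => (Kernel.measurable_coe (γ k) (hB j)).ennreal_toReal.comp
        ((measurable_pi_apply _).prodMk (measurable_pi_apply _))
  rw [setLIntegral_map hH hg.ennreal_ofReal (hL.measurable_treeTraj k)]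
  exact (condExp_indicator_eq_iff (hL.measurable_treeTraj k) hA hg
    (fun p => Finset.prod_nonneg fun _ _ => measureReal_nonneg)
    (fun p => Finset.prod_le_one (fun _ _ => measureReal_nonneg) fun _ _ => measureReal_le_one)).1
    (hL.law_phantom k B hB) H hH

end IsLocalFieldProcess

theorem fieldState_zero {Ω 𝒳 : Type*} (T : Ω → UHTree) (X : UHLabel₁ → ℕ → Ω → 𝒳) (N : ℕ → Ω → ℕ) :
    fieldState T X N 0 =
      (fun s : UHTree × (UHLabel₁ → 𝒳) × ℕ => (s.1, (fun v (_ : Fin 1) => s.2.1 v), s.2.2)) ∘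
        (fun ω => (T ω, (fun v => X v 0 ω), N 0 ω)) := by
  ext1 ω
  refine Prod.ext rfl (Prod.ext ?_ rfl)
  ext v i
  have : i = 0 := Fin.fin_one_eq_zero i
  subst this
  rfl

/-! ### Uniqueness in law. -/

namespace IsLocalFieldProcess

variable {Ω 𝒳 Ξ : Type*} [MeasurableSpace Ω] [MeasurableSpace 𝒳] [MeasurableSpace Ξ] {P : Measure Ω}
  [IsProbabilityMeasure P]
  {ϖ : 𝒳} {F : (k : ℕ) → (Fin (k + 1) → 𝒳) → Unordered (Fin (k + 1) → 𝒳) → Ξ → 𝒳}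
  {ν : Measure (UHTree × (UHLabel₁ → 𝒳) × ℕ)} {θ : Measure Ξ}
  {T : Ω → UHTree} {X : UHLabel₁ → ℕ → Ω → 𝒳} {N : ℕ → Ω → ℕ} {ξ : UHLabel₁ → ℕ → Ω → Ξ}
  {Z : (k : ℕ) → ℕ+ → Ω → Unordered (Fin (k + 1) → 𝒳)}
  {γ : (k : ℕ) → Kernel ((Fin (k + 1) → 𝒳) × (Fin (k + 1) → 𝒳)) (Unordered (Fin (k + 1) → 𝒳))}
  (hL : IsLocalFieldProcess P ϖ F ν θ T X N ξ Z γ)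
  {Ω' : Type*} [MeasurableSpace Ω'] {P' : Measure Ω'} [IsProbabilityMeasure P']
  {T' : Ω' → UHTree} {X' : UHLabel₁ → ℕ → Ω' → 𝒳} {N' : ℕ → Ω' → ℕ} {ξ' : UHLabel₁ → ℕ → Ω' → Ξ}
  {Z' : (k : ℕ) → ℕ+ → Ω' → Unordered (Fin (k + 1) → 𝒳)}
  {γ' : (k : ℕ) → Kernel ((Fin (k + 1) → 𝒳) × (Fin (k + 1) → 𝒳)) (Unordered (Fin (k + 1) → 𝒳))}
  (hL' : IsLocalFieldProcess P' ϖ F ν θ T' X' N' ξ' Z' γ')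

include hL hL'

/-- The phantom kernels of two processes whose states have the same law agree. -/
theorem kernel_ae_eq {k : ℕ}
    (hlaw : P.map (fieldState T X N k) = P'.map (fieldState T' X' N' k))
    (hr : Integrable fieldRatio (P.map (fieldState T X N k)))
    (hpos : ∀ᵐ s ∂(P.map (fieldState T X N k)), 0 < fieldRatio s)
    {B : Set (Unordered (Fin (k + 1) → 𝒳))} (hB : MeasurableSet B) :
    ∀ᵐ ω ∂P, (γ k (traj X .root k ω, traj X (.child 1) k ω)).real B =
      (γ' k (traj X .root k ω, traj X (.child 1) k ω)).real B := by
  have := (hL.kernel k).1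
  have := (hL'.kernel k).1
  have h' := (isPhantomKernel_iff (hL'.measurable_fieldState k) (hlaw ▸ hr) (hlaw ▸ hpos) (γ' k)).1
    (hL'.kernel k)
  rw [← hlaw] at h'
  -- Since the identities depend on the law alone, `γ'` is a phantom kernel for the first process as
  -- well, and two versions of one quotient agree almost surely.
  have h := (isPhantomKernel_iff (hL.measurable_fieldState k) hr hpos (γ' k)).2 h'
  exact ((hL.kernel k).2 B hB).trans (h.2 B hB).symm

/-- The joint laws of the tree, the trajectories and the phantoms of two processes whose states have
the same law agree. -/
theorem map_livePhantoms_eq {k : ℕ}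
    (hlaw : P.map (fieldState T X N k) = P'.map (fieldState T' X' N' k))
    (hr : Integrable fieldRatio (P.map (fieldState T X N k)))
    (hpos : ∀ᵐ s ∂(P.map (fieldState T X N k)), 0 < fieldRatio s)
    (hac : ∀ (j : ℕ+) (S : Set ((Fin (k + 1) → 𝒳) × (Fin (k + 1) → 𝒳))), MeasurableSet S →
      (∀ᵐ ω ∂P, (traj X .root k ω, traj X (.child 1) k ω) ∈ S) →
      ∀ᵐ ω ∂P, [j] ∈ (T ω).1 → (traj X (.child j) k ω, traj X .root k ω) ∈ S) :
    P.map (fun ω => ((T ω, fun v => traj X v k ω), livePhantoms (T ω) (fun j => Z k j ω))) =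
      P'.map (fun ω => ((T' ω, fun v => traj X' v k ω), livePhantoms (T' ω) (fun j => Z' k j ω))) := by
  classical
  have hm := (hL.measurable_treeTraj k).prodMk (hL.measurable_livePhantoms k)
  have hm' := (hL'.measurable_treeTraj k).prodMk (hL'.measurable_livePhantoms k)
  have hlaw₂ : P.map (fun ω => (T ω, fun v => traj X v k ω)) =
      P'.map (fun ω => (T' ω, fun v => traj X' v k ω)) := by
    have hφ : Measurable fun s : UHTree × (UHLabel₁ → Fin (k + 1) → 𝒳) × ℕ => (s.1, s.2.1) :=
      measurable_fst.prodMk measurable_snd.fst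
    have := congrArg (Measure.map fun s => (s.1, s.2.1)) hlaw
    rwa [Measure.map_map hφ (hL.measurable_fieldState k),
      Measure.map_map hφ (hL'.measurable_fieldState k)] at this
  have key : ∀ B : ℕ+ → Set (Unordered (Fin (k + 1) → 𝒳)), (∀ j, MeasurableSet (B j)) →
      ∀ H, MeasurableSet H →
      P ((fun ω => (T ω, fun v => traj X v k ω)) ⁻¹' H ∩
        {ω | ∀ j ∈ (T ω).rootChildren, Z k j ω ∈ B j}) =
      P' ((fun ω => (T' ω, fun v => traj X' v k ω)) ⁻¹' H ∩
        {ω | ∀ j ∈ (T' ω).rootChildren, Z' k j ω ∈ B j}) := by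
    intro B hB H hH
    rw [hL.measure_phantoms k hB hH, hL'.measure_phantoms k hB hH, ← hlaw₂]
    refine lintegral_congr_ae (ae_restrict_of_ae ?_)
    have hg : ∀ γ : Kernel ((Fin (k + 1) → 𝒳) × (Fin (k + 1) → 𝒳)) (Unordered (Fin (k + 1) → 𝒳)),
        Measurable fun p : UHTree × (UHLabel₁ → Fin (k + 1) → 𝒳) =>
        ENNReal.ofReal (∏ j ∈ p.1.rootChildren, (γ (p.2 (.child j), p.2 .root)).real (B j)) := fun γ =>
      (UHTree.measurable_prod_rootChildren
        (f := fun j (x : UHLabel₁ → Fin (k + 1) → 𝒳) => (γ (x (.child j), x .root)).real (B j))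
        fun j => (Kernel.measurable_coe γ (hB j)).ennreal_toReal.comp
          ((measurable_pi_apply _).prodMk (measurable_pi_apply _))).ennreal_ofReal
    refine (ae_map_iff (hL.measurable_treeTraj k).aemeasurable
      (measurableSet_eq_fun (hg (γ k)) (hg (γ' k)))).2 ?_
    -- The kernels are known to agree only for the law of the root and its first child; `hac` moves
    -- this to the pairs at which the phantoms evaluate them.
    have hj : ∀ j : ℕ+, ∀ᵐ ω ∂P, [j] ∈ (T ω).1 →
        (γ k (traj X (.child j) k ω, traj X .root k ω)).real (B j) =
          (γ' k (traj X (.child j) k ω, traj X .root k ω)).real (B j) := fun j =>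
      hac j {p | (γ k p).real (B j) = (γ' k p).real (B j)}
        (measurableSet_eq_fun (Kernel.measurable_coe _ (hB j)).ennreal_toReal
          (Kernel.measurable_coe _ (hB j)).ennreal_toReal)
        (hL.kernel_ae_eq hL' hlaw hr hpos (hB j))
    filter_upwards [ae_all_iff.2 hj] with ω hω
    refine congrArg ENNReal.ofReal (Finset.prod_congr rfl fun j hjT => ?_)
    exact hω j (((T ω).mem_rootChildren j).1 hjT)
  have : IsProbabilityMeasure (P.map fun ω =>
      ((T ω, fun v => traj X v k ω), livePhantoms (T ω) (fun j => Z k j ω))) :=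
    Measure.isProbabilityMeasure_map hm.aemeasurable
  refine Measure.ext_prod fun {H E} hH hE => ?_
  rw [Measure.map_apply hm (hH.prod hE), Measure.map_apply hm' (hH.prod hE)]
  let μ := (P.restrict ((fun ω => (T ω, fun v => traj X v k ω)) ⁻¹' H)).map
    fun ω => livePhantoms (T ω) (fun j => Z k j ω)
  let μ' := (P'.restrict ((fun ω => (T' ω, fun v => traj X' v k ω)) ⁻¹' H)).map
    fun ω => livePhantoms (T' ω) (fun j => Z' k j ω)
  have hHm := hL.measurable_treeTraj k hH
  have hHm' := hL'.measurable_treeTraj k hH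
  have e : ∀ E, MeasurableSet E → μ E = P ((fun ω => ((T ω, fun v => traj X v k ω),
      livePhantoms (T ω) (fun j => Z k j ω))) ⁻¹' (H ×ˢ E)) := fun E hE => by
    rw [Measure.map_apply (hL.measurable_livePhantoms k) hE,
      Measure.restrict_apply (hL.measurable_livePhantoms k hE), Set.inter_comm]
    rfl
  have e' : ∀ E, MeasurableSet E → μ' E = P' ((fun ω => ((T' ω, fun v => traj X' v k ω),
      livePhantoms (T' ω) (fun j => Z' k j ω))) ⁻¹' (H ×ˢ E)) := fun E hE => by
    rw [Measure.map_apply (hL'.measurable_livePhantoms k) hE,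
      Measure.restrict_apply (hL'.measurable_livePhantoms k hE), Set.inter_comm]
    rfl
  rw [← e E hE, ← e' E hE]
  have huniv : μ Set.univ = μ' Set.univ := by
    rw [e _ .univ, e' _ .univ]
    have := congrArg (fun m => m H) hlaw₂
    simp only [Measure.map_apply (hL.measurable_treeTraj k) hH,
      Measure.map_apply (hL'.measurable_treeTraj k) hH] at this
    simpa [Set.mk_preimage_prod] using this
  suffices μ = μ' by rw [this]
  refine ext_of_generate_finite _ generateFrom_squareCylinders.symm
    (isPiSystem_squareCylinders (fun _ => MeasurableSpace.isPiSystem_measurableSet) (by simp)) ?_ huniv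
  rintro _ ⟨J, C, hC, rfl⟩
  have hC' : ∀ j, MeasurableSet (C j) := fun j => hC j (Set.mem_univ j)
  have hCm : MeasurableSet ((J : Set ℕ+).pi C) := MeasurableSet.pi J.countable_toSet fun j _ => hC' j
  rw [e _ hCm, e' _ hCm]
  -- A cylinder constrains finitely many labels, while the law of the phantoms is specified by one
  -- set for every child; the others get the whole space.
  let B : ℕ+ → Set (Unordered (Fin (k + 1) → 𝒳)) := fun j => if j ∈ J then C j else Set.univ
  have hB : ∀ j, MeasurableSet (B j) := fun j => by
    by_cases hj : j ∈ J
    · simpa [B, hj] using hC' j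
    · simp [B, hj]
  -- At a label that is not a vertex the live phantom is empty, so the constraint there becomes a
  -- condition on the tree.
  let D : Set (UHTree × (UHLabel₁ → Fin (k + 1) → 𝒳)) :=
    ⋂ j ∈ J, {p | [j] ∈ p.1.1} ∪ {_p | (0 : Multiset (Fin (k + 1) → 𝒳)) ∈ C j}
  have hD : MeasurableSet D := Finset.measurableSet_biInter J fun j _ =>
    (measurable_fst (UHTree.measurableSet_mem [j])).union (MeasurableSet.const _)
  have hset : ∀ (t : UHTree) (x : UHLabel₁ → Fin (k + 1) → 𝒳)
      (z : ℕ+ → Unordered (Fin (k + 1) → 𝒳)),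
      ((t, x), livePhantoms t z) ∈ H ×ˢ (J : Set ℕ+).pi C ↔
        (t, x) ∈ H ∩ D ∧ ∀ j ∈ t.rootChildren, z j ∈ B j := by
    intro t x z
    simp only [Set.mem_prod, Set.mem_inter_iff, and_assoc]
    refine and_congr_right fun _ => ?_
    simp only [Set.mem_pi, D, Set.mem_iInter, Set.mem_union, Set.mem_ofPred_eq,
      UHTree.mem_rootChildren, Finset.mem_coe]
    constructor
    · intro h
      refine ⟨fun j hj => ?_, fun j hj => ?_⟩
      · by_cases hjt : [j] ∈ t.1
        · exact Or.inl hjt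
        · exact Or.inr (livePhantoms_of_notMem z hjt ▸ h j hj)
      · by_cases hjJ : j ∈ J
        · have := h j hjJ
          rw [livePhantoms_of_mem z hj] at this
          simpa [B, hjJ] using this
        · simp [B, hjJ]
    · rintro ⟨h1, h2⟩ j hj
      by_cases hjt : [j] ∈ t.1
      · rw [livePhantoms_of_mem z hjt]
        simpa [B, hj] using h2 j hjt
      · rw [livePhantoms_of_notMem z hjt]
        exact (h1 j hj).resolve_left hjt
  have e1 : (fun ω => ((T ω, fun v => traj X v k ω), livePhantoms (T ω) (fun j => Z k j ω))) ⁻¹'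
      (H ×ˢ (J : Set ℕ+).pi C) = (fun ω => (T ω, fun v => traj X v k ω)) ⁻¹' (H ∩ D) ∩
        {ω | ∀ j ∈ (T ω).rootChildren, Z k j ω ∈ B j} := by
    ext ω
    exact hset _ _ _
  have e2 : (fun ω => ((T' ω, fun v => traj X' v k ω), livePhantoms (T' ω) (fun j => Z' k j ω))) ⁻¹'
      (H ×ˢ (J : Set ℕ+).pi C) = (fun ω => (T' ω, fun v => traj X' v k ω)) ⁻¹' (H ∩ D) ∩
        {ω | ∀ j ∈ (T' ω).rootChildren, Z' k j ω ∈ B j} := by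
    ext ω
    exact hset _ _ _
  rw [e1, e2]
  exact key B hB _ (hH.inter hD)

/-- The law of a local-field process is determined by its initial law and by the law of the noise. -/
theorem map_fieldState_eq
    (hF : ∀ k, Measurable
      (fun q : (Fin (k + 1) → 𝒳) × Unordered (Fin (k + 1) → 𝒳) × Ξ => F k q.1 q.2.1 q.2.2))
    (hr : ∀ k, Integrable fieldRatio (P.map (fieldState T X N k)))
    (hpos : ∀ k, ∀ᵐ s ∂(P.map (fieldState T X N k)), 0 < fieldRatio s)
    (hac : ∀ (k : ℕ) (j : ℕ+) (S : Set ((Fin (k + 1) → 𝒳) × (Fin (k + 1) → 𝒳))), MeasurableSet S →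
      (∀ᵐ ω ∂P, (traj X .root k ω, traj X (.child 1) k ω) ∈ S) →
      ∀ᵐ ω ∂P, [j] ∈ (T ω).1 → (traj X (.child j) k ω, traj X .root k ω) ∈ S) (k : ℕ) :
    P.map (fieldState T X N k) = P'.map (fieldState T' X' N' k) := by
  induction k with
  | zero =>
    have hφ : Measurable fun s : UHTree × (UHLabel₁ → 𝒳) × ℕ =>
        (s.1, (fun v (_ : Fin 1) => s.2.1 v), s.2.2) :=
      measurable_fst.prodMk ((measurable_pi_lambda _ fun v => measurable_pi_lambda _ fun _ =>
        (measurable_pi_apply v).comp measurable_snd.fst).prodMk measurable_snd.snd)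
    have h1 : Measurable fun ω => (T ω, (fun v => X v 0 ω), N 0 ω) :=
      hL.measurable_tree.prodMk ((measurable_pi_lambda _ fun v => hL.measurable_state v 0).prodMk
        (hL.measurable_count 0))
    have h2 : Measurable fun ω => (T' ω, (fun v => X' v 0 ω), N' 0 ω) :=
      hL'.measurable_tree.prodMk ((measurable_pi_lambda _ fun v => hL'.measurable_state v 0).prodMk
        (hL'.measurable_count 0))
    have h := congrArg (Measure.map fun s : UHTree × (UHLabel₁ → 𝒳) × ℕ =>
        (s.1, (fun v (_ : Fin 1) => s.2.1 v), s.2.2)) (hL.law_init.trans hL'.law_init.symm)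
    rw [Measure.map_map hφ h1, Measure.map_map hφ h2] at h
    rw [fieldState_zero, fieldState_zero]
    exact h
  | succ k ih =>
    have h1 := hL.map_livePhantoms_eq hL' ih (hr k) (hpos k) (hac k)
    have h2 := hL.map_noise_phantoms k
    rw [h1, ← hL'.map_noise_phantoms k] at h2
    have hΨ := measurable_localFieldStep ϖ (hF k)
    have hm : Measurable fun ω => (fun v => ξ v (k + 1) ω, (T ω, fun v => traj X v k ω),
        livePhantoms (T ω) (fun j => Z k j ω)) :=
      (measurable_pi_lambda _ fun v => hL.measurable_noise v k).prodMk
        ((hL.measurable_treeTraj k).prodMk (hL.measurable_livePhantoms k))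
    have hm' : Measurable fun ω => (fun v => ξ' v (k + 1) ω, (T' ω, fun v => traj X' v k ω),
        livePhantoms (T' ω) (fun j => Z' k j ω)) :=
      (measurable_pi_lambda _ fun v => hL'.measurable_noise v k).prodMk
        ((hL'.measurable_treeTraj k).prodMk (hL'.measurable_livePhantoms k))
    rw [Measure.map_congr (hL.fieldState_succ k), Measure.map_congr (hL'.fieldState_succ k)]
    have h3 := congrArg (Measure.map (localFieldStep ϖ F)) h2
    rw [Measure.map_map hΨ hm, Measure.map_map hΨ hm'] at h3
    exact h3

end IsLocalFieldProcess

/-! ### Absolute continuity between neighboring pairs. -/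

namespace UGWCondition

variable {Ω 𝒳 Ξ : Type*} {ϖ : 𝒳} {ρ₀ ρ : PMF ℕ} {T : Ω → UHTree} {X : UHLabel → ℕ → Ω → 𝒳}
  {ξ : UHLabel → ℕ → Ω → Ξ}
  {F : (k : ℕ) → (Fin (k + 1) → 𝒳) → Unordered (Fin (k + 1) → 𝒳) → Ξ → 𝒳}
  [MeasurableSpace Ω] [MeasurableSpace 𝒳] [MeasurableSpace Ξ] {P : Measure Ω}
  [IsProbabilityMeasure P]
  (hcond : UGWCondition P ϖ ρ₀ ρ T X ξ F) (hX : IsParticleSystem ϖ T X ξ F)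

include hcond hX

/-- The law of the trajectories at a child of the root and at the root is absolutely continuous with
respect to the law of the trajectories at the root and at its first child. -/
theorem ae_child_root_of_ae_root_child (k : ℕ) (j : ℕ+)
    {S : Set ((Fin (k + 1) → 𝒳) × (Fin (k + 1) → 𝒳))} (hS : MeasurableSet S)
    (h : ∀ᵐ ω ∂P, (traj X [] k ω, traj X [1] k ω) ∈ S) :
    ∀ᵐ ω ∂P, [j] ∈ (T ω).1 → (traj X [j] k ω, traj X [] k ω) ∈ S := by
  let f : (Fin (k + 1) → 𝒳) × (Fin (k + 1) → 𝒳) × Unordered (Fin (k + 1) → 𝒳) → ℝ≥0∞ :=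
    fun p => Sᶜ.indicator 1 (p.1, p.2.1)
  have hf : Measurable f := (measurable_one.indicator hS.compl).comp
    (measurable_fst.prodMk measurable_snd.fst)
  -- The left side integrates a weight over a null event, so the right side shows that the exchanged
  -- pair at the first child almost surely lies in `S`.
  have h1 := hcond.setLIntegral_ratio hX hf (C := 1) fun p => by
    rw [ENNReal.coe_one]
    exact Set.indicator_le' (fun _ _ => le_rfl) (fun _ _ => zero_le) _
  have h2 : ∫⁻ ω in {ω | [1] ∈ (T ω).1}, f (traj X [] k ω, traj X [1] k ω, siteNbhd T X k [] ω) *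
        ENNReal.ofReal (ratio ((T ω).nbhd []).card ((T ω).nbhd [1]).card) ∂P = 0 := by
    refine (lintegral_congr_ae (ae_restrict_of_ae ?_)).trans lintegral_zero
    filter_upwards [h] with ω hω
    simp [f, hω]
  rw [h2] at h1
  let q : PairState 𝒳 k → ℝ≥0∞ := fun p => Sᶜ.indicator 1 (p.2.1, p.1)
  have hq : Measurable q := (measurable_one.indicator hS.compl).comp
    (measurable_snd.fst.prodMk measurable_fst)
  -- For each number of children, exchangeability passes from the first child to `[j]`.
  have h3 : ∀ n : ℕ, (j : ℕ) ≤ n → ∀ᵐ ω ∂P, ((T ω).nbhd []).card = n →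
      (traj X [j] k ω, traj X [] k ω) ∈ S := by
    intro n hn
    have h4 : ∫⁻ ω in {ω | ((T ω).nbhd []).card = n}, q (pairAt T X k [] [j] ω) ∂P = 0 := by
      rw [hcond.setLIntegral_pairAt_child hX hq hn, ← nonpos_iff_eq_zero, h1]
      refine lintegral_mono_set fun ω hω => ((T ω).singleton_mem_iff 1).2 ?_
      rw [show ((T ω).nbhd []).card = n from hω]
      exact j.pos.trans_le hn
    have hqj : Measurable fun ω => q (pairAt T X k [] [j] ω) :=
      hq.comp (hcond.measurable_pairAt hX k [] [j])
    rw [lintegral_eq_zero_iff hqj] at h4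
    filter_upwards [(ae_restrict_iff' (hcond.measurableSet_card n)).1 h4] with ω h5 hω
    have h6 : Sᶜ.indicator (1 : _ × _ → ℝ≥0∞) (traj X [j] k ω, traj X [] k ω) = 0 := h5 hω
    by_contra hc
    rw [Set.indicator_of_mem (by exact hc)] at h6
    exact one_ne_zero h6
  have h7 : ∀ n : ℕ, ∀ᵐ ω ∂P, (j : ℕ) ≤ n → ((T ω).nbhd []).card = n →
      (traj X [j] k ω, traj X [] k ω) ∈ S := by
    intro n
    by_cases hn : (j : ℕ) ≤ n
    · filter_upwards [h3 n hn] with ω hω _ using hω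
    · exact .of_forall fun ω h => absurd h hn
  filter_upwards [ae_all_iff.2 h7] with ω hω hj
  exact hω _ (((T ω).singleton_mem_iff j).1 hj) rfl

end UGWCondition

/-! ### Laws of whole paths and the conclusion. -/

/-- A law on families of marked sequences is determined by the laws of the initial segments. -/
theorem MeasureTheory.Measure.ext_of_map_initialSegments {ι A E : Type*} [MeasurableSpace A]
    [MeasurableSpace E] {μ μ' : Measure (ι → A × (ℕ → E))} [IsFiniteMeasure μ]
    (h : ∀ k, μ.map (fun g v => ((g v).1, fun i : Fin (k + 1) => (g v).2 i)) =
      μ'.map (fun g v => ((g v).1, fun i : Fin (k + 1) => (g v).2 i))) : μ = μ' := by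
  let r : (k : ℕ) → (ι → A × (ℕ → E)) → ι → A × (Fin (k + 1) → E) :=
    fun k g v => ((g v).1, fun i => (g v).2 i)
  have hr : ∀ k, Measurable (r k) := fun k => measurable_pi_lambda _ fun v =>
    (measurable_pi_apply v).fst.prodMk (measurable_pi_lambda _ fun i =>
      (measurable_pi_apply (i : ℕ)).comp (measurable_pi_apply v).snd)
  have hμ : ∀ k S, MeasurableSet S → μ (r k ⁻¹' S) = μ' (r k ⁻¹' S) := by
    intro k S hS
    rw [← Measure.map_apply (hr k) hS, ← Measure.map_apply (hr k) hS, h k]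
  let C : Set (Set (ι → A × (ℕ → E))) := {B | ∃ k S, MeasurableSet S ∧ B = r k ⁻¹' S}
  refine ext_of_generate_finite C (le_antisymm ?_ ?_) ?_ ?_ ?_
  · let m := MeasurableSpace.generateFrom C
    have hrC : ∀ k, Measurable[m] (r k) := fun k S hS =>
      MeasurableSpace.measurableSet_generateFrom ⟨k, S, hS, rfl⟩
    have hfst : ∀ v, Measurable fun g : ι → A × (Fin (0 + 1) → E) => (g v).1 := fun v =>
      (measurable_pi_apply v).fst
    have hlast : ∀ k v, Measurable fun g : ι → A × (Fin (k + 1) → E) => (g v).2 (Fin.last k) :=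
      fun k v => (measurable_pi_apply (Fin.last k)).comp (measurable_pi_apply v).snd
    have hid : @Measurable _ _ m MeasurableSpace.pi (id : (ι → A × (ℕ → E)) → ι → A × (ℕ → E)) := by
      refine @measurable_pi_lambda _ _ _ m _ _ fun v => ?_
      change @Measurable _ _ m _ fun g : ι → A × (ℕ → E) => ((g v).1, (g v).2)
      refine Measurable.prodMk ?_ ?_
      · exact (hfst v).comp (hrC 0)
      · exact @measurable_pi_lambda _ _ _ m _ _ fun k => (hlast k v).comp (hrC k)
    exact fun S hS => @hid S hS
  · refine MeasurableSpace.generateFrom_le ?_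
    rintro _ ⟨k, S, hS, rfl⟩
    exact hr k hS
  -- An event about a shorter initial segment is one about a longer segment, so intersections are
  -- formed at the larger of the two times.
  · have hmono : ∀ {k l : ℕ}, k ≤ l → ∀ S, MeasurableSet S → ∃ S', MeasurableSet S' ∧
        r k ⁻¹' S = r l ⁻¹' S' := by
      intro k l hkl S hS
      let s : (ι → A × (Fin (l + 1) → E)) → ι → A × (Fin (k + 1) → E) :=
        fun g v => ((g v).1, fun i => (g v).2 (Fin.castLE (by omega) i))
      have hs : Measurable s := measurable_pi_lambda _ fun v =>
        (measurable_pi_apply v).fst.prodMk (measurable_pi_lambda _ fun i =>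
          (measurable_pi_apply _).comp (measurable_pi_apply v).snd)
      exact ⟨s ⁻¹' S, hs hS, rfl⟩
    rintro _ ⟨k, S, hS, rfl⟩ _ ⟨l, S', hS', rfl⟩ -
    obtain ⟨U, hU, e⟩ := hmono (le_max_left k l) S hS
    obtain ⟨U', hU', e'⟩ := hmono (le_max_right k l) S' hS'
    exact ⟨max k l, U ∩ U', hU.inter hU', by rw [e, e', Set.preimage_inter]⟩
  · rintro _ ⟨k, S, hS, rfl⟩
    exact hμ k S hS
  · exact hμ 0 Set.univ .univ

theorem theorem2p10 {Ω : Type u} {𝒳 : Type*} {Ξ : Type*} [MeasurableSpace Ω]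
    [TopologicalSpace 𝒳] [PolishSpace 𝒳] [MeasurableSpace 𝒳] [BorelSpace 𝒳]
    [TopologicalSpace Ξ] [PolishSpace Ξ] [MeasurableSpace Ξ] [BorelSpace Ξ]
    (P : Measure Ω) [IsProbabilityMeasure P]
    (ϖ : 𝒳) (hϖ : IsOpen ({ϖ} : Set 𝒳)) (ρ₀ ρ : PMF ℕ)
    (T : Ω → UHTree) (X : UHLabel → ℕ → Ω → 𝒳) (ξ : UHLabel → ℕ → Ω → Ξ)
    (F : (k : ℕ) → (Fin (k + 1) → 𝒳) → Unordered (Fin (k + 1) → 𝒳) → Ξ → 𝒳)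
    (hcond : UGWCondition P ϖ ρ₀ ρ T X ξ F) (hX : IsParticleSystem ϖ T X ξ F)
    (ν : Measure (UHTree × (UHLabel₁ → 𝒳) × ℕ))
    (hν : ν = P.map (fun ω => ((T ω).trunc₁, fun v => X v.1 0 ω, ((T ω).nbhd [1]).card)))
    (θ : Measure Ξ) (hθ : θ = P.map (ξ [] 1)) :
    -- the construction can be carried out
    (∃ (Ω' : Type u) (_ : MeasurableSpace Ω') (P' : Measure Ω') (_ : IsProbabilityMeasure P')
        (T' : Ω' → UHTree) (X' : UHLabel₁ → ℕ → Ω' → 𝒳) (N' : ℕ → Ω' → ℕ)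
        (ξ' : UHLabel₁ → ℕ → Ω' → Ξ) (Z' : (k : ℕ) → ℕ+ → Ω' → Unordered (Fin (k + 1) → 𝒳))
        (γ' : (k : ℕ) →
          Kernel ((Fin (k + 1) → 𝒳) × (Fin (k + 1) → 𝒳)) (Unordered (Fin (k + 1) → 𝒳))),
        IsLocalFieldProcess P' ϖ F ν θ T' X' N' ξ' Z' γ') ∧
    -- and all its realizations have the asserted laws
    (∀ (Ω' : Type w) (_ : MeasurableSpace Ω') (P' : Measure Ω') (_ : IsProbabilityMeasure P')
        (T' : Ω' → UHTree) (X' : UHLabel₁ → ℕ → Ω' → 𝒳) (N' : ℕ → Ω' → ℕ)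
        (ξ' : UHLabel₁ → ℕ → Ω' → Ξ) (Z' : (k : ℕ) → ℕ+ → Ω' → Unordered (Fin (k + 1) → 𝒳))
        (γ' : (k : ℕ) →
          Kernel ((Fin (k + 1) → 𝒳) × (Fin (k + 1) → 𝒳)) (Unordered (Fin (k + 1) → 𝒳))),
        IsLocalFieldProcess P' ϖ F ν θ T' X' N' ξ' Z' γ' →
        (∀ k : ℕ, IdentDistrib
          (fun ω => ((fun v : UHLabel₁ => (v.1 ∈ (T ω).1, traj (fun v => X v) v.1 k ω)),
            ((T ω).nbhd [1]).card))
          (fun ω' => ((fun v : UHLabel₁ => (v.1 ∈ (T' ω').1, traj X' v k ω')), N' k ω'))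
          P P') ∧
        IdentDistrib
          (fun ω (v : UHLabel₁) => (v.1 ∈ (T ω).1, fun k : ℕ => X v.1 k ω))
          (fun ω' (v : UHLabel₁) => (v.1 ∈ (T' ω').1, fun k : ℕ => X' v k ω')) P P') := by
  have hϖm : MeasurableSet ({ϖ} : Set 𝒳) := hϖ.measurableSet
  choose κ hκM hκ using fun k => hcond.exists_isSubtreeKernel hX k
  have hL := hcond.isLocalFieldProcess hX hϖm hκ
  rw [← hν, ← hθ] at hL
  -- The particle system itself is the witness, and it is the process with which every other
  -- realization is compared below.
  refine ⟨⟨Ω, _, P, inferInstance, _, _, _, _, _, _, hL⟩, ?_⟩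
  intro Ω' _ P' _ T' X' N' ξ' Z' γ' hL'
  have e : ∀ k, (fieldRatio ∘ fieldState (fun ω => (T ω).trunc₁) (fun v : UHLabel₁ => X v.1)
      (fun _ ω => ((T ω).nbhd [1]).card) k) =
        fun ω => ratio ((T ω).nbhd []).card ((T ω).nbhd [1]).card := by
    intro k
    ext1 ω
    simp only [Function.comp_apply, fieldRatio, fieldState, UHTree.card_nbhd_root_trunc₁]
  have hlaw := hL.map_fieldState_eq hL' hcond.measurable_update
    (fun k => (integrable_map_measure measurable_fieldRatio.aestronglyMeasurable
      (hL.measurable_fieldState k).aemeasurable).2 (by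
        rw [e k]
        exact hcond.integrable_ratio_card hX))
    (fun k => (ae_map_iff (hL.measurable_fieldState k).aemeasurable
      (measurableSet_lt measurable_const measurable_fieldRatio)).2 (.of_forall fun ω => by
        rw [show fieldRatio _ = _ from congrFun (e k) ω]
        exact UGWCondition.ratio_card_pos ω))
    (fun k j S hS h => by
      filter_upwards [hcond.ae_child_root_of_ae_root_child hX k j hS h] with ω hω hj
      exact hω (((T ω).child_mem_trunc₁ j).1 hj))
  have hφ : ∀ k, Measurable fun s : UHTree × (UHLabel₁ → Fin (k + 1) → 𝒳) × ℕ =>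
      ((fun v : UHLabel₁ => (v.1 ∈ s.1.1, s.2.1 v)), s.2.2) := fun k =>
    (measurable_pi_lambda _ fun v : UHLabel₁ => ((UHTree.measurable_mem v.1).comp measurable_fst).prodMk
      ((measurable_pi_apply v).comp measurable_snd.fst)).prodMk measurable_snd.snd
  have hmem : ∀ (v : UHLabel₁) ω, (v.1 ∈ (T ω).trunc₁.1) = (v.1 ∈ (T ω).1) := fun v ω =>
    propext ((T ω).mem_trunc₁ v)
  have hid : ∀ k : ℕ, IdentDistrib
      (fun ω => ((fun v : UHLabel₁ => (v.1 ∈ (T ω).1, traj (fun v => X v) v.1 k ω)),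
        ((T ω).nbhd [1]).card))
      (fun ω' => ((fun v : UHLabel₁ => (v.1 ∈ (T' ω').1, traj X' v k ω')), N' k ω')) P P' := by
    intro k
    have e1 : (fun ω => ((fun v : UHLabel₁ => (v.1 ∈ (T ω).1, traj (fun v => X v) v.1 k ω)),
        ((T ω).nbhd [1]).card)) = (fun s : UHTree × (UHLabel₁ → Fin (k + 1) → 𝒳) × ℕ =>
          ((fun v : UHLabel₁ => (v.1 ∈ s.1.1, s.2.1 v)), s.2.2)) ∘
        fieldState (fun ω => (T ω).trunc₁) (fun v : UHLabel₁ => X v.1)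
          (fun _ ω => ((T ω).nbhd [1]).card) k := by
      ext1 ω
      simp only [Function.comp_apply, fieldState, hmem]
      rfl
    refine ⟨?_, ((hφ k).comp (hL'.measurable_fieldState k)).aemeasurable, ?_⟩
    · rw [e1]
      exact ((hφ k).comp (hL.measurable_fieldState k)).aemeasurable
    · rw [e1, ← Measure.map_map (hφ k) (hL.measurable_fieldState k), hlaw k,
        Measure.map_map (hφ k) (hL'.measurable_fieldState k)]
      rfl
  refine ⟨hid, ?_⟩
  have hm : Measurable fun ω (v : UHLabel₁) => (v.1 ∈ (T ω).1, fun k : ℕ => X v.1 k ω) :=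
    measurable_pi_lambda _ fun v => ((UHTree.measurable_mem v.1).comp hcond.measurable_tree).prodMk
      (measurable_pi_lambda _ fun k => hL.measurable_state v k)
  have hm' : Measurable fun ω' (v : UHLabel₁) => (v.1 ∈ (T' ω').1, fun k : ℕ => X' v k ω') :=
    measurable_pi_lambda _ fun v => ((UHTree.measurable_mem v.1).comp hL'.measurable_tree).prodMk
      (measurable_pi_lambda _ fun k => hL'.measurable_state v k)
  refine ⟨hm.aemeasurable, hm'.aemeasurable, ?_⟩
  have := Measure.isProbabilityMeasure_map (μ := P) hm.aemeasurable
  refine Measure.ext_of_map_initialSegments fun k => ?_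
  have hr : Measurable fun (g : UHLabel₁ → Prop × (ℕ → 𝒳)) (v : UHLabel₁) =>
      ((g v).1, fun i : Fin (k + 1) => (g v).2 i) :=
    measurable_pi_lambda _ fun v => (measurable_pi_apply v).fst.prodMk
      (measurable_pi_lambda _ fun i => (measurable_pi_apply (i : ℕ)).comp (measurable_pi_apply v).snd)
  rw [Measure.map_map hr hm, Measure.map_map hr hm']
  exact ((hid k).comp measurable_fst).map_eq
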